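/- Let $K\subset\mathbb R^3$ be a nondegenerate tetrahedron with vertex set $\mathcal V(K)$, set of (six) edges $\mathcal E(K)$ and set of (four) faces $\mathcal F(K)$. Let $k\ge 3$. For each face $F$ let $\mathbf n=\mathbf n_F$ be the unit outer normal. For each edge $e$ fix a unit tangent vector $\mathbf t_e$ and two linearly independent unit normal vectors $\mathbf n_1,\mathbf n_2$. Let $P_l(G)$, $P_l(G;\mathbb R^3)$, $P_l(G;\mathbb S)$ denote the polynomials of total degree at most $l$ on $G$ with values in $\mathbb R$, $\mathbb R^3$ and the symmetric $3\times3$ matrices, and $(\cdot,\cdot)_G$ the $L^2$ inner product over $G$. The operators $\nabla$ (of vector fields), $\mathbf{div}$, $\mathbf{curl}$ act row-wise, and $\mathbf{curl}^*$ is $\mathbf{curl}$ applied column-wise. Let $RM$ be the 6-dimensional space of rigid motions, $\Lambda_F(\boldsymbol\tau)=(I-\mathbf n\mathbf n^{\intercal})\boldsymbol\tau(I-\mathbf n\mathbf n^{\intercal})|_F$, and put $$W_k=\{\boldsymbol\phi\in P_k(K;\mathbb R^3):\ \boldsymbol\phi\times\mathbf n|_F=0\ \ \forall F\in\mathcal F(K)\},$$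 $$\mathcal W_{k-1}=\mathbf{curl}\,W_k/RM:=\{\mathbf w\in\mathbf{curl}\,W_k:\ (\mathbf w,\mathbf r)_K=0\ \ \forall\,\mathbf r\in RM\},$$ $$M_{k+2}=\{\boldsymbol\tau\in P_{k+2}(K;\mathbb S):\ \Lambda_F(\boldsymbol\tau)=0,\ \ (\mathbf{curl}\,\mathbf{curl}^*\boldsymbol\tau)\,\mathbf n|_F=0\ \ \forall F\in\mathcal F(K)\},\qquad \mathcal M_k=\mathbf{curl}\,\mathbf{curl}^*M_{k+2}.$$ **Theorem.** The degrees of freedom 1. $\boldsymbol\sigma(a)$ for $a\in\mathcal V(K)$; 2. $(\mathbf t_e^{\intercal}\boldsymbol\sigma\mathbf n_j,q)_e$ for $1\le j\le 2$ and $(\mathbf n_i^{\intercal}\boldsymbol\sigma\mathbf n_j,q)_e$ for $1\le i\le j\le2$, $q\in P_{k-2}(e)$, $e\in\mathcal E(K)$; 3. $(\boldsymbol\sigma\mathbf n,\boldsymbol\phi)_F$ for $\boldsymbol\phi\in P_{k-3}(F;\mathbb R^3)$, $F\in\mathcal F(K)$; 4. $(\mathbf{div}\,\boldsymbol\sigma\cdot\mathbf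 n,q)_F$ for $q\in P_{k-1}(F)$, $F\in\mathcal F(K)$; 5. $(\boldsymbol\sigma,\boldsymbol\eta)_K$ for $\boldsymbol\eta\in\nabla^2P_{k-2}(K)$; 6. $(\boldsymbol\sigma,\nabla\boldsymbol\phi)_K$ for $\boldsymbol\phi\in\mathcal W_{k-1}$; 7. $(\boldsymbol\sigma,\boldsymbol\tau)_K$ for $\boldsymbol\tau\in\mathcal M_k$ are unisolvent for $P_k(K;\mathbb S)$: for every choice of a symmetric matrix at each vertex and of a linear functional on each of the test spaces in 2–7 there is exactly one $\boldsymbol\sigma\in P_k(K;\mathbb S)$ whose degrees of freedom have these values. The number of degrees of freedom (six per vertex, plus the dimensions of all the test spaces) and $\dim P_k(K;\mathbb S)$ are both equal to $(k+1)(k+2)(k+3)$. Moreover, if in 7 the space $\mathcal M_k$ is replaced by the larger space $\mathbf{curl}\,\mathbf{curl}^*\{\boldsymbol\tau\in P_{k+2}(K;\mathbb S):\Lambda_F(\boldsymbol\tau)=0\ \ \forall F\in\mathcal F(K)\}$, then two elements of $P_k(K;\mathbb S)$ with the same values in 1–7 are still equal. -/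

import Mathlib

open scoped Matrix

namespace DivDivElement

noncomputable section

/-- Points (and vectors) of three-dimensional space, in Cartesian coordinates. Lengths and angles are
always expressed through the dot product. -/
abbrev Pt := Fin 3 → ℝ

/-- Real polynomials in the Cartesian coordinates of three-dimensional space. A tetrahedron has
nonempty interior, so these are the same thing as polynomial functions on it. -/
abbrev Poly := MvPolynomial (Fin 3) ℝ

/-- Symmetric `3 × 3` matrices with entries in `R`. -/
def symMat (R : Type) [CommRing R] [Algebra ℝ R] : Submodule ℝ (Matrix (Fin 3) (Fin 3) R) where
  carrier := {A | Aᵀ = A}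
  add_mem' {A B} hA hB := by
    simp only [Set.mem_ofPred_eq, Matrix.transpose_add] at *
    rw [hA, hB]
  zero_mem' := Matrix.transpose_zero
  smul_mem' c A hA := by
    simp only [Set.mem_ofPred_eq, Matrix.transpose_smul] at *
    rw [hA]

/-- `P_l(K)`: polynomials of total degree at most `l`. -/
abbrev scalarPoly (l : ℕ) : Submodule ℝ Poly := MvPolynomial.restrictTotalDegree (Fin 3) ℝ l

/-- `P_l(K; ℝ³)`. -/
def vecPoly (l : ℕ) : Submodule ℝ (Fin 3 → Poly) where
  carrier := {φ | ∀ i, φ i ∈ scalarPoly l}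
  add_mem' hA hB i := (scalarPoly l).add_mem (hA i) (hB i)
  zero_mem' _ := (scalarPoly l).zero_mem
  smul_mem' c _ hA i := (scalarPoly l).smul_mem c (hA i)

/-- `P_l(K; 𝕊)`: symmetric matrices of polynomials of total degree at most `l`. -/
def symPoly (l : ℕ) : Submodule ℝ (Matrix (Fin 3) (Fin 3) Poly) where
  carrier := {τ | τ ∈ symMat Poly ∧ ∀ i j, τ i j ∈ scalarPoly l}
  add_mem' hA hB :=
    ⟨(symMat Poly).add_mem hA.1 hB.1, fun i j => (scalarPoly l).add_mem (hA.2 i j) (hB.2 i j)⟩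
  zero_mem' := ⟨(symMat Poly).zero_mem, fun _ _ => (scalarPoly l).zero_mem⟩
  smul_mem' c _ hA :=
    ⟨(symMat Poly).smul_mem c hA.1, fun i j => (scalarPoly l).smul_mem c (hA.2 i j)⟩

/-- Value of a polynomial vector field at a point. -/
def evalVec (x : Pt) (φ : Fin 3 → Poly) : Pt := fun i => MvPolynomial.eval x (φ i)

/-- Value of a polynomial matrix field at a point. -/
def evalMat (x : Pt) (τ : Matrix (Fin 3) (Fin 3) Poly) : Matrix (Fin 3) (Fin 3) ℝ :=
  τ.map (MvPolynomial.eval x)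

/-! ### Differential operators -/

/-- Gradient of a vector field, applied row-wise: `(∇φ)ᵢⱼ = ∂ⱼ φᵢ`. -/
def grad (φ : Fin 3 → Poly) : Matrix (Fin 3) (Fin 3) Poly :=
  Matrix.of fun i j => MvPolynomial.pderiv j (φ i)

/-- Hessian of a scalar polynomial. -/
def hess : Poly →ₗ[ℝ] Matrix (Fin 3) (Fin 3) Poly where
  toFun q := Matrix.of fun i j => MvPolynomial.pderiv j (MvPolynomial.pderiv i q)
  map_add' p q := by ext1 i j; simp
  map_smul' c q := by ext1 i j; simp

/-- Row-wise divergence of a matrix field. -/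
def divMat (τ : Matrix (Fin 3) (Fin 3) Poly) : Fin 3 → Poly :=
  fun i => ∑ j, MvPolynomial.pderiv j (τ i j)

/-- `curl` of a vector field. -/
def curl : (Fin 3 → Poly) →ₗ[ℝ] (Fin 3 → Poly) where
  toFun φ := ![MvPolynomial.pderiv 1 (φ 2) - MvPolynomial.pderiv 2 (φ 1),
    MvPolynomial.pderiv 2 (φ 0) - MvPolynomial.pderiv 0 (φ 2),
    MvPolynomial.pderiv 0 (φ 1) - MvPolynomial.pderiv 1 (φ 0)]
  map_add' φ ψ := by
    ext1 i
    fin_cases i <;> simp <;> ring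
  map_smul' c φ := by
    ext1 i
    fin_cases i <;> simp [smul_sub]

/-- `curl` of a matrix field, applied row-wise. -/
def curlRow : Matrix (Fin 3) (Fin 3) Poly →ₗ[ℝ] Matrix (Fin 3) (Fin 3) Poly where
  toFun τ := Matrix.of fun i => curl (τ i)
  map_add' σ τ := by
    ext1 i j
    have h : (σ + τ) i = σ i + τ i := rfl
    simp [h]
  map_smul' c τ := by
    ext1 i j
    have h : (c • τ) i = c • τ i := rfl
    simp [h]

/-- `curl*` of a matrix field: `curl` applied column-wise. -/
def curlCol : Matrix (Fin 3) (Fin 3) Poly →ₗ[ℝ] Matrix (Fin 3) (Fin 3) Poly where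
  toFun τ := (curlRow τᵀ)ᵀ
  map_add' σ τ := by simp
  map_smul' c τ := by simp

/-- The second order operator `curl curl*`. -/
def curlCurlStar : Matrix (Fin 3) (Fin 3) Poly →ₗ[ℝ] Matrix (Fin 3) (Fin 3) Poly :=
  curlRow ∘ₗ curlCol

/-! ### The tetrahedron, its faces and its edges -/

/-- The closed tetrahedron with vertices `a 0, …, a 3`. -/
def tet (a : Fin 4 → Pt) : Set Pt := convexHull ℝ (Set.range a)

/-- The closed face opposite to the vertex `a i`. -/
def face (a : Fin 4 → Pt) (i : Fin 4) : Set Pt := convexHull ℝ (a '' {i}ᶜ)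

/-- The six edges, each listed once. -/
abbrev Edge := {e : Fin 4 × Fin 4 // e.1 < e.2}

/-- The vector along an edge. -/
def edgeVec (a : Fin 4 → Pt) (e : Edge) : Pt := a e.1.2 - a e.1.1

/-- The closed edge `e`. -/
def edge (a : Fin 4 → Pt) (e : Edge) : Set Pt := segment ℝ (a e.1.1) (a e.1.2)

/-- `m` is the unit outer normal of the face opposite to the vertex `a i`. -/
def IsOuterNormal (a : Fin 4 → Pt) (i : Fin 4) (m : Pt) : Prop :=
  m ⬝ᵥ m = 1 ∧ (∀ j l, j ≠ i → l ≠ i → m ⬝ᵥ (a j - a l) = 0) ∧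
    ∀ j, j ≠ i → m ⬝ᵥ (a i - a j) < 0

/-- `t` is a unit tangent vector of the edge `e`. -/
def IsEdgeTangent (a : Fin 4 → Pt) (e : Edge) (t : Pt) : Prop :=
  t ⬝ᵥ t = 1 ∧ ∃ c : ℝ, t = c • edgeVec a e

/-- `ν 0, ν 1` are two (linearly independent) unit normal vectors of the edge `e`. -/
def AreEdgeNormals (a : Fin 4 → Pt) (e : Edge) (ν : Fin 2 → Pt) : Prop :=
  (∀ i, ν i ⬝ᵥ ν i = 1) ∧ (∀ i, ν i ⬝ᵥ edgeVec a e = 0) ∧ LinearIndependent ℝ ν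

/-! ### Integrals -/

/-- The integral of a polynomial over the tetrahedron, with respect to Lebesgue measure. -/
def integralK (a : Fin 4 → Pt) : Poly →ₗ[ℝ] ℝ where
  toFun p := ∫ x in tet a, MvPolynomial.eval x p
  map_add' p q := by
    have h : ∀ r : Poly, MeasureTheory.IntegrableOn (fun x => MvPolynomial.eval x r) (tet a) :=
      fun r => (MvPolynomial.continuous_eval r).continuousOn.integrableOn_compact
        ((Set.finite_range a).isCompact_convexHull ℝ)
    simp only [map_add]
    exact MeasureTheory.integral_add (h p) (h q)
  map_smul' c p := by
    simp only [MvPolynomial.smul_eval, RingHom.id_apply, smul_eq_mul]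
    exact MeasureTheory.integral_const_mul c _

/-- `(u, v)_K` for vector fields. -/
def innerVecK (a : Fin 4 → Pt) (u v : Fin 3 → Poly) : ℝ := integralK a (u ⬝ᵥ v)

/-- `(σ, τ)_K` for matrix fields, with the Frobenius product of matrices. -/
def innerMatK (a : Fin 4 → Pt) (σ τ : Matrix (Fin 3) (Fin 3) Poly) : ℝ :=
  integralK a (∑ i, ∑ j, σ i j * τ i j)

/-- The integral over an edge with respect to arc length. -/
def integralE (a : Fin 4 → Pt) (e : Edge) (f : Pt → ℝ) : ℝ :=
  ∫ s in (0 : ℝ)..1, f (a e.1.1 + s • edgeVec a e) * √(edgeVec a e ⬝ᵥ edgeVec a e)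

/-- The reference triangle that parametrizes the faces. -/
def refTriangle : Set (ℝ × ℝ) := {p | 0 ≤ p.1 ∧ 0 ≤ p.2 ∧ p.1 + p.2 ≤ 1}

/-- The integral over a face with respect to surface area: the face with vertices `b 0, b 1, b 2` is
parametrized affinely, with surface element `|(b 1 - b 0) × (b 2 - b 0)|`. -/
def integralF (a : Fin 4 → Pt) (i : Fin 4) (f : Pt → ℝ) : ℝ :=
  let b : Fin 3 → Pt := fun j => a (i.succAbove j)
  let c : Pt := (b 1 - b 0) ⨯₃ (b 2 - b 0)
  ∫ p in refTriangle, f (b 0 + p.1 • (b 1 - b 0) + p.2 • (b 2 - b 0)) * √(c ⬝ᵥ c)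

/-! ### Polynomials on faces and edges -/

/-- The restriction of a polynomial to a subset `G`, as a function on `G`; a function on `G` is
represented by its extension by zero. -/
def restrictTo (G : Set Pt) : Poly →ₗ[ℝ] (Pt → ℝ) where
  toFun q := G.indicator fun x => MvPolynomial.eval x q
  map_add' p q := by
    ext x
    by_cases hx : x ∈ G <;> simp [hx]
  map_smul' c q := by
    ext x
    by_cases hx : x ∈ G <;> simp [hx]

/-- `P_l(G)`: the polynomial functions of degree at most `l` on the set `G`. -/
def polyOn (l : ℕ) (G : Set Pt) : Submodule ℝ (Pt → ℝ) := (scalarPoly l).map (restrictTo G)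

/-! ### The interior test spaces -/

/-- `∇² P_l(K)`. -/
def hessians (l : ℕ) : Submodule ℝ (Matrix (Fin 3) (Fin 3) Poly) := (scalarPoly l).map hess

/-- `W_l(K; ℝ³)`: the fields `φ ∈ P_l(K; ℝ³)` with `φ × n = 0` on every face. The vector `n i` is
the normal of the face opposite to `a i`. -/
def spaceW (a n : Fin 4 → Pt) (l : ℕ) : Submodule ℝ (Fin 3 → Poly) where
  carrier := {φ | φ ∈ vecPoly l ∧ ∀ i, ∀ x ∈ face a i, evalVec x φ ⨯₃ n i = 0}
  add_mem' {φ ψ} hφ hψ := by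
    refine ⟨(vecPoly l).add_mem hφ.1 hψ.1, fun i x hx => ?_⟩
    have h : evalVec x (φ + ψ) = evalVec x φ + evalVec x ψ := by ext j; simp [evalVec]
    rw [h, map_add, LinearMap.add_apply, hφ.2 i x hx, hψ.2 i x hx, add_zero]
  zero_mem' := by
    refine ⟨(vecPoly l).zero_mem, fun i x _ => ?_⟩
    have h : evalVec x 0 = 0 := by ext j; simp [evalVec]
    rw [h, map_zero, LinearMap.zero_apply]
  smul_mem' c φ hφ := by
    refine ⟨(vecPoly l).smul_mem c hφ.1, fun i x hx => ?_⟩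
    have h : evalVec x (c • φ) = c • evalVec x φ := by ext j; simp [evalVec]
    rw [h, map_smul, LinearMap.smul_apply, hφ.2 i x hx, smul_zero]

/-- The rigid motion with parameters `c`. -/
def rigidMotion (c : Fin 6 → ℝ) : Fin 3 → Poly :=
  let X : Fin 3 → Poly := MvPolynomial.X
  ![MvPolynomial.C (c 0) - c 3 • X 1 - c 4 • X 2,
    MvPolynomial.C (c 1) + c 3 • X 0 - c 5 • X 2,
    MvPolynomial.C (c 2) + c 4 • X 0 + c 5 • X 1]

/-- The space `curl W_l(K; ℝ³) / RM(K)`, realized as the space of the fields in `curl W_l(K; ℝ³)`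
that are `L²(K)`-orthogonal to all rigid motions. -/
def curlSpace (a n : Fin 4 → Pt) (l : ℕ) : Submodule ℝ (Fin 3 → Poly) where
  carrier := {w | w ∈ (spaceW a n l).map curl ∧ ∀ c, innerVecK a w (rigidMotion c) = 0}
  add_mem' {v w} hv hw := by
    refine ⟨Submodule.add_mem _ hv.1 hw.1, fun c => ?_⟩
    have h := congrArg₂ (· + ·) (hv.2 c) (hw.2 c)
    simpa [innerVecK, add_dotProduct] using h
  zero_mem' := by
    refine ⟨Submodule.zero_mem _, fun c => ?_⟩
    simp [innerVecK]
  smul_mem' r w hw := by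
    refine ⟨Submodule.smul_mem _ r hw.1, fun c => ?_⟩
    have h := hw.2 c
    simp only [innerVecK] at h ⊢
    rw [smul_dotProduct, map_smul, h, smul_zero]

/-- `Λ_F(τ) = (I - n nᵀ) τ (I - n nᵀ)` at the point `x`. -/
def tangentialPart (m : Pt) (x : Pt) (τ : Matrix (Fin 3) (Fin 3) Poly) :
    Matrix (Fin 3) (Fin 3) ℝ :=
  (1 - Matrix.vecMulVec m m) * evalMat x τ * (1 - Matrix.vecMulVec m m)

theorem tangentialPart_add (m x : Pt) (σ τ : Matrix (Fin 3) (Fin 3) Poly) :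
    tangentialPart m x (σ + τ) = tangentialPart m x σ + tangentialPart m x τ := by
  have h : evalMat x (σ + τ) = evalMat x σ + evalMat x τ := by ext i j; simp [evalMat]
  simp only [tangentialPart, h, Matrix.mul_add, Matrix.add_mul]

theorem tangentialPart_smul (m x : Pt) (c : ℝ) (τ : Matrix (Fin 3) (Fin 3) Poly) :
    tangentialPart m x (c • τ) = c • tangentialPart m x τ := by
  have h : evalMat x (c • τ) = c • evalMat x τ := by ext i j; simp [evalMat]
  simp only [tangentialPart, h, Matrix.mul_smul, Matrix.smul_mul]

/-- The fields `τ ∈ P_l(K; 𝕊)` with `Λ_F(τ) = 0` on every face `F`. -/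
def tangentialFree (a n : Fin 4 → Pt) (l : ℕ) : Submodule ℝ (Matrix (Fin 3) (Fin 3) Poly) where
  carrier := {τ | τ ∈ symPoly l ∧ ∀ i, ∀ x ∈ face a i, tangentialPart (n i) x τ = 0}
  add_mem' {σ τ} hσ hτ := by
    refine ⟨(symPoly l).add_mem hσ.1 hτ.1, fun i x hx => ?_⟩
    rw [tangentialPart_add, hσ.2 i x hx, hτ.2 i x hx, add_zero]
  zero_mem' := by
    refine ⟨(symPoly l).zero_mem, fun i x _ => ?_⟩
    have h : evalMat x 0 = 0 := by ext i j; simp [evalMat]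
    simp [tangentialPart, h]
  smul_mem' c τ hτ := by
    refine ⟨(symPoly l).smul_mem c hτ.1, fun i x hx => ?_⟩
    rw [tangentialPart_smul, hτ.2 i x hx, smul_zero]

/-- `M_l(K; 𝕊)`: the fields `τ ∈ P_l(K; 𝕊)` with `Λ_F(τ) = 0` and `(curl curl* τ) n = 0` on every
face `F`. -/
def spaceM (a n : Fin 4 → Pt) (l : ℕ) : Submodule ℝ (Matrix (Fin 3) (Fin 3) Poly) where
  carrier := {τ | τ ∈ tangentialFree a n l ∧
    ∀ i, ∀ x ∈ face a i, evalMat x (curlCurlStar τ) *ᵥ n i = 0}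
  add_mem' {σ τ} hσ hτ := by
    refine ⟨(tangentialFree a n l).add_mem hσ.1 hτ.1, fun i x hx => ?_⟩
    have h : evalMat x (curlCurlStar (σ + τ)) =
        evalMat x (curlCurlStar σ) + evalMat x (curlCurlStar τ) := by ext i j; simp [evalMat]
    rw [h, Matrix.add_mulVec, hσ.2 i x hx, hτ.2 i x hx, add_zero]
  zero_mem' := by
    refine ⟨(tangentialFree a n l).zero_mem, fun i x _ => ?_⟩
    have h : evalMat x (curlCurlStar 0) = 0 := by ext i j; simp [evalMat]
    rw [h, Matrix.zero_mulVec]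
  smul_mem' c τ hτ := by
    refine ⟨(tangentialFree a n l).smul_mem c hτ.1, fun i x hx => ?_⟩
    have h : evalMat x (curlCurlStar (c • τ)) = c • evalMat x (curlCurlStar τ) := by
      ext i j; simp [evalMat]
    rw [h, Matrix.smul_mulVec, hτ.2 i x hx, smul_zero]

/-! ### The degrees of freedom -/

/-- The index pairs `1 ≤ i ≤ j ≤ 2` of the moments of `n_iᵀ σ n_j` (the pairs `(i, j)` and `(j, i)`
give the same moment, since `σ` is symmetric). -/
abbrev NormalPair := {p : Fin 2 × Fin 2 // p.1 ≤ p.2}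

/-- A prescription of a value for every degree of freedom. The moments against a test space are
prescribed by an arbitrary linear functional on that test space; `N` is the last test space. -/
structure DofData (a n : Fin 4 → Pt) (k : ℕ) (N : Submodule ℝ (Matrix (Fin 3) (Fin 3) Poly)) where
  vertex : Fin 4 → symMat ℝ
  edgeTN : ∀ e : Edge, Fin 2 → Module.Dual ℝ (polyOn (k - 2) (edge a e))
  edgeNN : ∀ e : Edge, NormalPair → Module.Dual ℝ (polyOn (k - 2) (edge a e))
  faceNormal : ∀ i : Fin 4, Module.Dual ℝ (Fin 3 → polyOn (k - 3) (face a i))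
  faceDiv : ∀ i : Fin 4, Module.Dual ℝ (polyOn (k - 1) (face a i))
  interiorHess : Module.Dual ℝ (hessians (k - 2))
  interiorCurl : Module.Dual ℝ (curlSpace a n k)
  interiorTensor : Module.Dual ℝ N

/-- The degrees of freedom of `σ` take the prescribed values `g`. Here `n i` is the normal of the
face opposite to `a i`, and `t e`, `ν e` are the tangent and the normals of the edge `e`. -/
structure HasDofs (a n : Fin 4 → Pt) (t : Edge → Pt) (ν : Edge → Fin 2 → Pt) (k : ℕ)
    (N : Submodule ℝ (Matrix (Fin 3) (Fin 3) Poly)) (g : DofData a n k N)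
    (σ : Matrix (Fin 3) (Fin 3) Poly) : Prop where
  vertex : ∀ i, evalMat (a i) σ = g.vertex i
  edgeTN : ∀ e j (q : polyOn (k - 2) (edge a e)),
    integralE a e (fun x => (t e ⬝ᵥ (evalMat x σ *ᵥ ν e j)) * q.1 x) = g.edgeTN e j q
  edgeNN : ∀ e (p : NormalPair) (q : polyOn (k - 2) (edge a e)),
    integralE a e (fun x => (ν e p.1.1 ⬝ᵥ (evalMat x σ *ᵥ ν e p.1.2)) * q.1 x) = g.edgeNN e p q
  faceNormal : ∀ i (φ : Fin 3 → polyOn (k - 3) (face a i)),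
    integralF a i (fun x => (evalMat x σ *ᵥ n i) ⬝ᵥ fun j => (φ j).1 x) = g.faceNormal i φ
  faceDiv : ∀ i (q : polyOn (k - 1) (face a i)),
    integralF a i (fun x => (evalVec x (divMat σ) ⬝ᵥ n i) * q.1 x) = g.faceDiv i q
  interiorHess : ∀ η : hessians (k - 2), innerMatK a σ η.1 = g.interiorHess η
  interiorCurl : ∀ w : curlSpace a n k, innerMatK a σ (grad w.1) = g.interiorCurl w
  interiorTensor : ∀ τ : N, innerMatK a σ τ.1 = g.interiorTensor τ

/-- The number of degrees of freedom: the dimension of the space of all prescriptions. -/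
def numberOfDofs (a n : Fin 4 → Pt) (k : ℕ) (N : Submodule ℝ (Matrix (Fin 3) (Fin 3) Poly)) : ℕ :=
  ∑ _i : Fin 4, Module.finrank ℝ (symMat ℝ)
    + ∑ e : Edge, (∑ _j : Fin 2, Module.finrank ℝ (polyOn (k - 2) (edge a e))
        + ∑ _p : NormalPair, Module.finrank ℝ (polyOn (k - 2) (edge a e)))
    + ∑ i : Fin 4, Module.finrank ℝ (Fin 3 → polyOn (k - 3) (face a i))
    + ∑ i : Fin 4, Module.finrank ℝ (polyOn (k - 1) (face a i))
    + Module.finrank ℝ (hessians (k - 2))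
    + Module.finrank ℝ (curlSpace a n k)
    + Module.finrank ℝ N

end

end DivDivElement

open DivDivElement

namespace DivDivElement

noncomputable section

open MvPolynomial

/-! ### Polynomials of bounded degree -/

/-! Unisolvence is injectivity of the map to the degrees of freedom together with an upper bound for
their number. Everything is written in barycentric coordinates `λ_i = bary a g i`, whose gradients
`g i` are nonzero multiples of the face normals.

Injectivity (`IsDual.eq_zero_of_dofs`). Suppose that all degrees of freedom of `σ` vanish. The
vertex and edge data kill every component of `σ` on an edge except the purely tangential one, which
`σ n` does not see for the normals of the adjacent faces; hence `σ n = 0` on the edges of each face.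
There `σ n` is then a face bubble times a polynomial of degree `k - 3`, and the face moments give `σ
n = 0` on the faces. The moments of `div σ · n` give `div σ · n = 0` there. No boundary terms are
left in Green's formulas. Testing with the Hessian of `q = div div σ` gives `div div σ = 0`. Now
`div σ` is solenoidal with zero normal trace, so it is the curl of an element of `W_k`; it is
orthogonal to rigid motions because `σ` is symmetric. It may therefore be tested with itself, so
`div σ = 0`. Finally `σ` is `curl curl*` of an element of `M_{k+2}` and is tested with itself.

The last two steps rest on exactness of polynomial complexes with boundary conditions. For vector
fields (`IsDual.exists_curl_eq`), the homotopy operator based at a vertex respects the boundary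
condition on the three faces through that vertex; two such potentials differ by a gradient, and a
face bubble repairs the fourth face. For symmetric matrices (`IsDual.exists_curlCurlStar_eq`) this
is applied twice, with the algebraic map `ψ ↦ ψᵀ - (tr ψ) I` in between.

Counting (`IsDual.numberOfDofs_le`). Only upper bounds for the dimensions of the test spaces are
proved. Those for `𝓜_k` and for the curls come from pairing the divergence of bubble fields with
polynomials: the divergence-free bubbles lie in one kernel of the pairing, and the other kernel is
small (rigid motions, respectively constants). The bubble spaces are bounded through divisibility by
barycentric coordinates. The bounds add up to `dim P_k(K; 𝕊)`, while injectivity gives the reverse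
inequality, so the degrees of freedom map is bijective. For the larger last test space the
injectivity argument alone applies. -/

theorem mem_scalarPoly {l : ℕ} {p : Poly} : p ∈ scalarPoly l ↔ p.totalDegree ≤ l :=
  mem_restrictTotalDegree _ _ _

theorem scalarPoly_mono {l m : ℕ} (h : l ≤ m) {p : Poly} (hp : p ∈ scalarPoly l) :
    p ∈ scalarPoly m :=
  mem_scalarPoly.2 ((mem_scalarPoly.1 hp).trans h)

theorem mul_mem_scalarPoly {l m : ℕ} {p q : Poly} (hp : p ∈ scalarPoly l) (hq : q ∈ scalarPoly m) :
    p * q ∈ scalarPoly (l + m) :=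
  mem_scalarPoly.2 ((totalDegree_mul p q).trans
    (add_le_add (mem_scalarPoly.1 hp) (mem_scalarPoly.1 hq)))

theorem C_mem_scalarPoly (l : ℕ) (c : ℝ) : (C c : Poly) ∈ scalarPoly l :=
  mem_scalarPoly.2 (by simp)

theorem C_mul_mem_scalarPoly {l : ℕ} (c : ℝ) {p : Poly} (hp : p ∈ scalarPoly l) :
    C c * p ∈ scalarPoly l := by
  rw [← smul_eq_C_mul]; exact (scalarPoly l).smul_mem c hp

theorem X_mem_scalarPoly (i : Fin 3) : (X i : Poly) ∈ scalarPoly 1 :=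
  mem_scalarPoly.2 (by simp)

theorem pderiv_mem_scalarPoly {l : ℕ} {p : Poly} (i : Fin 3) (hp : p ∈ scalarPoly (l + 1)) :
    pderiv i p ∈ scalarPoly l := by
  rw [mem_scalarPoly] at *
  refine Finset.sup_le fun s hs => ?_
  rw [mem_support_iff, coeff_pderiv] at hs
  have h1 : s + Finsupp.single i 1 ∈ p.support := by
    rw [mem_support_iff]; intro h; apply hs; rw [h]; simp
  have h2 := (le_totalDegree h1).trans hp
  rw [Finsupp.sum_add_index' (by simp) (by simp), Finsupp.sum_single_index rfl] at h2
  simpa using h2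

theorem exists_eq_C_of_mem_scalarPoly_zero {p : Poly} (hp : p ∈ scalarPoly 0) :
    ∃ c : ℝ, p = C c :=
  ⟨_, totalDegree_eq_zero_iff_eq_C.1 (Nat.le_zero.1 (mem_scalarPoly.1 hp))⟩

/-- Splitting off the constant term of a polynomial. -/
theorem exists_eq_C_add_sum_X_mul {l : ℕ} {p : Poly} (hp : p ∈ scalarPoly (l + 1)) :
    ∃ (c : ℝ) (q : Fin 3 → Poly), (∀ i, q i ∈ scalarPoly l) ∧ p = C c + ∑ i, X i * q i := by
  have hmon : ∀ (s : Fin 3 →₀ ℕ) (r : ℝ), (s.sum fun _ e => e) ≤ l + 1 →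
      ∃ (c : ℝ) (q : Fin 3 → Poly), (∀ i, q i ∈ scalarPoly l) ∧
        monomial s r = C c + ∑ i, X i * q i := by
    intro s r hs
    by_cases h0 : s = 0
    · exact ⟨r, 0, fun i => (scalarPoly l).zero_mem, by simp [h0]⟩
    · obtain ⟨i, hi⟩ := Finsupp.ne_iff.1 h0
      have hi' : Finsupp.single i 1 ≤ s := by
        rw [Finsupp.single_le_iff]; simp at hi; omega
      have hsplit : Finsupp.single i 1 + (s - Finsupp.single i 1) = s := add_tsub_cancel_of_le hi'
      refine ⟨0, Pi.single i (monomial (s - Finsupp.single i 1) r), fun j => ?_, ?_⟩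
      · by_cases hj : j = i
        · subst hj
          rw [Pi.single_eq_same, mem_scalarPoly]
          refine (totalDegree_monomial_le _ _).trans ?_
          rw [← hsplit, Finsupp.sum_add_index' (by simp) (by simp),
            Finsupp.sum_single_index rfl] at hs
          exact Nat.le_of_add_le_add_left (by rw [add_comm 1 l]; exact hs)
        · rw [Pi.single_eq_of_ne hj]; exact (scalarPoly l).zero_mem
      · rw [Finset.sum_eq_single i (fun j _ hj => by rw [Pi.single_eq_of_ne hj, mul_zero])
          (by simp), Pi.single_eq_same, X, monomial_mul, hsplit]
        simp
  have hsum : ∀ t : Finset (Fin 3 →₀ ℕ), (∀ s ∈ t, (s.sum fun _ e => e) ≤ l + 1) →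
      ∃ (c : ℝ) (q : Fin 3 → Poly), (∀ i, q i ∈ scalarPoly l) ∧
        ∑ s ∈ t, monomial s (coeff s p) = C c + ∑ i, X i * q i := by
    intro t
    induction t using Finset.induction_on with
    | empty => exact fun _ => ⟨0, 0, fun i => (scalarPoly l).zero_mem, by simp⟩
    | insert s t hst ih =>
      intro h
      obtain ⟨c, q, hq, e⟩ := ih fun s' hs' => h s' (Finset.mem_insert_of_mem hs')
      obtain ⟨c', q', hq', e'⟩ := hmon s (coeff s p) (h s (Finset.mem_insert_self _ _))
      refine ⟨c' + c, q' + q, fun i => (scalarPoly l).add_mem (hq' i) (hq i), ?_⟩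
      rw [Finset.sum_insert hst, e, e']
      simp only [Pi.add_apply, mul_add, Finset.sum_add_distrib, C_add]
      ring
  obtain ⟨c, q, hq, e⟩ := hsum p.support fun s hs =>
    (le_totalDegree hs).trans (mem_scalarPoly.1 hp)
  exact ⟨c, q, hq, by rw [← e]; exact p.as_sum⟩

/-- A slack variable, the coordinate `none`, turns exponents of degree at most `l` in `n` variables
into exponents of degree exactly `l` in `n + 1` variables. -/
theorem card_degree_le (n l : ℕ) :
    Nat.card {s : Fin n →₀ ℕ | (s.sum fun _ e => e) ≤ l} = (l + n).choose n := by
  let e : {s : Fin n →₀ ℕ | (s.sum fun _ e => e) ≤ l} ≃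
      (Finset.finsuppAntidiag (Finset.univ : Finset (Option (Fin n))) l) :=
    { toFun := fun s => ⟨Finsupp.equivFunOnFinite.symm fun o => o.elim (l - s.1.sum fun _ e => e) s.1, by
        have := s.2
        simp only [Set.mem_ofPred_eq] at this
        simp only [Finset.mem_finsuppAntidiag, Finset.subset_univ, and_true]
        rw [Fintype.sum_option]
        simp only [Finsupp.equivFunOnFinite_symm_apply_apply, Option.elim]
        rw [Finsupp.sum_fintype _ _ (by simp)] at *
        omega⟩
      invFun := fun s => ⟨Finsupp.equivFunOnFinite.symm fun i => s.1 (some i), by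
        have := (Finset.mem_finsuppAntidiag.1 s.2).1
        rw [Fintype.sum_option] at this
        simp only [Set.mem_ofPred_eq]
        rw [Finsupp.sum_fintype _ _ (by simp)]
        simp only [Finsupp.equivFunOnFinite_symm_apply_apply]
        omega⟩
      left_inv := fun s => by ext; simp
      right_inv := fun s => by
        ext o
        have := (Finset.mem_finsuppAntidiag.1 s.2).1
        rw [Fintype.sum_option] at this
        cases o with
        | none =>
          simp only [Finsupp.equivFunOnFinite_symm_apply_apply, Option.elim]
          rw [Finsupp.sum_fintype _ _ (by simp)]
          simp only [Finsupp.equivFunOnFinite_symm_apply_apply]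
          omega
        | some i => simp }
  rw [Nat.card_congr e, Nat.card_eq_fintype_card, Fintype.card_coe,
    Finset.card_finsuppAntidiag_nat_eq_choose]
  simp only [Finset.card_univ, Fintype.card_option, Fintype.card_fin]
  rw [← Nat.choose_symm_add]
  congr 1
  omega

theorem finrank_restrictTotalDegree (n l : ℕ) :
    Module.finrank ℝ (restrictTotalDegree (Fin n) ℝ l) = (l + n).choose n := by
  rw [← card_degree_le]
  exact Module.finrank_eq_nat_card_basis (basisRestrictSupport ℝ _)

theorem finrank_scalarPoly (l : ℕ) : Module.finrank ℝ (scalarPoly l) = (l + 3).choose 3 :=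
  finrank_restrictTotalDegree 3 l

/-! ### Directional derivatives and restriction to lines -/

/-- The derivative in the direction `v`. -/
def dirD (v : Pt) : Derivation ℝ Poly Poly :=
  ∑ m, v m • (pderiv m : Derivation ℝ Poly Poly)

theorem dirD_apply (v : Pt) (p : Poly) : dirD v p = ∑ m, C (v m) * pderiv m p := by
  simp [dirD, Fin.sum_univ_three, smul_eq_C_mul]

theorem dirD_mul (v : Pt) (p q : Poly) : dirD v (p * q) = p * dirD v q + dirD v p * q := by
  rw [Derivation.leibniz, smul_eq_mul, smul_eq_mul, mul_comm q]

theorem dirD_mem_scalarPoly {l : ℕ} {p : Poly} (v : Pt) (hp : p ∈ scalarPoly (l + 1)) :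
    dirD v p ∈ scalarPoly l := by
  rw [dirD_apply]
  exact Submodule.sum_mem _ fun m _ => C_mul_mem_scalarPoly _ (pderiv_mem_scalarPoly m hp)

/-- The commutator of two derivations is a derivation, so it suffices to check the variables. -/
theorem pderiv_comm (i j : Fin 3) (p : Poly) : pderiv i (pderiv j p) = pderiv j (pderiv i p) := by
  have h : ⁅(pderiv i : Derivation ℝ Poly Poly), (pderiv j : Derivation ℝ Poly Poly)⁆ = 0 := by
    apply derivation_ext
    intro m
    simp only [Derivation.commutator_apply, pderiv_X, Derivation.zero_apply]
    have hs : ∀ a b : Fin 3, pderiv a ((Pi.single b 1 : Fin 3 → Poly) m) = 0 := by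
      intro a b
      by_cases hb : m = b
      · subst hb; simp
      · rw [Pi.single_eq_of_ne hb, map_zero]
    rw [hs, hs, sub_zero]
  have := congrArg (fun D => D p) h
  simpa [Derivation.commutator_apply, sub_eq_zero] using this

/-- The restriction of a polynomial to the line `s ↦ x + s • v`. -/
def along (x v : Pt) : Poly →ₐ[ℝ] Polynomial ℝ :=
  aeval fun m => Polynomial.C (x m) + Polynomial.C (v m) * Polynomial.X

theorem eval_along (x v : Pt) (s : ℝ) (p : Poly) :
    (along x v p).eval s = eval (x + s • v) p := by
  induction p using MvPolynomial.induction_on with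
  | C c => simp [along, ← Polynomial.algebraMap_eq]
  | add p q hp hq => simp [hp, hq]
  | mul_X p i hp => simp [hp]; left; simp [along]; ring

theorem derivative_along (x v : Pt) (p : Poly) :
    (along x v p).derivative = along x v (dirD v p) := by
  induction p using MvPolynomial.induction_on with
  | C c => simp [along, ← Polynomial.algebraMap_eq]
  | add p q hp hq => simp [hp, hq]
  | mul_X p i hp =>
    have h : dirD v (X i : Poly) = C (v i) := by
      simp [dirD_apply, pderiv_X, Pi.single_apply, Finset.sum_ite_eq]
    rw [dirD_mul, map_mul, Polynomial.derivative_mul, hp, map_add, map_mul, map_mul, h]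
    simp [along]
    ring

theorem natDegree_along_le {l : ℕ} {p : Poly} (hp : p ∈ scalarPoly l) (x v : Pt) :
    (along x v p).natDegree ≤ l := by
  refine le_trans ?_ (mem_scalarPoly.1 hp)
  rw [along, aeval_def, eval₂_eq']
  refine Polynomial.natDegree_sum_le_of_forall_le _ _ fun s hs => ?_
  refine le_trans (Polynomial.natDegree_C_mul_le _ _) ?_
  refine le_trans (Polynomial.natDegree_prod_le _ _) ?_
  refine le_trans ?_ (le_totalDegree hs)
  rw [Finsupp.sum_fintype _ _ (by simp)]
  refine Finset.sum_le_sum fun m _ => ?_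
  refine le_trans Polynomial.natDegree_pow_le ?_
  have : (Polynomial.C (x m) + Polynomial.C (v m) * Polynomial.X).natDegree ≤ 1 := by
    compute_degree
  nlinarith

theorem poly_ext {p q : Poly} (h : ∀ x, eval x p = eval x q) : p = q :=
  MvPolynomial.funext h

/-- If a product vanishes on the line through `x` and `y`, and the first factor does not vanish at
`x`, then the second factor vanishes at `y`. -/
theorem eval_eq_zero_of_mul_along {x y : Pt} {p q : Poly}
    (h : ∀ s : ℝ, eval (x + s • (y - x)) (p * q) = 0) (hx : eval x p ≠ 0) : eval y q = 0 := by
  have h1 : along x (y - x) p * along x (y - x) q = 0 := by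
    apply Polynomial.funext; intro s
    rw [← map_mul, eval_along, h, Polynomial.eval_zero]
  rcases mul_eq_zero.1 h1 with h2 | h2
  · exact absurd (by simpa [eval_along] using congrArg (Polynomial.eval 0) h2) hx
  · simpa [eval_along] using congrArg (Polynomial.eval 1) h2

/-- A polynomial whose derivative along a line vanishes is constant on the line. -/
theorem eval_eq_of_dirD_along {x y : Pt} {p : Poly}
    (h : ∀ s : ℝ, eval (x + s • (y - x)) (dirD (y - x) p) = 0) : eval y p = eval x p := by
  have h1 : (along x (y - x) p).derivative = 0 := by
    rw [derivative_along]
    apply Polynomial.funext; intro s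
    rw [eval_along, h, Polynomial.eval_zero]
  have h2 := Polynomial.eq_C_of_derivative_eq_zero h1
  have e1 := congrArg (Polynomial.eval 1) h2
  have e0 := congrArg (Polynomial.eval 0) h2
  simp only [eval_along, Polynomial.eval_C] at e0 e1
  simpa [← e0] using e1

theorem eq_C_of_pderiv_eq_zero {p : Poly} (h : ∀ i, pderiv i p = 0) : p = C (eval 0 p) := by
  apply poly_ext
  intro x
  rw [eval_C]
  apply eval_eq_of_dirD_along
  intro s
  simp [dirD_apply, h]

end

end DivDivElement

namespace DivDivElement

noncomputable section

open MvPolynomial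

/-! ### Barycentric coordinates -/

/-- The vectors `g i` are the gradients of the barycentric coordinates of the tetrahedron with
vertices `a i`. -/
def IsDual (a g : Fin 4 → Pt) : Prop :=
  ∀ i j l, g i ⬝ᵥ (a j - a l) = (if i = j then 1 else 0) - (if i = l then 1 else 0)

/-- The `i`-th barycentric coordinate, as a polynomial. -/
def bary (a g : Fin 4 → Pt) (i : Fin 4) : Poly :=
  C (1 - g i ⬝ᵥ a i) + ∑ m, C (g i m) * X m

variable {a g : Fin 4 → Pt}

theorem eval_bary (i : Fin 4) (x : Pt) : eval x (bary a g i) = 1 + g i ⬝ᵥ (x - a i) := by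
  simp [bary, dotProduct_sub]
  simp [dotProduct]
  ring

theorem bary_mem_scalarPoly (i : Fin 4) : bary a g i ∈ scalarPoly 1 :=
  Submodule.add_mem _ (C_mem_scalarPoly _ _)
    (Submodule.sum_mem _ fun m _ => C_mul_mem_scalarPoly _ (X_mem_scalarPoly m))

theorem pderiv_bary (m : Fin 3) (i : Fin 4) : pderiv m (bary a g i) = C (g i m) := by
  simp [bary, pderiv_X, Pi.single_apply]

theorem eval_bary_add_smul (i : Fin 4) (x v : Pt) (s : ℝ) :
    eval (x + s • v) (bary a g i) = eval x (bary a g i) + s * (g i ⬝ᵥ v) := by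
  rw [eval_bary, eval_bary, add_sub_right_comm, dotProduct_add, dotProduct_smul, smul_eq_mul]
  ring

theorem eval_bary_line (i : Fin 4) (x y : Pt) (s : ℝ) :
    eval (x + s • (y - x)) (bary a g i) =
      (1 - s) * eval x (bary a g i) + s * eval y (bary a g i) := by
  have e : g i ⬝ᵥ (y - x) = g i ⬝ᵥ (y - a i) - g i ⬝ᵥ (x - a i) := by
    rw [← dotProduct_sub, sub_sub_sub_cancel_right]
  rw [eval_bary_add_smul, eval_bary, eval_bary, e]
  ring

theorem IsDual.eval_bary_eq (h : IsDual a g) (i j : Fin 4) (x : Pt) :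
    eval x (bary a g i) = (if i = j then 1 else 0) + g i ⬝ᵥ (x - a j) := by
  have := h i j i
  rw [eval_bary, show x - a i = (x - a j) + (a j - a i) by abel, dotProduct_add, this]
  simp
  ring

theorem IsDual.eval_bary_vertex (h : IsDual a g) (i j : Fin 4) :
    eval (a j) (bary a g i) = if i = j then 1 else 0 := by
  rw [h.eval_bary_eq i j]; simp

/-- The matrix of the gradients `g 1, g 2, g 3` is a left inverse of the matrix of the edge vectors
from `a 0`, hence also a right inverse. -/
theorem IsDual.sum_dot_smul_sub (h : IsDual a g) (u : Pt) :
    ∑ j : Fin 3, (g j.succ ⬝ᵥ u) • (a j.succ - a 0) = u := by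
  let B : Matrix (Fin 3) (Fin 3) ℝ := Matrix.of fun j => a j.succ - a 0
  let G : Matrix (Fin 3) (Fin 3) ℝ := Matrix.of fun j => g j.succ
  have h1 : G * Bᵀ = 1 := by
    ext i j
    rw [Matrix.mul_apply]
    have := h i.succ j.succ 0
    simp only [dotProduct, Pi.sub_apply, Fin.succ_inj, Fin.succ_ne_zero, if_false, sub_zero] at this
    simpa [G, B, Matrix.one_apply] using this
  have h2 : Bᵀ * G = 1 := mul_eq_one_comm.1 h1
  have h3 : Bᵀ *ᵥ (G *ᵥ u) = u := by rw [Matrix.mulVec_mulVec, h2, Matrix.one_mulVec]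
  conv_rhs => rw [← h3]
  ext m
  simp [Matrix.mulVec, dotProduct, B, G, mul_comm]

theorem IsDual.sum_dot (h : IsDual a g) (u : Pt) : ∑ i, g i ⬝ᵥ u = 0 := by
  have h0 : g 0 ⬝ᵥ u = - ∑ j : Fin 3, g j.succ ⬝ᵥ u := by
    conv_lhs => rw [← h.sum_dot_smul_sub u]
    rw [dotProduct_sum, ← Finset.sum_neg_distrib]
    refine Finset.sum_congr rfl fun j _ => ?_
    rw [dotProduct_smul, h 0 j.succ 0]
    simp [(Fin.succ_ne_zero j).symm]
  rw [Fin.sum_univ_succ, h0]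
  ring

/-- Recovers a vector from its components normal to the four faces; applied pointwise, it turns
divisibility of the normal components by the `λ_i` into a formula for the whole field. -/
theorem IsDual.sum_dot_smul (h : IsDual a g) (u : Pt) : ∑ i, (g i ⬝ᵥ u) • a i = u := by
  have h0 := h.sum_dot u
  rw [Fin.sum_univ_succ] at h0 ⊢
  have h1 := h.sum_dot_smul_sub u
  simp only [smul_sub, Finset.sum_sub_distrib, ← Finset.sum_smul] at h1
  rw [eq_neg_of_add_eq_zero_left h0, neg_smul]
  rw [← sub_eq_neg_add]
  exact h1

theorem IsDual.sum_eval_bary (h : IsDual a g) (x : Pt) : ∑ i, eval x (bary a g i) = 1 := by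
  simp only [h.eval_bary_eq _ 0, Finset.sum_add_distrib, h.sum_dot]
  simp

theorem IsDual.sum_bary (h : IsDual a g) : ∑ i, bary a g i = 1 :=
  poly_ext fun x => by rw [map_sum, h.sum_eval_bary, map_one]

theorem IsDual.sum_eval_bary_smul (h : IsDual a g) (x : Pt) :
    ∑ i, eval x (bary a g i) • a i = x := by
  simp only [h.eval_bary_eq _ 0, add_smul, Finset.sum_add_distrib, h.sum_dot_smul]
  simp

theorem IsDual.mem_convexHull_iff (h : IsDual a g) (I : Set (Fin 4)) (x : Pt) :
    x ∈ convexHull ℝ (a '' I) ↔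
      (∀ j, 0 ≤ eval x (bary a g j)) ∧ ∀ j, j ∉ I → eval x (bary a g j) = 0 := by
  constructor
  · intro hx
    have hconv : Convex ℝ {x : Pt | (∀ j, 0 ≤ eval x (bary a g j)) ∧
        ∀ j, j ∉ I → eval x (bary a g j) = 0} := by
      intro x hx y hy s t hs ht hst
      have e : s • x + t • y = x + t • (y - x) := by
        rw [← eq_sub_iff_add_eq] at hst; subst hst; module
      constructor
      · intro j
        rw [e, eval_bary_line, ← hst, add_sub_cancel_right]
        exact add_nonneg (mul_nonneg hs (hx.1 j)) (mul_nonneg ht (hy.1 j))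
      · intro j hj
        rw [e, eval_bary_line, hx.2 j hj, hy.2 j hj]; simp
    refine convexHull_min ?_ hconv hx
    rintro _ ⟨i, hi, rfl⟩
    constructor
    · intro j; rw [h.eval_bary_vertex]; split_ifs <;> norm_num
    · intro j hj; rw [h.eval_bary_vertex, if_neg]; rintro rfl; exact hj hi
  · rintro ⟨h1, h2⟩
    classical
    rw [← h.sum_eval_bary_smul x]
    have hs : ∑ i, eval x (bary a g i) • a i =
        ∑ i with i ∈ I, eval x (bary a g i) • a i := by
      rw [Finset.sum_filter]
      refine Finset.sum_congr rfl fun i _ => ?_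
      split_ifs with hi
      · rfl
      · rw [h2 i hi, zero_smul]
    rw [hs]
    refine (convex_convexHull ℝ _).sum_mem (fun i _ => h1 i) ?_ fun i hi =>
      subset_convexHull ℝ _ ⟨i, (Finset.mem_filter.1 hi).2, rfl⟩
    rw [Finset.sum_filter, ← h.sum_eval_bary x]
    refine Finset.sum_congr rfl fun i _ => ?_
    split_ifs with hi
    · rfl
    · exact (h2 i hi).symm

theorem IsDual.mem_tet_iff (h : IsDual a g) (x : Pt) :
    x ∈ tet a ↔ ∀ j, 0 ≤ eval x (bary a g j) := by
  rw [tet, ← Set.image_univ, h.mem_convexHull_iff]; simp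

theorem IsDual.mem_face_iff (h : IsDual a g) (i : Fin 4) (x : Pt) :
    x ∈ face a i ↔ (∀ j, 0 ≤ eval x (bary a g j)) ∧ eval x (bary a g i) = 0 := by
  rw [face, h.mem_convexHull_iff]; simp

/-- A polynomial that vanishes on a simplex vanishes on the plane that it spans. -/
theorem IsDual.eval_eq_zero_of_convexHull (h : IsDual a g) {I : Set (Fin 4)} (hI : I.Nonempty)
    {p : Poly} (hp : ∀ x ∈ convexHull ℝ (a '' I), eval x p = 0) {y : Pt}
    (hy : ∀ j, j ∉ I → eval y (bary a g j) = 0) : eval y p = 0 := by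
  classical
  obtain ⟨i₀, hi₀⟩ := hI
  let N : ℝ := ((Finset.univ.filter (· ∈ I)).card : ℝ)
  have hN : 0 < N := by
    have : 0 < (Finset.univ.filter (· ∈ I)).card := Finset.card_pos.2 ⟨i₀, by simpa using hi₀⟩
    exact Nat.cast_pos.2 this
  -- The barycentre is a relative interior point. A short piece of any line through it in the
  -- spanned plane stays in the simplex, so `p` has infinitely many zeros on that line.
  let x : Pt := ∑ i with i ∈ I, N⁻¹ • a i
  have hx : ∀ j, eval x (bary a g j) = if j ∈ I then N⁻¹ else 0 := by
    intro j
    have e : x - a i₀ = ∑ i with i ∈ I, N⁻¹ • (a i - a i₀) := by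
      simp only [smul_sub, Finset.sum_sub_distrib, x, Finset.sum_const, N]
      rw [← Nat.cast_smul_eq_nsmul ℝ, smul_smul, mul_inv_cancel₀ hN.ne', one_smul]
    rw [h.eval_bary_eq j i₀, e, dotProduct_sum]
    simp only [dotProduct_smul, h j _ i₀, smul_eq_mul, mul_sub, Finset.sum_sub_distrib,
      Finset.sum_const]
    rw [nsmul_eq_mul, ← mul_assoc, mul_inv_cancel₀ hN.ne']
    simp
  let U : Set ℝ := {s | ∀ j ∈ I, 0 < eval (x + s • (y - x)) (bary a g j)}
  have hU : IsOpen U := by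
    have : U = ⋂ j : Fin 4, ⋂ _ : j ∈ I, {s | 0 < eval (x + s • (y - x)) (bary a g j)} := by
      ext s; simp [U]
    rw [this]
    refine isOpen_iInter_of_finite fun j => isOpen_iInter_of_finite fun _ => ?_
    simp only [eval_bary_add_smul]
    exact isOpen_lt continuous_const (by fun_prop)
  have h0 : (0 : ℝ) ∈ U := by
    intro j hj
    rw [zero_smul, add_zero, hx, if_pos hj]
    positivity
  have hinf : U.Infinite := infinite_of_mem_nhds 0 (hU.mem_nhds h0)
  have hz : along x (y - x) p = 0 := by
    refine Polynomial.eq_zero_of_infinite_isRoot _ (hinf.mono fun s hs => ?_)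
    rw [Set.mem_ofPred_eq, Polynomial.IsRoot, eval_along]
    apply hp
    rw [h.mem_convexHull_iff]
    have hz : ∀ j, j ∉ I → eval (x + s • (y - x)) (bary a g j) = 0 := by
      intro j hj; rw [eval_bary_line, hx, if_neg hj, hy j hj]; simp
    refine ⟨fun j => ?_, hz⟩
    by_cases hj : j ∈ I
    · exact (hs j hj).le
    · exact (hz j hj).ge
  have := congrArg (Polynomial.eval 1) hz
  simpa [eval_along] using this

theorem IsDual.eval_eq_zero_of_face (h : IsDual a g) {i : Fin 4} {p : Poly}
    (hp : ∀ x ∈ face a i, eval x p = 0) {y : Pt} (hy : eval y (bary a g i) = 0) :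
    eval y p = 0 := by
  refine h.eval_eq_zero_of_convexHull (I := {i}ᶜ) ?_ hp ?_
  · obtain ⟨j, hj⟩ := exists_ne i
    exact ⟨j, hj⟩
  · intro j hj
    rw [Set.notMem_compl_iff, Set.mem_singleton_iff] at hj
    rw [hj, hy]

theorem IsDual.eval_eq_zero_of_segment (h : IsDual a g) {i j : Fin 4} {p : Poly}
    (hp : ∀ x ∈ segment ℝ (a i) (a j), eval x p = 0) {y : Pt}
    (hy : ∀ l, l ≠ i → l ≠ j → eval y (bary a g l) = 0) : eval y p = 0 := by
  refine h.eval_eq_zero_of_convexHull (I := {i, j}) ⟨i, by simp⟩ ?_ ?_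
  · rwa [Set.image_pair, convexHull_pair]
  · intro l hl
    simp only [Set.mem_insert_iff, Set.mem_singleton_iff, not_or] at hl
    exact hy l hl.1 hl.2

/-! ### Polynomials vanishing on faces and edges -/

/-- The pullback of polynomials under the projection, in the direction `v`, onto the plane where the
`i`-th barycentric coordinate vanishes (if `g i ⬝ᵥ v = 1`). -/
def projPlane (a g : Fin 4 → Pt) (i : Fin 4) (v : Pt) : Poly →ₐ[ℝ] Poly :=
  aeval fun m => X m - bary a g i * C (v m)

theorem eval_projPlane (i : Fin 4) (v : Pt) (p : Poly) (x : Pt) :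
    eval x (projPlane a g i v p) = eval (x - eval x (bary a g i) • v) p := by
  induction p using MvPolynomial.induction_on with
  | C c => simp [projPlane, ← algebraMap_eq]
  | add p q hp hq => simp [hp, hq]
  | mul_X p j hp => simp [hp]; left; simp [projPlane]

theorem projPlane_X (i : Fin 4) (v : Pt) (m : Fin 3) :
    projPlane a g i v (X m) = X m - bary a g i * C (v m) := by simp [projPlane]

theorem projPlane_C (i : Fin 4) (v : Pt) (c : ℝ) : projPlane a g i v (C c) = C c := by
  simp [projPlane, ← algebraMap_eq]

theorem projPlane_X_mem (i : Fin 4) (v : Pt) (m : Fin 3) :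
    projPlane a g i v (X m) ∈ scalarPoly 1 := by
  rw [projPlane_X, mul_comm]
  exact Submodule.sub_mem _ (X_mem_scalarPoly m) (C_mul_mem_scalarPoly _ (bary_mem_scalarPoly i))

theorem projPlane_mem (i : Fin 4) (v : Pt) {l : ℕ} {p : Poly} (hp : p ∈ scalarPoly l) :
    projPlane a g i v p ∈ scalarPoly l := by
  induction l generalizing p with
  | zero => obtain ⟨c, rfl⟩ := exists_eq_C_of_mem_scalarPoly_zero hp; rwa [projPlane_C]
  | succ l ih =>
    obtain ⟨c, q, hq, rfl⟩ := exists_eq_C_add_sum_X_mul hp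
    rw [map_add, map_sum, projPlane_C]
    refine Submodule.add_mem _ (C_mem_scalarPoly _ _) (Submodule.sum_mem _ fun m _ => ?_)
    rw [map_mul, add_comm l 1]
    exact mul_mem_scalarPoly (projPlane_X_mem i v m) (ih (hq m))

/-- Division with remainder by the linear polynomial `λ_i`; the remainder is the pullback of `p`
under the projection along `v`. Induction on the degree, one variable being split off at a time. -/
theorem exists_eq_projPlane_add (i : Fin 4) (v : Pt) {l : ℕ} {p : Poly}
    (hp : p ∈ scalarPoly (l + 1)) :
    ∃ r ∈ scalarPoly l, p = projPlane a g i v p + bary a g i * r := by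
  -- For `l = 0` the truncated `l - 1` only says that `r` is constant. The clause `r = 0` is carried
  -- along because the next step multiplies `r` by a polynomial of degree one.
  have main : ∀ (l : ℕ) (p : Poly), p ∈ scalarPoly l →
      ∃ r ∈ scalarPoly (l - 1), (l = 0 → r = 0) ∧ p = projPlane a g i v p + bary a g i * r := by
    intro l
    induction l with
    | zero =>
      intro p hp
      obtain ⟨c, rfl⟩ := exists_eq_C_of_mem_scalarPoly_zero hp
      exact ⟨0, Submodule.zero_mem _, fun _ => rfl, by rw [projPlane_C]; simp⟩
    | succ l ih =>
      intro p hp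
      obtain ⟨c, q, hq, rfl⟩ := exists_eq_C_add_sum_X_mul hp
      choose r hr h0 e using fun m => ih (q m) (hq m)
      refine ⟨∑ m, (C (v m) * q m + projPlane a g i v (X m) * r m),
        Submodule.sum_mem _ fun m _ => Submodule.add_mem _ (C_mul_mem_scalarPoly _ (hq m)) ?_,
        fun h => absurd h (Nat.succ_ne_zero l), ?_⟩
      · cases l with
        | zero => rw [h0 m rfl, mul_zero]; exact Submodule.zero_mem _
        | succ l =>
          have := mul_mem_scalarPoly (projPlane_X_mem (a := a) (g := g) i v m) (hr m)
          rwa [show 1 + (l + 1 - 1) = l + 1 by omega] at this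
      · rw [map_add, map_sum, projPlane_C, Finset.mul_sum, add_assoc, ← Finset.sum_add_distrib]
        congr 1
        refine Finset.sum_congr rfl fun m _ => ?_
        rw [map_mul, projPlane_X]
        linear_combination (X m - bary a g i * C (v m)) * e m
  obtain ⟨r, hr, -, e⟩ := main (l + 1) p hp
  exact ⟨r, hr, e⟩

theorem IsDual.exists_eq_bary_mul (h : IsDual a g) (i : Fin 4) {l : ℕ} {p : Poly}
    (hp : p ∈ scalarPoly (l + 1)) (h0 : ∀ x, eval x (bary a g i) = 0 → eval x p = 0) :
    ∃ r ∈ scalarPoly l, p = bary a g i * r := by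
  obtain ⟨j, hj⟩ := exists_ne i
  obtain ⟨r, hr, e⟩ := exists_eq_projPlane_add (a := a) (g := g) i (a i - a j) hp
  refine ⟨r, hr, ?_⟩
  have hz : projPlane a g i (a i - a j) p = 0 := by
    apply poly_ext
    intro x
    rw [eval_projPlane, map_zero]
    apply h0
    rw [sub_eq_add_neg, ← neg_smul, eval_bary_add_smul, h, if_pos rfl, if_neg hj.symm]
    ring
  rw [hz, zero_add] at e
  exact e

/-- Projecting along `a i - a m` with `m ≠ i, j` leaves `λ_j` unchanged, so the remainder modulo
`λ_i` vanishes on the whole plane `λ_j = 0` and is divisible by `λ_j`. -/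
theorem IsDual.exists_eq_bary_mul_add (h : IsDual a g) {i j : Fin 4} (hij : i ≠ j) {l : ℕ}
    {p : Poly} (hp : p ∈ scalarPoly (l + 1))
    (h0 : ∀ x, eval x (bary a g i) = 0 → eval x (bary a g j) = 0 → eval x p = 0) :
    ∃ q ∈ scalarPoly l, ∃ r ∈ scalarPoly l, p = bary a g i * q + bary a g j * r := by
  obtain ⟨m, hmi, hmj⟩ : ∃ m, m ≠ i ∧ m ≠ j := by
    have : ∀ i j : Fin 4, ∃ m, m ≠ i ∧ m ≠ j := by decide
    exact this i j
  obtain ⟨q, hq, e⟩ := exists_eq_projPlane_add (a := a) (g := g) i (a i - a m) hp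
  obtain ⟨r, hr, e'⟩ := h.exists_eq_bary_mul j
    (projPlane_mem (a := a) (g := g) i (a i - a m) hp) (by
      intro x hx
      rw [eval_projPlane]
      apply h0
      · rw [sub_eq_add_neg, ← neg_smul, eval_bary_add_smul, h, if_pos rfl, if_neg hmi.symm]
        ring
      · rw [sub_eq_add_neg, ← neg_smul, eval_bary_add_smul, h, if_neg hij.symm, if_neg hmj.symm, hx]
        ring)
  exact ⟨q, hq, r, hr, by rw [← e', add_comm]; exact e⟩

/-- If `q * p` vanishes on an edge and `q` does not vanish at one point of it, then `p` vanishes on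
the edge. -/
theorem eval_eq_zero_of_mul_edge {i j : Fin 4} {p q : Poly} {x₀ : Pt}
    (h0 : ∀ x, eval x (bary a g i) = 0 → eval x (bary a g j) = 0 → eval x (q * p) = 0)
    (hi : eval x₀ (bary a g i) = 0) (hj : eval x₀ (bary a g j) = 0) (hq : eval x₀ q ≠ 0) {x : Pt}
    (hxi : eval x (bary a g i) = 0) (hxj : eval x (bary a g j) = 0) : eval x p = 0 := by
  refine eval_eq_zero_of_mul_along (fun s => h0 _ ?_ ?_) hq
  · rw [eval_bary_line, hi, hxi]; ring
  · rw [eval_bary_line, hj, hxj]; ring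

/-- A polynomial that vanishes on the three edges of a face agrees on that face with a multiple of the
bubble function of the face. -/
theorem IsDual.exists_eq_bary_mul_add_bubble (h : IsDual a g) {i j₁ j₂ j₃ : Fin 4}
    (h₁ : i ≠ j₁) (h₂ : i ≠ j₂) (h₃ : i ≠ j₃) (h₁₂ : j₁ ≠ j₂) (h₁₃ : j₁ ≠ j₃) (h₂₃ : j₂ ≠ j₃)
    {l : ℕ} {p : Poly} (hp : p ∈ scalarPoly (l + 3))
    (h0 : ∀ j, j ≠ i → ∀ x, eval x (bary a g i) = 0 → eval x (bary a g j) = 0 → eval x p = 0) :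
    ∃ q, ∃ r ∈ scalarPoly l,
      p = bary a g i * q + bary a g j₁ * bary a g j₂ * bary a g j₃ * r := by
  obtain ⟨q₁, -, r₁, hr₁, e₁⟩ := h.exists_eq_bary_mul_add h₁ hp (h0 j₁ h₁.symm)
  -- On the next edge `λ_{j₁} r₁` vanishes, and `λ_{j₁}` is nonzero at the vertex `a j₁` of that
  -- edge, so `r₁` vanishes there as well.
  obtain ⟨q₂, -, r₂, hr₂, e₂⟩ := h.exists_eq_bary_mul_add h₂ hr₁ (by
    intro x hxi hxj
    refine eval_eq_zero_of_mul_edge (i := i) (j := j₂) (q := bary a g j₁) (x₀ := a j₁)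
      (fun x hxi hxj => ?_) ?_ ?_ ?_ hxi hxj
    · have := h0 j₂ h₂.symm x hxi hxj
      rw [e₁] at this
      simpa [hxi] using this
    all_goals rw [h.eval_bary_vertex]; simp [h₁, h₁₂.symm])
  obtain ⟨q₃, -, r₃, hr₃, e₃⟩ := h.exists_eq_bary_mul_add h₃ hr₂ (by
    intro x hxi hxj
    obtain ⟨x₀, hx₀i, hx₀3, hx₀1, hx₀2⟩ : ∃ x₀, eval x₀ (bary a g i) = 0 ∧
        eval x₀ (bary a g j₃) = 0 ∧ eval x₀ (bary a g j₁) ≠ 0 ∧ eval x₀ (bary a g j₂) ≠ 0 := by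
      -- Both factors already split off must be nonzero at the chosen point; each endpoint of the
      -- third edge is a zero of one of them, the midpoint of neither.
      refine ⟨a j₁ + (2⁻¹ : ℝ) • (a j₂ - a j₁), ?_⟩
      simp only [eval_bary_line, h.eval_bary_vertex]
      simp [h₁, h₂, h₁₂, h₁₂.symm, h₁₃.symm, h₂₃.symm]
      norm_num
    refine eval_eq_zero_of_mul_edge (i := i) (j := j₃) (q := bary a g j₁ * bary a g j₂) (x₀ := x₀)
      (fun x hxi hxj => ?_) hx₀i hx₀3 (by rw [map_mul]; exact mul_ne_zero hx₀1 hx₀2) hxi hxj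
    have := h0 j₃ h₃.symm x hxi hxj
    rw [e₁, e₂] at this
    simpa [hxi, mul_assoc] using this)
  exact ⟨q₁ + bary a g j₁ * q₂ + bary a g j₁ * bary a g j₂ * q₃, r₃, hr₃, by
    rw [e₁, e₂, e₃]; ring⟩

/-- The bubble function of the face opposite to the vertex `i`. -/
def faceBubble (a g : Fin 4 → Pt) (i : Fin 4) : Poly := ∏ j ∈ Finset.univ.erase i, bary a g j

theorem IsDual.exists_eq_bary_mul_add_faceBubble (h : IsDual a g) (i : Fin 4)
    {l : ℕ} {p : Poly} (hp : p ∈ scalarPoly (l + 3))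
    (h0 : ∀ j, j ≠ i → ∀ x, eval x (bary a g i) = 0 → eval x (bary a g j) = 0 → eval x p = 0) :
    ∃ q, ∃ r ∈ scalarPoly l, p = bary a g i * q + faceBubble a g i * r := by
  have key : ∀ j₁ j₂ j₃ : Fin 4, i ≠ j₁ → i ≠ j₂ → i ≠ j₃ → j₁ ≠ j₂ → j₁ ≠ j₃ → j₂ ≠ j₃ →
      Finset.univ.erase i = {j₁, j₂, j₃} →
      ∃ q, ∃ r ∈ scalarPoly l, p = bary a g i * q + faceBubble a g i * r := by
    intro j₁ j₂ j₃ h₁ h₂ h₃ h₁₂ h₁₃ h₂₃ he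
    obtain ⟨q, r, hr, e⟩ := h.exists_eq_bary_mul_add_bubble h₁ h₂ h₃ h₁₂ h₁₃ h₂₃ hp h0
    refine ⟨q, r, hr, ?_⟩
    rw [e, faceBubble, he, Finset.prod_insert (by simp [h₁₂, h₁₃]), Finset.prod_insert (by simp [h₂₃]),
      Finset.prod_singleton, mul_assoc (bary a g j₁)]
  have hd : ∀ i : Fin 4, ∃ j₁ j₂ j₃ : Fin 4, i ≠ j₁ ∧ i ≠ j₂ ∧ i ≠ j₃ ∧ j₁ ≠ j₂ ∧ j₁ ≠ j₃ ∧ j₂ ≠ j₃ ∧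
      Finset.univ.erase i = {j₁, j₂, j₃} := by decide
  obtain ⟨j₁, j₂, j₃, h₁, h₂, h₃, h₁₂, h₁₃, h₂₃, he⟩ := hd i
  exact key j₁ j₂ j₃ h₁ h₂ h₃ h₁₂ h₁₃ h₂₃ he

theorem eval_faceBubble_eq_zero {i j : Fin 4} (hij : j ≠ i) {x : Pt}
    (hx : eval x (bary a g j) = 0) : eval x (faceBubble a g i) = 0 := by
  rw [faceBubble, map_prod]
  exact Finset.prod_eq_zero (Finset.mem_erase.2 ⟨hij, Finset.mem_univ j⟩) hx

theorem faceBubble_mem_scalarPoly (i : Fin 4) : faceBubble a g i ∈ scalarPoly 3 := by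
  have : (Finset.univ.erase i).card = 3 := by simp
  rw [mem_scalarPoly, faceBubble]
  refine ((totalDegree_finsetProd _ _).trans ?_).trans this.le
  rw [Finset.card_eq_sum_ones]
  exact Finset.sum_le_sum fun j _ => mem_scalarPoly.1 (bary_mem_scalarPoly j)

end

end DivDivElement

namespace DivDivElement

noncomputable section

open MvPolynomial

variable {a g : Fin 4 → Pt}

/-! ### Homotopy operators on polynomial fields -/

/-- The position vector relative to the point `b`. -/
def position (b : Pt) : Fin 3 → Poly := fun i => X i - C (b i)

/-- The shifted Euler operator `p ↦ (x - b) · ∇p + m p`. -/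
def euler (b : Pt) (m : ℕ) : Poly →ₗ[ℝ] Poly where
  toFun p := ∑ i, position b i * pderiv i p + (m : Poly) * p
  map_add' p q := by simp only [map_add, mul_add, Finset.sum_add_distrib]; ring
  map_smul' c p := by
    simp only [Derivation.map_smul, mul_smul_comm, Finset.smul_sum, smul_add, RingHom.id_apply]

theorem euler_apply (b : Pt) (m : ℕ) (p : Poly) :
    euler b m p = ∑ i, position b i * pderiv i p + (m : Poly) * p := rfl

theorem position_mem_scalarPoly (b : Pt) (i : Fin 3) : position b i ∈ scalarPoly 1 :=
  Submodule.sub_mem _ (X_mem_scalarPoly i) (C_mem_scalarPoly _ _)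

theorem evalVec_position (b x : Pt) : evalVec x (position b) = x - b := by
  ext i; simp [evalVec, position]

theorem pderiv_position (b : Pt) (i j : Fin 3) :
    pderiv i (position b j) = if i = j then 1 else 0 := by
  simp [position, pderiv_X, Pi.single_apply, eq_comm]

theorem euler_mem_scalarPoly (b : Pt) (m : ℕ) {l : ℕ} {p : Poly} (hp : p ∈ scalarPoly l) :
    euler b m p ∈ scalarPoly l := by
  refine Submodule.add_mem _ (Submodule.sum_mem _ fun i _ => ?_) ?_
  · cases l with
    | zero =>
      obtain ⟨c, rfl⟩ := exists_eq_C_of_mem_scalarPoly_zero hp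
      simp
    | succ l =>
      rw [add_comm l 1]
      exact mul_mem_scalarPoly (position_mem_scalarPoly b i) (pderiv_mem_scalarPoly i hp)
  · rw [← C_eq_coe_nat]
    exact C_mul_mem_scalarPoly _ hp

/-- The shift of the index by one is what lets identities between derivatives (symmetry, zero
divergence) pass through the inverse of an Euler operator. -/
theorem pderiv_euler (b : Pt) (m : ℕ) (i : Fin 3) (p : Poly) :
    pderiv i (euler b m p) = euler b (m + 1) (pderiv i p) := by
  have hm : pderiv i (m : Poly) = 0 := Derivation.map_natCast _ _
  simp only [euler_apply, map_add, map_sum, pderiv_mul, pderiv_position, hm,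
    Finset.sum_add_distrib, ite_mul, one_mul, zero_mul, Finset.sum_ite_eq, Finset.mem_univ,
    if_true, zero_add, Nat.cast_add, Nat.cast_one, add_mul]
  simp only [pderiv_comm i]
  ring

/-- If `euler b m p` vanishes along the line through `b` and `x`, then `p` vanishes at `x`. -/
theorem eval_eq_zero_of_euler {b x : Pt} {m : ℕ} (hm : 0 < m) {p : Poly}
    (h : ∀ s : ℝ, eval (b + s • (x - b)) (euler b m p) = 0) : eval x p = 0 := by
  set f := along b (x - b) p with hf
  have h1 : along b (x - b) (euler b m p) = 0 := by
    apply Polynomial.funext; intro s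
    rw [eval_along, h, Polynomial.eval_zero]
  have h2 : along b (x - b) (euler b m p) =
      Polynomial.X * f.derivative + (m : Polynomial ℝ) * f := by
    have hpos : ∀ i, along b (x - b) (position b i) =
        Polynomial.C (x i - b i) * Polynomial.X := by
      intro i
      rw [position, map_sub]
      simp [along, ← Polynomial.algebraMap_eq]
    have hC : ∀ c, along b (x - b) (C c) = Polynomial.C c := by
      intro c; simp [along, ← Polynomial.algebraMap_eq]
    rw [euler_apply, hf, derivative_along, dirD_apply]
    simp only [map_add, map_sum, map_mul, hpos, hC, map_natCast, Finset.mul_sum, Pi.sub_apply]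
    congr 1
    refine Finset.sum_congr rfl fun i _ => ?_
    ring
  rw [h1] at h2
  -- `X ^ (m - 1)` is an integrating factor for `X f' + m f`; then `X ^ m * f` is constant and
  -- vanishes at `0`, so `f` vanishes at `1`.
  have h3 : (Polynomial.X ^ m * f).derivative = 0 := by
    obtain ⟨k, rfl⟩ := Nat.exists_eq_succ_of_ne_zero hm.ne'
    rw [Polynomial.derivative_mul, Polynomial.derivative_X_pow]
    simp only [Nat.succ_eq_add_one, Nat.add_sub_cancel, map_natCast] at h2 ⊢
    linear_combination (-Polynomial.X ^ k) * h2
  have h4 := Polynomial.eq_C_of_derivative_eq_zero h3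
  have e1 := congrArg (Polynomial.eval 1) h4
  have e0 := congrArg (Polynomial.eval 0) h4
  simp only [Polynomial.eval_mul, Polynomial.eval_pow, Polynomial.eval_X, zero_pow hm.ne', zero_mul,
    Polynomial.eval_C] at e0
  rw [← e0] at e1
  simp only [Polynomial.eval_mul, Polynomial.eval_pow, Polynomial.eval_X, one_pow, one_mul,
    Polynomial.eval_C] at e1
  rw [hf, eval_along] at e1
  simpa using e1

theorem euler_injective (b : Pt) {m : ℕ} (hm : 0 < m) : Function.Injective (euler b m) := by
  rw [injective_iff_map_eq_zero]
  intro p hp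
  apply poly_ext
  intro x
  rw [map_zero]
  exact eval_eq_zero_of_euler hm fun s => by rw [hp, map_zero]

/-- An injective endomorphism of a finite-dimensional space is surjective. This replaces the
integration along rays in the Poincaré homotopy formula. -/
theorem exists_euler_eq (b : Pt) {m : ℕ} (hm : 0 < m) {l : ℕ} {p : Poly} (hp : p ∈ scalarPoly l) :
    ∃ u ∈ scalarPoly l, euler b m u = p := by
  let E : scalarPoly l →ₗ[ℝ] scalarPoly l :=
    (euler b m).restrict fun _ hq => euler_mem_scalarPoly b m hq
  have hE : Function.Injective E := fun p q hpq =>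
    Subtype.ext (euler_injective b hm (congrArg Subtype.val hpq))
  obtain ⟨u, hu⟩ := LinearMap.injective_iff_surjective.1 hE ⟨p, hp⟩
  exact ⟨u.1, u.2, congrArg Subtype.val hu⟩

/-- The gradient of a scalar polynomial. -/
def gradS (p : Poly) : Fin 3 → Poly := fun i => pderiv i p

theorem gradS_mem_vecPoly {l : ℕ} {p : Poly} (hp : p ∈ scalarPoly (l + 1)) :
    gradS p ∈ vecPoly l := fun i => pderiv_mem_scalarPoly i hp

theorem curl_gradS (p : Poly) : curl (gradS p) = 0 := by
  ext1 i
  fin_cases i <;> simp [curl, gradS, pderiv_comm 2, pderiv_comm 1 0]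

theorem evalVec_sub (x : Pt) (φ ψ : Fin 3 → Poly) :
    evalVec x (φ - ψ) = evalVec x φ - evalVec x ψ := by ext i; simp [evalVec]

theorem evalVec_add (x : Pt) (φ ψ : Fin 3 → Poly) :
    evalVec x (φ + ψ) = evalVec x φ + evalVec x ψ := by ext i; simp [evalVec]

theorem evalVec_cross (x : Pt) (φ ψ : Fin 3 → Poly) :
    evalVec x (φ ⨯₃ ψ) = evalVec x φ ⨯₃ evalVec x ψ := by
  ext i; fin_cases i <;> simp [evalVec, cross_apply]

/-- Curl-free polynomial fields are gradients. -/
theorem exists_gradS_eq {l : ℕ} {ψ : Fin 3 → Poly} (hψ : ψ ∈ vecPoly l) (hc : curl ψ = 0) :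
    ∃ q ∈ scalarPoly (l + 1), gradS q = ψ := by
  choose w hw e using fun i => exists_euler_eq 0 one_pos (hψ i)
  have hsymψ : ∀ i j, pderiv i (ψ j) = pderiv j (ψ i) := by
    have h0 := congrFun hc 0
    have h1 := congrFun hc 1
    have h2 := congrFun hc 2
    simp [curl, sub_eq_zero] at h0 h1 h2
    intro i j
    fin_cases i <;> fin_cases j <;> simp [h0, h1, h2]
  -- With `w` solving the Euler equation of index `1` for `ψ`, the potential is `x · w`. The
  -- symmetry of `∇w`, inherited from that of `∇ψ`, makes its gradient equal to `ψ`.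
  have hsym : ∀ i j, pderiv i (w j) = pderiv j (w i) := by
    intro i j
    apply euler_injective 0 two_pos
    have h1 := pderiv_euler 0 1 i (w j)
    have h2 := pderiv_euler 0 1 j (w i)
    rw [e] at h1 h2
    exact h1.symm.trans ((hsymψ i j).trans h2)
  refine ⟨∑ i, position 0 i * w i, Submodule.sum_mem _ fun i _ => ?_, ?_⟩
  · rw [add_comm l 1]
    exact mul_mem_scalarPoly (position_mem_scalarPoly 0 i) (hw i)
  · ext1 j
    rw [gradS, ← e j, euler_apply]
    simp only [map_sum, pderiv_mul, pderiv_position, Finset.sum_add_distrib, ite_mul, one_mul,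
      zero_mul, Finset.sum_ite_eq, Finset.mem_univ, if_true, Nat.cast_one, hsym j]
    ring

/-- The potential with base point `b` of a divergence-free polynomial field. -/
theorem exists_curl_eq_of_basepoint (b : Pt) {l : ℕ} {v : Fin 3 → Poly} (hv : v ∈ vecPoly l)
    (hd : ∑ i, pderiv i (v i) = 0) :
    ∃ φ ∈ vecPoly (l + 1), curl φ = v ∧
      ∀ γ c : Pt, γ ⬝ᵥ (b - c) = 0 → (∀ x : Pt, γ ⬝ᵥ (x - c) = 0 → γ ⬝ᵥ evalVec x v = 0) →
        ∀ x : Pt, γ ⬝ᵥ (x - c) = 0 → evalVec x φ ⨯₃ γ = 0 := by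
  choose u hu e using fun i => exists_euler_eq b two_pos (hv i)
  have hdu : ∑ i, pderiv i (u i) = 0 := by
    apply euler_injective b three_pos
    rw [map_zero, map_sum, ← hd]
    refine Finset.sum_congr rfl fun i _ => ?_
    exact (pderiv_euler b 2 i (u i)).symm.trans (congrArg _ (e i))
  -- For divergence-free `u`, the curl of `u × (x - b)` is the Euler operator of index `2` applied
  -- to `u`.
  refine ⟨u ⨯₃ position b, ?_, ?_, ?_⟩
  · intro i
    rw [cross_apply]
    fin_cases i <;>
      exact Submodule.sub_mem _ (mul_mem_scalarPoly (hu _) (position_mem_scalarPoly b _))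
        (mul_mem_scalarPoly (hu _) (position_mem_scalarPoly b _))
  · have hp : ∀ i j, pderiv i (position b j) = if i = j then 1 else 0 := pderiv_position b
    ext1 i
    rw [← e i, euler_apply]
    rw [Fin.sum_univ_three] at hdu ⊢
    fin_cases i
    · simp [curl, cross_apply, hp]
      linear_combination (-position b 0) * hdu
    · simp [curl, cross_apply, hp]
      linear_combination (-position b 1) * hdu
    · simp [curl, cross_apply, hp]
      linear_combination (-position b 2) * hdu
  · intro γ c hb hγ x hx
    -- A plane through `b` contains the rays from `b` to its points, so inverting the Euler operator
    -- preserves vanishing of `γ · v` on it.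
    have hux : γ ⬝ᵥ evalVec x u = 0 := by
      have hdot : ∀ (x : Pt) (w : Fin 3 → Poly),
          eval x (∑ i, γ i • w i) = γ ⬝ᵥ evalVec x w := by
        intro x w; simp [dotProduct, evalVec]
      rw [← hdot]
      refine eval_eq_zero_of_euler (b := b) two_pos fun s => ?_
      simp only [map_sum, map_smul, e]
      rw [← map_sum, hdot]
      apply hγ
      have e1 : b + s • (x - b) - c = (1 - s) • (b - c) + s • (x - c) := by module
      rw [e1, dotProduct_add, dotProduct_smul, dotProduct_smul, hb, hx]; simp
    have hxb : γ ⬝ᵥ (x - b) = 0 := by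
      have e1 : x - b = (x - c) - (b - c) := by abel
      rw [e1, dotProduct_sub, hb, hx, sub_zero]
    rw [evalVec_cross, evalVec_position, cross_cross_eq_smul_sub_smul]
    rw [dotProduct_comm _ γ, hux, dotProduct_comm _ γ, hxb]
    simp

theorem dot_eq_zero_of_cross_eq_zero {w γ t : Pt} (hγ : γ ≠ 0) (h : w ⨯₃ γ = 0)
    (ht : t ⬝ᵥ γ = 0) : t ⬝ᵥ w = 0 := by
  have h1 := cross_dot_cross w γ t γ
  rw [h, zero_dotProduct, dotProduct_comm γ t, ht, mul_zero, sub_zero] at h1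
  have h2 : γ ⬝ᵥ γ ≠ 0 := fun h => hγ (dotProduct_self_eq_zero.1 h)
  rw [dotProduct_comm t w]
  exact (mul_eq_zero.1 h1.symm).resolve_right h2

theorem IsDual.ne_zero (h : IsDual a g) (i : Fin 4) : g i ≠ 0 := by
  obtain ⟨j, hj⟩ := exists_ne i
  intro h0
  have := h i i j
  rw [h0, zero_dotProduct] at this
  simp [hj.symm] at this

theorem evalVec_gradS_bary_mul_cross (i : Fin 4) (f : Poly) {x : Pt}
    (hx : eval x (bary a g i) = 0) : evalVec x (gradS (bary a g i * f)) ⨯₃ g i = 0 := by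
  have e : evalVec x (gradS (bary a g i * f)) = eval x f • g i := by
    ext m
    simp [evalVec, gradS, pderiv_bary, hx, mul_comm]
  rw [e, LinearMap.map_smul₂, cross_self, smul_zero]

theorem dirD_eq_dot (x v : Pt) (p : Poly) : eval x (dirD v p) = v ⬝ᵥ evalVec x (gradS p) := by
  simp [dirD_apply, dotProduct, evalVec, gradS]

/-- A divergence-free polynomial field whose normal components vanish on the boundary is the curl of a
polynomial field whose tangential components vanish on the boundary. -/
theorem IsDual.exists_curl_eq (h : IsDual a g) {l : ℕ} {v : Fin 3 → Poly}
    (hv : v ∈ vecPoly (l + 1)) (hd : ∑ i, pderiv i (v i) = 0)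
    (hn : ∀ i x, eval x (bary a g i) = 0 → g i ⬝ᵥ evalVec x v = 0) :
    ∃ φ ∈ vecPoly (l + 2), curl φ = v ∧
      ∀ i x, eval x (bary a g i) = 0 → evalVec x φ ⨯₃ g i = 0 := by
  have hbary : ∀ i j, i ≠ j → ∀ x, eval x (bary a g i) = g i ⬝ᵥ (x - a j) := by
    intro i j hij x
    rw [h.eval_bary_eq i j, if_neg hij, zero_add]
  -- The vertex `a j` lies on every face except the one opposite to it, so the potential based there
  -- satisfies the boundary condition on three faces.
  have base : ∀ j, ∃ φ ∈ vecPoly (l + 2), curl φ = v ∧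
      ∀ i, i ≠ j → ∀ x, eval x (bary a g i) = 0 → evalVec x φ ⨯₃ g i = 0 := by
    intro j
    obtain ⟨φ, hφ, hc, hb⟩ := exists_curl_eq_of_basepoint (a j) hv hd
    refine ⟨φ, hφ, hc, fun i hij x hx => ?_⟩
    refine hb (g i) (a j) (by simp) (fun x hx => hn i x ?_) x ?_
    · rw [hbary i j hij, hx]
    · rw [← hbary i j hij, hx]
  obtain ⟨φ, hφ, hφc, hφ0⟩ := base 0
  obtain ⟨φ', hφ', hφc', hφ1⟩ := base 1
  obtain ⟨q, hq, hgq⟩ := exists_gradS_eq (Submodule.sub_mem _ hφ hφ')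
    (by rw [map_sub, hφc, hφc', sub_self])
  -- Along the edge shared by the faces `0` and `j`, the derivative of `q` is the tangential
  -- component of `φ - φ'`. That of `φ` is zero because of face `j`, that of `φ'` because of face
  -- `0`.
  have hedge : ∀ j, j ≠ 0 → ∀ x y, eval x (bary a g 0) = 0 → eval x (bary a g j) = 0 →
      eval y (bary a g 0) = 0 → eval y (bary a g j) = 0 → eval y q = eval x q := by
    intro j hj x y hx0 hxj hy0 hyj
    apply eval_eq_of_dirD_along
    intro s
    have hz : ∀ i, eval x (bary a g i) = 0 → eval y (bary a g i) = 0 →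
        eval (x + s • (y - x)) (bary a g i) = 0 := by
      intro i hx hy; rw [eval_bary_line, hx, hy]; ring
    have ht : ∀ i, eval x (bary a g i) = 0 → eval y (bary a g i) = 0 → (y - x) ⬝ᵥ g i = 0 := by
      intro i hx hy
      have := eval_bary_line (a := a) (g := g) i x y 1
      rw [eval_bary_add_smul, hx, hy] at this
      rw [dotProduct_comm]
      linarith
    rw [dirD_eq_dot, hgq, evalVec_sub, dotProduct_sub,
      dot_eq_zero_of_cross_eq_zero (h.ne_zero j) (hφ0 j hj _ (hz j hxj hyj)) (ht j hxj hyj),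
      dot_eq_zero_of_cross_eq_zero (h.ne_zero 0) (hφ1 0 (by decide) _ (hz 0 hx0 hy0))
        (ht 0 hx0 hy0), sub_zero]
  have hv' := h.eval_bary_vertex
  -- The three edges of face `0` meet at vertices, so `q` takes one constant value on all of them
  -- and differs from it by a bubble on that face.
  obtain ⟨A, r, hr, e⟩ := h.exists_eq_bary_mul_add_faceBubble 0 (l := l)
    (p := q - C (eval (a 1) q)) (Submodule.sub_mem _ hq (C_mem_scalarPoly _ _)) (by
      intro j hj x hx0 hxj
      rw [map_sub, eval_C, sub_eq_zero]
      by_cases hj1 : j = 1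
      · rw [hedge j hj (a 2) x (by simp [hv']) (by simp [hv', hj1]) hx0 hxj]
        exact hedge 3 (by decide) _ _ (by simp [hv']) (by simp [hv']) (by simp [hv'])
          (by simp [hv'])
      · exact hedge j hj _ _ (by simp [hv']) (by simp [hv', hj1]) hx0 hxj)
  have hb : faceBubble a g 0 * r ∈ scalarPoly (l + 3) := by
    rw [add_comm l 3]
    exact mul_mem_scalarPoly (faceBubble_mem_scalarPoly 0) hr
  refine ⟨φ - gradS (faceBubble a g 0 * r), Submodule.sub_mem _ hφ (gradS_mem_vecPoly hb), ?_, ?_⟩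
  · rw [map_sub, curl_gradS, hφc, sub_zero]
  · intro i x hx
    by_cases hi : i = 0
    · subst hi
      -- On face `0` the corrected field has the tangential trace of `φ'`, since the gradient of a
      -- multiple of `λ_0` is normal there. On the other faces the correction is itself the gradient
      -- of a multiple of `λ_i`.
      have e1 : φ - gradS (faceBubble a g 0 * r) = φ' + gradS (bary a g 0 * A) := by
        have : gradS q = gradS (bary a g 0 * A) + gradS (faceBubble a g 0 * r) := by
          ext1 m
          have := congrArg (pderiv m) e
          simpa [gradS] using this
        rw [hgq] at this
        rw [sub_eq_iff_eq_add, add_assoc, ← this]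
        abel
      rw [e1, evalVec_add, map_add, LinearMap.add_apply, hφ1 0 (by decide) x hx,
        evalVec_gradS_bary_mul_cross 0 A hx, add_zero]
    · rw [evalVec_sub, map_sub, LinearMap.sub_apply, hφ0 i hi x hx, faceBubble,
        ← Finset.mul_prod_erase _ _ (Finset.mem_erase.2 ⟨hi, Finset.mem_univ i⟩), mul_assoc,
        evalVec_gradS_bary_mul_cross i _ hx, sub_zero]

end

end DivDivElement

namespace DivDivElement

noncomputable section

open MvPolynomial

variable {a g n : Fin 4 → Pt}

/-! ### The elasticity complex with boundary conditions -/

theorem curl_mem_vecPoly {l : ℕ} {φ : Fin 3 → Poly} (hφ : φ ∈ vecPoly (l + 1)) :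
    curl φ ∈ vecPoly l := by
  intro i
  fin_cases i <;>
    exact Submodule.sub_mem _ (pderiv_mem_scalarPoly _ (hφ _)) (pderiv_mem_scalarPoly _ (hφ _))

theorem sum_pderiv_curl (φ : Fin 3 → Poly) : ∑ i, pderiv i (curl φ i) = 0 := by
  simp [curl, Fin.sum_univ_three, pderiv_comm 2, pderiv_comm 1 0]

theorem curlCurlStar_apply (τ : Matrix (Fin 3) (Fin 3) Poly) :
    curlCurlStar τ = curlRow (curlRow τᵀ)ᵀ := rfl

theorem divMat_curlRow (ψ : Matrix (Fin 3) (Fin 3) Poly) : divMat (curlRow ψ) = 0 := by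
  ext1 i
  exact sum_pderiv_curl (ψ i)

theorem divMat_curlCurlStar (τ : Matrix (Fin 3) (Fin 3) Poly) : divMat (curlCurlStar τ) = 0 :=
  divMat_curlRow _

theorem curlRow_apply (ψ : Matrix (Fin 3) (Fin 3) Poly) (i : Fin 3) :
    curlRow ψ i = curl (ψ i) := rfl

theorem curlCurlStar_transpose {τ : Matrix (Fin 3) (Fin 3) Poly} (hτ : τᵀ = τ) :
    (curlCurlStar τ)ᵀ = curlCurlStar τ := by
  have hs : ∀ i j, τ i j = τ j i := fun i j => congrFun (congrFun hτ j) i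
  have h1 := hs 1 0
  have h2 := hs 2 0
  have h3 := hs 2 1
  ext1 i j
  rw [curlCurlStar_apply, hτ]
  simp only [Matrix.transpose_apply, curlRow_apply]
  fin_cases i <;> fin_cases j <;>
    simp [curl, curlRow_apply, Matrix.transpose_apply, h1, h2, h3, pderiv_comm 2, pderiv_comm 1 0]
      <;> ring

theorem curlCurlStar_mem_symPoly {l : ℕ} {τ : Matrix (Fin 3) (Fin 3) Poly}
    (hτ : τ ∈ symPoly (l + 2)) : curlCurlStar τ ∈ symPoly l := by
  refine ⟨curlCurlStar_transpose hτ.1, fun i => ?_⟩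
  refine curl_mem_vecPoly fun j => ?_
  exact curl_mem_vecPoly (l := l + 1) (φ := τᵀ j) (fun m => hτ.2 m j) i

/-- The matrix field `ψᵀ - (tr ψ) I`. -/
def transposeSubTrace (ψ : Matrix (Fin 3) (Fin 3) Poly) : Matrix (Fin 3) (Fin 3) Poly :=
  Matrix.of fun i j => ψ j i - if i = j then ∑ m, ψ m m else 0

/-- Up to sign, the three components of this divergence are the skew-symmetric differences of the
entries of `curlRow ψ`. -/
theorem divMat_transposeSubTrace {ψ : Matrix (Fin 3) (Fin 3) Poly}
    (hψ : (curlRow ψ)ᵀ = curlRow ψ) : divMat (transposeSubTrace ψ) = 0 := by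
  have hs : ∀ i j, curlRow ψ i j = curlRow ψ j i := fun i j => congrFun (congrFun hψ j) i
  have h1 := hs 0 1
  have h2 := hs 0 2
  have h3 := hs 1 2
  simp [curlRow_apply, curl] at h1 h2 h3
  ext1 i
  fin_cases i
  · simp [divMat, transposeSubTrace, Fin.sum_univ_three]
    linear_combination -h3
  · simp [divMat, transposeSubTrace, Fin.sum_univ_three]
    linear_combination h2
  · simp [divMat, transposeSubTrace, Fin.sum_univ_three]
    linear_combination -h1

/-- Taking row-wise curls in `ψ = (curl ρ)ᵀ + (tr ψ) I` gives `curl ψ = curl curl* ρᵀ + curl ((tr ψ)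
I)`, whose last term is skew. Since `curl ρ` is divergence-free, `curl ψ` is symmetric, so it is the
symmetric part of `curl curl* ρᵀ`, that is, `curl curl*` of the symmetric part of `ρ`. -/
theorem curlCurlStar_eq_of_curlRow_eq {ψ ρ : Matrix (Fin 3) (Fin 3) Poly}
    (h : curlRow ρ = transposeSubTrace ψ) :
    curlCurlStar ((1 / 2 : ℝ) • (ρ + ρᵀ)) = curlRow ψ := by
  set T : Poly := ∑ m, ψ m m with hT
  have hψ : ∀ i j, ψ i j = curlRow ρ j i + if i = j then T else 0 := by
    intro i j
    rw [h, transposeSubTrace, Matrix.of_apply, ← hT]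
    by_cases hij : i = j
    · subst hij; simp
    · simp [hij, Ne.symm hij]
  -- In dimension three the trace of `ψᵀ - (tr ψ) I` is `-2 tr ψ`.
  have htr : ∀ k, pderiv k T * (-2) = ∑ m, pderiv k (curlRow ρ m m) := by
    intro k
    have : T * (-2) = ∑ m, curlRow ρ m m := by
      rw [hT]
      simp only [h, transposeSubTrace, Matrix.of_apply, Fin.sum_univ_three, if_true]
      ring
    rw [← map_sum, ← this]
    have h2 : pderiv k (-2 : Poly) = 0 := by
      have : (-2 : Poly) = C (-2) := by rw [map_neg, map_ofNat]
      rw [this, pderiv_C]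
    rw [pderiv_mul, h2, mul_zero, add_zero]
  suffices hs : curlCurlStar (ρ + ρᵀ) = (2 : ℝ) • curlRow ψ by
    rw [map_smul, hs, smul_smul]; norm_num
  have t0 := htr 0
  have t1 := htr 1
  have t2 := htr 2
  have e00 := hψ 0 0
  have e01 := hψ 0 1
  have e02 := hψ 0 2
  have e10 := hψ 1 0
  have e11 := hψ 1 1
  have e12 := hψ 1 2
  have e20 := hψ 2 0
  have e21 := hψ 2 1
  have e22 := hψ 2 2
  simp [curlRow_apply, curl, Fin.sum_univ_three] at t0 t1 t2 e00 e01 e02 e10 e11 e12 e20 e21 e22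
  have h2 : ∀ p : Poly, (2 : ℝ) • p = 2 * p := by
    intro p; rw [smul_eq_C_mul, map_ofNat]
  ext1 i j
  rw [curlCurlStar_apply, Matrix.smul_apply, h2]
  simp only [curlRow_apply, Matrix.transpose_add, Matrix.transpose_transpose]
  fin_cases i <;> fin_cases j <;>
    simp [curl, curlRow_apply, e00, e01, e02, e10, e11, e12, e20, e21, e22] <;>
    simp only [pderiv_comm 2 1, pderiv_comm 2 0, pderiv_comm 1 0] at t0 t1 t2 ⊢
  · ring
  · linear_combination t2
  · linear_combination -t1
  · linear_combination -t2
  · ring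
  · linear_combination t0
  · linear_combination t1
  · linear_combination -t0
  · ring

theorem evalMat_mulVec (x v : Pt) (τ : Matrix (Fin 3) (Fin 3) Poly) (i : Fin 3) :
    (evalMat x τ *ᵥ v) i = v ⬝ᵥ evalVec x (τ i) := by
  simp [evalMat, evalVec, Matrix.mulVec, dotProduct, mul_comm]

/-- The vectors `n i` are unit vectors, parallel to the gradients of the barycentric coordinates. -/
def UnitNormals (g n : Fin 4 → Pt) : Prop :=
  ∀ i, n i ⬝ᵥ n i = 1 ∧ ∃ d : ℝ, d ≠ 0 ∧ n i = d • g i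

/-- Each gradient is the normal divided by `n i · (a i - a j)`, with `a j` on the opposite face;
this number is strictly negative because the normal points outward. -/
theorem exists_isDual (hn : ∀ i, IsOuterNormal a i (n i)) :
    ∃ g, IsDual a g ∧ UnitNormals g n := by
  choose s hs using fun i : Fin 4 => exists_ne i
  let d : Fin 4 → ℝ := fun i => n i ⬝ᵥ (a i - a (s i))
  have hd : ∀ i, d i ≠ 0 := fun i => ((hn i).2.2 _ (hs i)).ne
  refine ⟨fun i => (d i)⁻¹ • n i, ?_, fun i => ⟨(hn i).1, d i, hd i, ?_⟩⟩
  · have key : ∀ i j, (d i)⁻¹ * (n i ⬝ᵥ (a j - a (s i))) = if i = j then 1 else 0 := by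
      intro i j
      split_ifs with hij
      · subst hij; exact inv_mul_cancel₀ (hd i)
      · rw [(hn i).2.1 j (s i) (Ne.symm hij) (hs i), mul_zero]
    intro i j l
    rw [smul_dotProduct, smul_eq_mul, ← key i j, ← key i l, ← mul_sub, ← dotProduct_sub]
    congr 2
    abel
  · rw [smul_smul, mul_inv_cancel₀ (hd i), one_smul]

theorem UnitNormals.cross_iff (hgn : UnitNormals g n) (i : Fin 4) (w : Pt) :
    w ⨯₃ n i = 0 ↔ w ⨯₃ g i = 0 := by
  obtain ⟨-, d, hd, e⟩ := hgn i
  rw [e, map_smul]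
  simp [hd]

theorem UnitNormals.mulVec_iff (hgn : UnitNormals g n) (i : Fin 4) (A : Matrix (Fin 3) (Fin 3) ℝ) :
    A *ᵥ n i = 0 ↔ A *ᵥ g i = 0 := by
  obtain ⟨-, d, hd, e⟩ := hgn i
  rw [e, Matrix.mulVec_smul]
  simp [hd]

theorem UnitNormals.dot_iff (hgn : UnitNormals g n) (i : Fin 4) (w : Pt) :
    w ⬝ᵥ n i = 0 ↔ g i ⬝ᵥ w = 0 := by
  obtain ⟨-, d, hd, e⟩ := hgn i
  rw [e, dotProduct_smul, dotProduct_comm]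
  simp [hd]

theorem IsDual.exists_curlRow_eq (h : IsDual a g) {l : ℕ} {σ : Matrix (Fin 3) (Fin 3) Poly}
    (hσ : ∀ i j, σ i j ∈ scalarPoly (l + 1)) (hd : divMat σ = 0)
    (hn : ∀ i x, eval x (bary a g i) = 0 → evalMat x σ *ᵥ g i = 0) :
    ∃ ψ : Matrix (Fin 3) (Fin 3) Poly, (∀ i j, ψ i j ∈ scalarPoly (l + 2)) ∧ curlRow ψ = σ ∧
      ∀ i x, eval x (bary a g i) = 0 → ∀ m, evalVec x (ψ m) ⨯₃ g i = 0 := by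
  choose ψ hψ hc hb using fun m => h.exists_curl_eq (v := σ m) (hσ m) (congrFun hd m)
    (fun i x hx => by rw [← evalMat_mulVec, hn i x hx]; rfl)
  exact ⟨ψ, hψ, by ext1 m; exact congrFun (hc m), fun i x hx m => hb m i x hx⟩

/-- A symmetric divergence-free polynomial field with vanishing normal components on the boundary is
`curl curl*` of a field with vanishing tangential components on the boundary. -/
theorem IsDual.exists_curlCurlStar_eq (h : IsDual a g) (hgn : UnitNormals g n) {l : ℕ}
    {σ : Matrix (Fin 3) (Fin 3) Poly} (hσ : σ ∈ symPoly (l + 1)) (hd : divMat σ = 0)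
    (hn : ∀ i x, eval x (bary a g i) = 0 → evalMat x σ *ᵥ g i = 0) :
    ∃ τ ∈ spaceM a n (l + 3), curlCurlStar τ = σ := by
  obtain ⟨ψ, hψ, hc, hb⟩ := h.exists_curlRow_eq hσ.2 hd hn
  -- The second potential exists because symmetry of `σ = curl ψ` makes `ψᵀ - (tr ψ) I`
  -- divergence-free; the symmetric part of `ρ` is the field sought.
  obtain ⟨ρ, hρ, hcρ, hbρ⟩ := h.exists_curlRow_eq (l := l + 1) (σ := transposeSubTrace ψ)
    (by
      intro i j
      refine Submodule.sub_mem _ (hψ j i) ?_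
      split_ifs
      · exact Submodule.sum_mem _ fun m _ => hψ m m
      · exact Submodule.zero_mem _)
    (divMat_transposeSubTrace (by rw [hc]; exact hσ.1))
    (by
      intro i x hx
      -- On the face the rows of `ψ` are multiples `c_m g_i`. Hence `ψᵀ g_i = (c · g_i) g_i`, and
      -- `tr ψ = c · g_i`, so the normal trace cancels.
      have hw := hb i x hx
      have c0 := hw 0
      have c1 := hw 1
      have c2 := hw 2
      rw [cross_apply] at c0 c1 c2
      have c00 := congrFun c0 0
      have c01 := congrFun c0 1
      have c02 := congrFun c0 2
      have c10 := congrFun c1 0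
      have c11 := congrFun c1 1
      have c12 := congrFun c1 2
      have c20 := congrFun c2 0
      have c21 := congrFun c2 1
      have c22 := congrFun c2 2
      simp [evalVec] at c00 c01 c02 c10 c11 c12 c20 c21 c22
      ext m
      rw [evalMat_mulVec]
      fin_cases m <;>
        simp [evalVec, transposeSubTrace, dotProduct, Fin.sum_univ_three]
      · linear_combination c12 - c21
      · linear_combination -c02 + c20
      · linear_combination c01 - c10)
  have hcurl : curlCurlStar ((1 / 2 : ℝ) • (ρ + ρᵀ)) = σ := by
    rw [curlCurlStar_eq_of_curlRow_eq hcρ, hc]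
  refine ⟨(1 / 2 : ℝ) • (ρ + ρᵀ), ⟨⟨⟨?_, fun i j => ?_⟩, fun i x hx => ?_⟩, fun i x hx => ?_⟩, hcurl⟩
  · change ((1 / 2 : ℝ) • (ρ + ρᵀ))ᵀ = (1 / 2 : ℝ) • (ρ + ρᵀ)
    rw [Matrix.transpose_smul, Matrix.transpose_add, Matrix.transpose_transpose, add_comm]
  · exact Submodule.smul_mem _ _ (Submodule.add_mem _ (hρ i j) (hρ j i))
  · have hQ : evalMat x ρ * (1 - Matrix.vecMulVec (n i) (n i)) = 0 := by
      ext m j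
      have hc0 := (hgn.cross_iff i _).2 (hbρ i x ((h.mem_face_iff i x).1 hx).2 m)
      have hnn := (hgn i).1
      rw [cross_apply] at hc0
      have q0 := congrFun hc0 0
      have q1 := congrFun hc0 1
      have q2 := congrFun hc0 2
      simp [evalVec] at q0 q1 q2
      simp only [dotProduct, Fin.sum_univ_three] at hnn
      rw [Matrix.mul_apply, Fin.sum_univ_three]
      simp only [Matrix.sub_apply, Matrix.one_apply, Matrix.vecMulVec_apply, evalMat,
        Matrix.map_apply, Matrix.zero_apply]
      fin_cases j <;> simp
      · linear_combination (-(eval x (ρ m 0))) * hnn + n i 2 * (-q1) + n i 1 * q2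
      · linear_combination (-(eval x (ρ m 1))) * hnn + n i 2 * q0 - n i 0 * q2
      · linear_combination (-(eval x (ρ m 2))) * hnn - n i 1 * q0 + n i 0 * q1
    have hQt : (1 - Matrix.vecMulVec (n i) (n i)) * evalMat x ρᵀ = 0 := by
      have := congrArg Matrix.transpose hQ
      rw [Matrix.transpose_mul, Matrix.transpose_sub, Matrix.transpose_one,
        Matrix.transpose_vecMulVec, Matrix.transpose_zero] at this
      exact this
    rw [tangentialPart_smul, tangentialPart_add, tangentialPart, tangentialPart, Matrix.mul_assoc,
      hQ, hQt]
    simp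
  · rw [hcurl, hgn.mulVec_iff]
    exact hn i x ((h.mem_face_iff i x).1 hx).2

end

end DivDivElement

namespace DivDivElement

noncomputable section

open MvPolynomial

variable {a g n : Fin 4 → Pt}

/-! ### Integration by parts on the tetrahedron -/

open MeasureTheory Measure in
/-- A function whose integrals over all lines with direction `v` vanish has integral zero. -/
theorem integral_eq_zero_of_lines {v : Pt} (hv : v ≠ 0) {F : Pt → ℝ}
    (h : ∀ x, ∫ s : ℝ, F (x + s • v) = 0) : ∫ x, F x = 0 := by
  -- A linear change of variables makes `v` the last coordinate direction. It changes the measure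
  -- only by a constant factor, which is harmless as the integral to be shown is zero.
  obtain ⟨L, hL⟩ : ∃ L : Pt ≃L[ℝ] ((Fin 2 → ℝ) × ℝ), L v = (0, 1) := by
    have : Module.finrank ℝ ((Fin 2 → ℝ) × ℝ) = Module.finrank ℝ Pt := by simp
    have L₀ : Pt ≃L[ℝ] ((Fin 2 → ℝ) × ℝ) := (ContinuousLinearEquiv.ofFinrankEq this).symm
    obtain ⟨M, hM⟩ : ∃ M : ((Fin 2 → ℝ) × ℝ) ≃L[ℝ] ((Fin 2 → ℝ) × ℝ), M (L₀ v) = (0, 1) := by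
      apply SeparatingDual.exists_continuousLinearEquiv_apply_eq
      · simpa using hv
      · simp
    exact ⟨L₀.trans M, by simp [hM]⟩
  have hLs : L.symm (0, 1) = v := by rw [← hL, L.symm_apply_apply]
  have L_emb : MeasurableEmbedding L := L.toHomeomorph.measurableEmbedding
  have h1 : ∫ x, F x = ∫ z, F (L.symm z) ∂(Measure.map L volume) := by
    rw [L_emb.integral_map]; simp
  have A : Measure.map L volume = addHaarScalarFactor (Measure.map L volume)
      ((volume : Measure (Fin 2 → ℝ)).prod (volume : Measure ℝ)) •
        ((volume : Measure (Fin 2 → ℝ)).prod (volume : Measure ℝ)) :=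
    isAddLeftInvariant_eq_smul _ _
  rw [h1, A, integral_smul_nnreal_measure]
  suffices hz : ∫ z, F (L.symm z) ∂((volume : Measure (Fin 2 → ℝ)).prod (volume : Measure ℝ)) = 0 by
    rw [hz, smul_zero]
  -- Fubini treats the integrable case; otherwise the integral is zero by convention.
  by_cases hi : Integrable (fun z => F (L.symm z))
      ((volume : Measure (Fin 2 → ℝ)).prod (volume : Measure ℝ))
  · rw [integral_prod _ hi]
    have : ∀ y : Fin 2 → ℝ, ∫ t : ℝ, F (L.symm (y, t)) = 0 := by
      intro y
      rw [← h (L.symm (y, 0))]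
      congr 1
      ext t
      rw [← hLs, ← map_smul, ← map_add]
      simp
    simp [this]
  · exact integral_undef hi

theorem integralK_apply (p : Poly) : integralK a p = ∫ x in tet a, eval x p := rfl

theorem IsDual.measurableSet_tet (a : Fin 4 → Pt) : MeasurableSet (tet a) :=
  ((Set.finite_range a).isCompact_convexHull ℝ).isClosed.measurableSet

/-- A line in the direction `a i - a j` meets the tetrahedron, if at all, in a segment with `λ_i =
0` at one end and `λ_j = 0` at the other, the remaining coordinates being constant. The fundamental
theorem of calculus on it has no boundary terms. -/
theorem IsDual.integralK_dirD (h : IsDual a g) {i j : Fin 4} (hij : i ≠ j) (q : Poly) :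
    integralK a (dirD (a i - a j) (bary a g i * bary a g j * q)) = 0 := by
  set v : Pt := a i - a j with hv
  set f : Poly := bary a g i * bary a g j * q with hf
  have hgi : g i ⬝ᵥ v = 1 := by rw [hv, h]; simp [hij]
  have hgj : g j ⬝ᵥ v = -1 := by rw [hv, h]; simp [hij.symm]
  have hgm : ∀ m, m ≠ i → m ≠ j → g m ⬝ᵥ v = 0 := by
    intro m hmi hmj; rw [hv, h]; simp [hmi, hmj]
  rw [integralK_apply, ← MeasureTheory.integral_indicator (IsDual.measurableSet_tet a)]
  refine integral_eq_zero_of_lines (v := v) ?_ fun x => ?_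
  · intro h0; rw [h0, dotProduct_zero] at hgi; exact zero_ne_one hgi
  set A := eval x (bary a g i)
  set B := eval x (bary a g j)
  have hline : ∀ (s : ℝ) m, eval (x + s • v) (bary a g m) =
      eval x (bary a g m) + s * (g m ⬝ᵥ v) := fun s m => eval_bary_add_smul m x v s
  have hEmpty : (∀ s : ℝ, x + s • v ∉ tet a) →
      ∫ s : ℝ, (tet a).indicator (fun x => eval x (dirD v f)) (x + s • v) = 0 := by
    intro hs
    simp [hs]
  by_cases hm : ∀ m, m ≠ i → m ≠ j → 0 ≤ eval x (bary a g m)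
  swap
  · push Not at hm
    obtain ⟨m, hmi, hmj, hneg⟩ := hm
    apply hEmpty
    intro s hs
    have := (h.mem_tet_iff _).1 hs m
    rw [hline, hgm m hmi hmj] at this
    linarith
  by_cases hAB : -A ≤ B
  swap
  · apply hEmpty
    intro s hs
    have h1 := (h.mem_tet_iff _).1 hs i
    have h2 := (h.mem_tet_iff _).1 hs j
    rw [hline, hgi] at h1
    rw [hline, hgj] at h2
    linarith
  have hset : ∀ s : ℝ, x + s • v ∈ tet a ↔ s ∈ Set.Icc (-A) B := by
    intro s
    rw [h.mem_tet_iff, Set.mem_Icc]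
    constructor
    · intro hs
      have h1 := hs i
      have h2 := hs j
      rw [hline, hgi] at h1
      rw [hline, hgj] at h2
      constructor <;> linarith
    · intro hs m
      rw [hline]
      by_cases hmi : m = i
      · subst hmi; rw [hgi]; linarith [hs.1]
      by_cases hmj : m = j
      · subst hmj; rw [hgj]; linarith [hs.2]
      rw [hgm m hmi hmj, mul_zero, add_zero]
      exact hm m hmi hmj
  have hind : (fun s : ℝ => (tet a).indicator (fun x => eval x (dirD v f)) (x + s • v)) =
      (Set.Icc (-A) B).indicator fun s => (along x v f).derivative.eval s := by
    ext s
    by_cases hs : s ∈ Set.Icc (-A) B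
    · rw [Set.indicator_of_mem hs, Set.indicator_of_mem ((hset s).2 hs), derivative_along,
        eval_along]
    · rw [Set.indicator_of_notMem hs, Set.indicator_of_notMem (fun h => hs ((hset s).1 h))]
  rw [hind, MeasureTheory.integral_indicator measurableSet_Icc,
    MeasureTheory.integral_Icc_eq_integral_Ioc, ← intervalIntegral.integral_of_le hAB,
    intervalIntegral.integral_eq_sub_of_hasDerivAt (fun s _ => (along x v f).hasDerivAt s)
      ((along x v f).derivative.continuous.intervalIntegrable _ _),
    eval_along, eval_along, hf, map_mul, map_mul, map_mul, map_mul, hline B j, hline (-A) i, hgi, hgj]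
  ring

theorem dirD_sub_right (p : Poly) (u v : Pt) : dirD (u - v) p = dirD u p - dirD v p := by
  simp [dirD_apply, sub_mul, Finset.sum_sub_distrib]

/-- The divergence theorem for fields with vanishing normal components on the boundary. -/
theorem IsDual.integralK_div (h : IsDual a g) {w : Fin 3 → Poly}
    (hw : ∀ i x, eval x (bary a g i) = 0 → g i ⬝ᵥ evalVec x w = 0) :
    integralK a (∑ m, pderiv m (w m)) = 0 := by
  have hdeg : ∃ l, ∀ m, w m ∈ scalarPoly l :=
    ⟨∑ m, (w m).totalDegree, fun m => mem_scalarPoly.2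
      (Finset.single_le_sum (f := fun m => (w m).totalDegree) (fun _ _ => Nat.zero_le _)
        (Finset.mem_univ m))⟩
  obtain ⟨l, hl⟩ := hdeg
  choose p hp e using fun i => h.exists_eq_bary_mul i (l := l) (p := ∑ m, C (g i m) * w m)
    (Submodule.sum_mem _ fun m _ => C_mul_mem_scalarPoly _ (scalarPoly_mono (Nat.le_succ l) (hl m)))
    (fun x hx => by rw [← hw i x hx]; simp [dotProduct, evalVec])
  have hsum : ∑ i, bary a g i * p i = 0 := by
    simp only [← e]
    apply poly_ext
    intro x
    rw [map_zero, ← h.sum_dot (evalVec x w), map_sum]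
    simp [dotProduct, evalVec]
  have hrec : ∀ m, w m = ∑ i, C (a i m) * (bary a g i * p i) := by
    intro m
    simp only [← e]
    apply poly_ext
    intro x
    have := congrFun (h.sum_dot_smul (evalVec x w)) m
    rw [map_sum]
    simp only [Finset.sum_apply, Pi.smul_apply, smul_eq_mul] at this
    change eval x (w m) = _
    change _ = eval x (w m) at this
    rw [← this]
    refine Finset.sum_congr rfl fun i _ => ?_
    simp [dotProduct, evalVec, mul_comm]
  have hdiv : ∑ m, pderiv m (w m) = ∑ i, dirD (a i) (bary a g i * p i) := by
    simp only [dirD_apply]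
    rw [Finset.sum_comm]
    refine Finset.sum_congr rfl fun m _ => ?_
    conv_lhs => rw [hrec m]
    simp only [map_sum, pderiv_C_mul]
  -- Antisymmetrization, using `∑ λ_j = 1` and `∑ λ_j p_j = 0`, rewrites the divergence through
  -- derivatives along edges of functions divisible by `λ_i λ_j`.
  have hcyc : (2 : ℝ) • ∑ i, dirD (a i) (bary a g i * p i) =
      ∑ i, ∑ j, dirD (a i - a j) (bary a g i * bary a g j * (p i - p j)) := by
    have e1 : ∀ i, ∑ j, dirD (a i) (bary a g i * bary a g j * (p i - p j)) =
        dirD (a i) (bary a g i * p i) := by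
      intro i
      rw [← map_sum]
      congr 1
      have : ∀ j, bary a g i * bary a g j * (p i - p j) =
          bary a g j * (bary a g i * p i) - bary a g i * (bary a g j * p j) := by intro j; ring
      simp only [this, Finset.sum_sub_distrib, ← Finset.mul_sum, ← Finset.sum_mul, hsum, h.sum_bary]
      ring
    have e2 : ∀ j, ∑ i, dirD (a j) (bary a g i * bary a g j * (p i - p j)) =
        - dirD (a j) (bary a g j * p j) := by
      intro j
      rw [← e1 j, ← Finset.sum_neg_distrib]
      refine Finset.sum_congr rfl fun i _ => ?_
      rw [← map_neg]
      congr 1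
      ring
    simp only [dirD_sub_right, Finset.sum_sub_distrib, e1]
    rw [Finset.sum_comm]
    simp only [e2, Finset.sum_neg_distrib]
    rw [sub_neg_eq_add, two_smul]
  have h0 : (2 : ℝ) • integralK a (∑ m, pderiv m (w m)) = 0 := by
    rw [hdiv, ← map_smul, hcyc, map_sum]
    refine Finset.sum_eq_zero fun i _ => ?_
    rw [map_sum]
    refine Finset.sum_eq_zero fun j _ => ?_
    by_cases hij : i = j
    · subst hij; simp
    · exact h.integralK_dirD hij _
  simpa using h0

/-! ### Positivity -/

/-- The polynomial vanishes almost everywhere on the tetrahedron, hence on the open interior by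
continuity, and then on every line through the barycentre. -/
theorem IsDual.eq_zero_of_integralK_eq_zero (h : IsDual a g) {p : Poly}
    (hp : ∀ x ∈ tet a, 0 ≤ eval x p) (h0 : integralK a p = 0) : p = 0 := by
  have hint : MeasureTheory.IntegrableOn (fun x => eval x p) (tet a) :=
    (MvPolynomial.continuous_eval p).continuousOn.integrableOn_compact
      ((Set.finite_range a).isCompact_convexHull ℝ)
  rw [integralK_apply, MeasureTheory.setIntegral_eq_zero_iff_of_nonneg_ae
    ((MeasureTheory.ae_restrict_iff' (IsDual.measurableSet_tet a)).2 (Filter.Eventually.of_forall hp))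
    hint] at h0
  let U : Set Pt := {x | ∀ j, 0 < eval x (bary a g j)}
  have hU : IsOpen U := by
    have : U = ⋂ j, {x | 0 < eval x (bary a g j)} := by ext x; simp [U]
    rw [this]
    exact isOpen_iInter_of_finite fun j =>
      isOpen_lt continuous_const (MvPolynomial.continuous_eval _)
  have hUt : U ⊆ tet a := fun x hx => (h.mem_tet_iff x).2 fun j => (hx j).le
  have hpU : ∀ x ∈ U, eval x p = 0 :=
    MeasureTheory.Measure.eqOn_open_of_ae_eq (MeasureTheory.ae_restrict_of_ae_restrict_of_subset hUt h0)
      hU (MvPolynomial.continuous_eval p).continuousOn continuousOn_const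
  let b : Pt := ∑ i, (4⁻¹ : ℝ) • a i
  have hb : b ∈ U := by
    intro j
    have e : b - a 0 = ∑ i, (4⁻¹ : ℝ) • (a i - a 0) := by
      simp only [b, Fin.sum_univ_four]; module
    rw [h.eval_bary_eq j 0, e, dotProduct_sum]
    simp only [dotProduct_smul, h j _ 0, smul_eq_mul, mul_sub, Finset.sum_sub_distrib,
      Finset.sum_const]
    simp
  apply poly_ext
  intro y
  have hz : along b (y - b) p = 0 := by
    refine Polynomial.eq_zero_of_infinite_isRoot _
      (Set.Infinite.mono (s := {s : ℝ | b + s • (y - b) ∈ U}) (fun s hs => ?_) ?_)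
    · rw [Set.mem_ofPred_eq, Polynomial.IsRoot, eval_along]
      exact hpU _ hs
    · refine infinite_of_mem_nhds 0 ((hU.preimage (by fun_prop)).mem_nhds ?_)
      simpa using hb
  have := congrArg (Polynomial.eval 1) hz
  simpa [eval_along] using this

theorem IsDual.eq_zero_of_integralK_mul (h : IsDual a g) {b p : Poly}
    (hb : ∀ x ∈ tet a, 0 ≤ eval x b) (hb0 : b ≠ 0) (h0 : integralK a (b * p * p) = 0) : p = 0 := by
  have := h.eq_zero_of_integralK_eq_zero (p := b * p * p) (fun x hx => by
    rw [map_mul, map_mul, mul_assoc]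
    exact mul_nonneg (hb x hx) (mul_self_nonneg _)) h0
  simpa [hb0] using this

theorem IsDual.bary_ne_zero (h : IsDual a g) (i : Fin 4) : bary a g i ≠ 0 := by
  intro h0
  have := h.eval_bary_vertex i i
  rw [h0] at this
  simp at this

end

end DivDivElement

namespace DivDivElement

noncomputable section

open MvPolynomial

variable {a g n : Fin 4 → Pt}

/-! ### Moments on edges and faces -/

theorem mem_polyOn {l : ℕ} {G : Set Pt} {q : Poly} (hq : q ∈ scalarPoly l) :
    restrictTo G q ∈ polyOn l G := Submodule.mem_map_of_mem hq

theorem restrictTo_apply_of_mem {G : Set Pt} {x : Pt} (hx : x ∈ G) (q : Poly) :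
    restrictTo G q x = eval x q :=
  Set.indicator_of_mem hx fun x => eval x q

theorem edgePoint_mem (e : Edge) {s : ℝ} (hs : s ∈ Set.Icc (0 : ℝ) 1) :
    a e.1.1 + s • edgeVec a e ∈ edge a e := by
  rw [edge, segment_eq_image']
  exact ⟨s, hs, rfl⟩

theorem integralE_congr {e : Edge} {f f' : Pt → ℝ} (hf : ∀ x ∈ edge a e, f x = f' x) :
    integralE a e f = integralE a e f' := by
  refine intervalIntegral.integral_congr fun s hs => ?_
  rw [Set.uIcc_of_le zero_le_one] at hs
  simp only [hf _ (edgePoint_mem e hs)]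

theorem IsDual.dot_edgeVec (h : IsDual a g) (i : Fin 4) (e : Edge) :
    g i ⬝ᵥ edgeVec a e = (if i = e.1.2 then 1 else 0) - (if i = e.1.1 then 1 else 0) :=
  h i _ _

theorem IsDual.edgeVec_ne_zero (h : IsDual a g) (e : Edge) : edgeVec a e ≠ 0 := by
  intro h0
  have := h.dot_edgeVec e.1.2 e
  rw [h0, dotProduct_zero, if_pos rfl, if_neg e.2.ne'] at this
  norm_num at this

theorem sqrt_dot_self_pos {v : Pt} (hv : v ≠ 0) : 0 < √(v ⬝ᵥ v) := by
  refine Real.sqrt_pos.2 (lt_of_le_of_ne ?_ fun h => hv (dotProduct_self_eq_zero.1 h.symm))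
  exact Finset.sum_nonneg fun i _ => mul_self_nonneg _

theorem aeval_bary_mem (i : Fin 4) {l : ℕ} {r : Polynomial ℝ} (hr : r.natDegree ≤ l) :
    Polynomial.aeval (bary a g i) r ∈ scalarPoly l := by
  rw [Polynomial.aeval_eq_sum_range]
  refine Submodule.sum_mem _ fun m hm => Submodule.smul_mem _ _ ?_
  rw [mem_scalarPoly]
  refine (totalDegree_pow _ _).trans ?_
  have h1 := mem_scalarPoly.1 (bary_mem_scalarPoly (a := a) (g := g) i)
  have h2 : m ≤ r.natDegree := Nat.lt_succ_iff.1 (Finset.mem_range.1 hm)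
  nlinarith

theorem eval_aeval (x : Pt) (p : Poly) (r : Polynomial ℝ) :
    eval x (Polynomial.aeval p r) = r.eval (eval x p) := by
  have := Polynomial.hom_eval₂ r (algebraMap ℝ Poly) (eval x) p
  rw [Polynomial.aeval_def, this]
  have hc : (eval x).comp (algebraMap ℝ Poly) = RingHom.id ℝ := by
    ext c; simp [algebraMap_eq]
  rw [hc, Polynomial.eval₂_id]

/-- A polynomial that vanishes at the endpoints of an edge and whose moments on the edge vanish is
zero on the edge. -/
theorem IsDual.eval_eq_zero_of_edge_moments (h : IsDual a g) (e : Edge) {k : ℕ} (hk : 2 ≤ k)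
    {p : Poly} (hp : p ∈ scalarPoly k) (h0 : eval (a e.1.1) p = 0) (h1 : eval (a e.1.2) p = 0)
    (hq : ∀ q : polyOn (k - 2) (edge a e), integralE a e (fun x => eval x p * q.1 x) = 0) :
    ∀ x ∈ edge a e, eval x p = 0 := by
  set f := along (a e.1.1) (edgeVec a e) p with hf
  have hfs : ∀ s, f.eval s = eval (a e.1.1 + s • edgeVec a e) p := fun s => eval_along _ _ _ _
  have hf0 : f.IsRoot 0 := by rw [Polynomial.IsRoot, hfs]; simpa using h0
  -- Dividing by the zeros at both endpoints gives `f = s (s - 1) r` with `deg r ≤ k - 2`, and `r`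
  -- itself is an admissible test function.
  obtain ⟨f₁, hf₁⟩ := Polynomial.dvd_iff_isRoot.2 hf0
  have hf1 : f₁.IsRoot 1 := by
    have : f.eval 1 = 0 := by rw [hfs]; simpa [edgeVec] using h1
    rw [hf₁] at this
    simpa using this
  obtain ⟨r, hr⟩ := Polynomial.dvd_iff_isRoot.2 hf1
  rw [hr] at hf₁
  have hdeg : r.natDegree ≤ k - 2 := by
    have hd := natDegree_along_le hp (a e.1.1) (edgeVec a e)
    rw [← hf, hf₁] at hd
    by_cases hr0 : r = 0
    · simp [hr0]
    · rw [Polynomial.natDegree_mul (Polynomial.X_sub_C_ne_zero _)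
        (mul_ne_zero (Polynomial.X_sub_C_ne_zero _) hr0),
        Polynomial.natDegree_mul (Polynomial.X_sub_C_ne_zero _) hr0,
        Polynomial.natDegree_X_sub_C, Polynomial.natDegree_X_sub_C] at hd
      omega
  -- The barycentric coordinate of the second endpoint equals the parameter `s` on the edge, so it
  -- lifts `r` to a polynomial in space.
  have hI := hq ⟨_, mem_polyOn (aeval_bary_mem (a := a) (g := g) e.1.2 hdeg)⟩
  set c := √(edgeVec a e ⬝ᵥ edgeVec a e) with hc
  have hcpos : 0 < c := sqrt_dot_self_pos (h.edgeVec_ne_zero e)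
  have hval : ∀ s ∈ Set.Icc (0 : ℝ) 1,
      eval (a e.1.1 + s • edgeVec a e) p * restrictTo (edge a e)
        (Polynomial.aeval (bary a g e.1.2) r) (a e.1.1 + s • edgeVec a e) * c =
      -(s * (1 - s) * r.eval s ^ 2 * c) := by
    intro s hs
    rw [restrictTo_apply_of_mem (edgePoint_mem e hs), eval_aeval, ← hfs, hf₁, eval_bary_add_smul,
      h.eval_bary_vertex, h.dot_edgeVec, if_neg e.2.ne', if_pos rfl]
    simp
    ring
  rw [integralE, intervalIntegral.integral_congr (g := fun s => -(s * (1 - s) * r.eval s ^ 2 * c))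
    (fun s hs => hval s (by rwa [Set.uIcc_of_le zero_le_one] at hs)),
    intervalIntegral.integral_neg, neg_eq_zero] at hI
  have hr0 : r = 0 := by
    by_contra hr0
    have hfin := r.roots.toFinset.finite_toSet
    obtain ⟨s, hs, hsr⟩ := (Set.Ioo_infinite (zero_lt_one' ℝ)).exists_notMem_finite hfin
    have hpos : 0 < ∫ s in (0 : ℝ)..1, s * (1 - s) * r.eval s ^ 2 * c := by
      refine intervalIntegral.integral_pos zero_lt_one (by fun_prop) (fun s hs => ?_)
        ⟨s, Set.Ioo_subset_Icc_self hs, ?_⟩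
      · have h1 : 0 ≤ s := hs.1.le
        have h2 : 0 ≤ 1 - s := by linarith [hs.2]
        positivity
      · have h1 : 0 < s := hs.1
        have h2 : 0 < 1 - s := by linarith [hs.2]
        have h3 : r.eval s ≠ 0 := by
          intro h3; apply hsr; simp [hr0, h3]
        positivity
    exact hpos.ne' hI
  intro x hx
  rw [edge, segment_eq_image'] at hx
  obtain ⟨s, -, rfl⟩ := hx
  have := hfs s
  rw [hf₁, hr0] at this
  simpa [edgeVec] using this.symm

/-- The parametrization of the face opposite to the vertex `i`. -/
def facePoint (a : Fin 4 → Pt) (i : Fin 4) (z : ℝ × ℝ) : Pt :=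
  a (i.succAbove 0) + z.1 • (a (i.succAbove 1) - a (i.succAbove 0)) +
    z.2 • (a (i.succAbove 2) - a (i.succAbove 0))

theorem IsDual.eval_bary_facePoint (h : IsDual a g) (i j : Fin 4) (z : ℝ × ℝ) :
    eval (facePoint a i z) (bary a g j) =
      (if j = i.succAbove 0 then 1 - z.1 - z.2 else 0) + (if j = i.succAbove 1 then z.1 else 0) +
        (if j = i.succAbove 2 then z.2 else 0) := by
  rw [facePoint, eval_bary_add_smul, eval_bary_add_smul, h.eval_bary_vertex, h, h]
  split_ifs <;> ring

theorem IsDual.facePoint_mem (h : IsDual a g) (i : Fin 4) {z : ℝ × ℝ} (hz : z ∈ refTriangle) :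
    facePoint a i z ∈ face a i := by
  obtain ⟨h1, h2, h3⟩ := hz
  rw [h.mem_face_iff]
  constructor
  · intro j
    rw [h.eval_bary_facePoint]
    have : 0 ≤ 1 - z.1 - z.2 := by linarith
    refine add_nonneg (add_nonneg ?_ ?_) ?_ <;> split_ifs <;> first | assumption | exact le_rfl
  · rw [h.eval_bary_facePoint, if_neg (Fin.succAbove_ne i 0).symm,
      if_neg (Fin.succAbove_ne i 1).symm, if_neg (Fin.succAbove_ne i 2).symm]
    ring

theorem IsDual.eq_facePoint (h : IsDual a g) {i : Fin 4} {x : Pt}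
    (hx : eval x (bary a g i) = 0) :
    x = facePoint a i (eval x (bary a g (i.succAbove 1)), eval x (bary a g (i.succAbove 2))) := by
  have h1 := h.sum_eval_bary x
  have h2 := h.sum_eval_bary_smul x
  rw [Fin.sum_univ_succAbove _ i, Fin.sum_univ_three, hx, zero_add] at h1
  rw [Fin.sum_univ_succAbove _ i, Fin.sum_univ_three, hx, zero_smul, zero_add] at h2
  rw [facePoint]
  conv_lhs => rw [← h2]
  rw [show eval x (bary a g (i.succAbove 0)) = 1 - eval x (bary a g (i.succAbove 1)) -
    eval x (bary a g (i.succAbove 2)) by linarith]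
  module

theorem IsDual.face_cross_ne_zero (h : IsDual a g) (i : Fin 4) :
    (a (i.succAbove 1) - a (i.succAbove 0)) ⨯₃ (a (i.succAbove 2) - a (i.succAbove 0)) ≠ 0 := by
  have h01 : i.succAbove 1 ≠ i.succAbove 0 := by simp
  have h02 : i.succAbove 2 ≠ i.succAbove 0 := by simp
  have h12 : i.succAbove 1 ≠ i.succAbove 2 := by simp
  intro h0
  have hne : a (i.succAbove 2) - a (i.succAbove 0) ≠ 0 := by
    intro h0
    have := h (i.succAbove 2) (i.succAbove 2) (i.succAbove 0)
    rw [h0, dotProduct_zero, if_pos rfl, if_neg h02] at this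
    norm_num at this
  have := dot_eq_zero_of_cross_eq_zero (t := g (i.succAbove 1)) hne h0
    (by rw [h, if_neg h12, if_neg h01, sub_zero])
  rw [h, if_pos rfl, if_neg h01] at this
  norm_num at this

theorem integralF_eq (i : Fin 4) (f : Pt → ℝ) :
    integralF a i f = ∫ z in refTriangle, f (facePoint a i z) *
      √(((a (i.succAbove 1) - a (i.succAbove 0)) ⨯₃ (a (i.succAbove 2) - a (i.succAbove 0))) ⬝ᵥ
        ((a (i.succAbove 1) - a (i.succAbove 0)) ⨯₃ (a (i.succAbove 2) - a (i.succAbove 0)))) := rfl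

theorem isClosed_refTriangle : IsClosed refTriangle :=
  (isClosed_le continuous_const continuous_fst).inter
    ((isClosed_le continuous_const continuous_snd).inter
      (isClosed_le (continuous_fst.add continuous_snd) continuous_const))

theorem isCompact_refTriangle : IsCompact refTriangle := by
  refine (isCompact_Icc.prod isCompact_Icc : IsCompact (Set.Icc (0 : ℝ) 1 ×ˢ Set.Icc (0 : ℝ) 1)).of_isClosed_subset
    isClosed_refTriangle fun z hz => ?_
  obtain ⟨h1, h2, h3⟩ := hz
  exact ⟨⟨h1, by linarith⟩, ⟨h2, by linarith⟩⟩

theorem IsDual.integralF_congr (h : IsDual a g) {i : Fin 4} {f f' : Pt → ℝ}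
    (hf : ∀ x ∈ face a i, f x = f' x) : integralF a i f = integralF a i f' := by
  rw [integralF_eq, integralF_eq]
  refine MeasureTheory.setIntegral_congr_fun isClosed_refTriangle.measurableSet fun z hz => ?_
  simp only [hf _ (h.facePoint_mem i hz)]

/-- A nonnegative polynomial whose integral over a face vanishes is zero on the face. -/
theorem IsDual.eval_eq_zero_of_integralF (h : IsDual a g) {i : Fin 4} {p : Poly}
    (hp : ∀ x ∈ face a i, 0 ≤ eval x p) (h0 : integralF a i (fun x => eval x p) = 0) {x : Pt}
    (hx : eval x (bary a g i) = 0) : eval x p = 0 := by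
  have hcont : Continuous (facePoint a i) := by
    unfold facePoint; fun_prop
  have hcont' : Continuous fun z => eval (facePoint a i z) p :=
    (MvPolynomial.continuous_eval p).comp hcont
  rw [integralF_eq, MeasureTheory.integral_mul_const, mul_eq_zero,
    or_iff_left (sqrt_dot_self_pos (h.face_cross_ne_zero i)).ne',
    MeasureTheory.setIntegral_eq_zero_iff_of_nonneg_ae
      ((MeasureTheory.ae_restrict_iff' isClosed_refTriangle.measurableSet).2
        (Filter.Eventually.of_forall fun z hz => hp _ (h.facePoint_mem i hz)))
      (hcont'.continuousOn.integrableOn_compact isCompact_refTriangle)] at h0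
  let U : Set (ℝ × ℝ) := {z | 0 < z.1 ∧ 0 < z.2 ∧ z.1 + z.2 < 1}
  have hU : IsOpen U :=
    (isOpen_lt continuous_const continuous_fst).inter
      ((isOpen_lt continuous_const continuous_snd).inter
        (isOpen_lt (continuous_fst.add continuous_snd) continuous_const))
  have hUt : U ⊆ refTriangle := fun z hz => ⟨hz.1.le, hz.2.1.le, hz.2.2.le⟩
  have hpU : ∀ z ∈ U, eval (facePoint a i z) p = 0 :=
    MeasureTheory.Measure.eqOn_open_of_ae_eq (MeasureTheory.ae_restrict_of_ae_restrict_of_subset hUt h0)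
      hU hcont'.continuousOn continuousOn_const
  let b : ℝ × ℝ := (3⁻¹, 3⁻¹)
  have hb : b ∈ U := by refine ⟨?_, ?_, ?_⟩ <;> norm_num [b]
  set z : ℝ × ℝ := (eval x (bary a g (i.succAbove 1)), eval x (bary a g (i.succAbove 2)))
  have hz : x = facePoint a i z := h.eq_facePoint hx
  have hz0 : along (facePoint a i b) (x - facePoint a i b) p = 0 := by
    refine Polynomial.eq_zero_of_infinite_isRoot _
      (Set.Infinite.mono (s := {s : ℝ | b + s • (z - b) ∈ U}) (fun s hs => ?_) ?_)
    · rw [Set.mem_ofPred_eq, Polynomial.IsRoot, eval_along]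
      have e : facePoint a i b + s • (x - facePoint a i b) = facePoint a i (b + s • (z - b)) := by
        rw [hz]
        simp only [facePoint, Prod.fst_add, Prod.snd_add, Prod.smul_fst, Prod.smul_snd,
          Prod.fst_sub, Prod.snd_sub, smul_eq_mul]
        module
      rw [e]
      exact hpU _ hs
    · refine infinite_of_mem_nhds 0 ((hU.preimage (by fun_prop)).mem_nhds ?_)
      simpa using hb
  have := congrArg (Polynomial.eval 1) hz0
  simpa [eval_along] using this

/-- A polynomial whose moments on a face vanish is zero on the face. -/
theorem IsDual.eval_eq_zero_of_face_moments (h : IsDual a g) (i : Fin 4) {l : ℕ}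
    {p : Poly} (hp : p ∈ scalarPoly l)
    (hq : ∀ q : polyOn l (face a i), integralF a i (fun x => eval x p * q.1 x) = 0) {x : Pt}
    (hx : eval x (bary a g i) = 0) : eval x p = 0 := by
  have := h.eval_eq_zero_of_integralF (p := p * p) (i := i)
    (fun x _ => by rw [map_mul]; exact mul_self_nonneg _)
    (by
      rw [← hq ⟨_, mem_polyOn hp⟩]
      refine h.integralF_congr fun x hx => ?_
      change _ = eval x p * restrictTo _ _ x
      rw [restrictTo_apply_of_mem hx, map_mul]) hx
  simpa using this

/-- A polynomial that vanishes on the edges of a face and whose moments on the face of degree lower by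
three vanish is zero on the face. -/
theorem IsDual.eval_eq_zero_of_face_interior_moments (h : IsDual a g) (i : Fin 4) {k : ℕ}
    (hk : 3 ≤ k) {p : Poly} (hp : p ∈ scalarPoly k)
    (h0 : ∀ j, j ≠ i → ∀ x, eval x (bary a g i) = 0 → eval x (bary a g j) = 0 → eval x p = 0)
    (hq : ∀ q : polyOn (k - 3) (face a i), integralF a i (fun x => eval x p * q.1 x) = 0) {x : Pt}
    (hx : eval x (bary a g i) = 0) : eval x p = 0 := by
  obtain ⟨A, r, hr, e⟩ := h.exists_eq_bary_mul_add_faceBubble i (l := k - 3)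
    (by rwa [Nat.sub_add_cancel hk]) h0
  have hpx : ∀ x, eval x (bary a g i) = 0 → eval x p = eval x (faceBubble a g i) * eval x r := by
    intro x hx
    rw [e, map_add, map_mul, hx, map_mul]; ring
  have := h.eval_eq_zero_of_integralF (p := faceBubble a g i * r * r) (i := i)
    (fun x hx => by
      rw [map_mul, map_mul, mul_assoc]
      refine mul_nonneg ?_ (mul_self_nonneg _)
      rw [faceBubble, map_prod]
      exact Finset.prod_nonneg fun j _ => ((h.mem_face_iff i x).1 hx).1 j)
    (by
      rw [← hq ⟨_, mem_polyOn hr⟩]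
      refine h.integralF_congr fun x hx => ?_
      change _ = eval x p * restrictTo _ _ x
      rw [restrictTo_apply_of_mem hx, hpx x ((h.mem_face_iff i x).1 hx).2, map_mul, map_mul]) hx
  rw [hpx x hx]
  rw [map_mul, map_mul] at this
  rcases mul_eq_zero.1 this with h1 | h1
  · exact h1
  · rw [h1, mul_zero]

end

end DivDivElement

namespace DivDivElement

noncomputable section

open MvPolynomial

variable {a g n : Fin 4 → Pt}

/-! ### Green's formulas -/

/-- The divergence theorem for `σᵀ φ`, whose normal component `(σ g_i) · φ` vanishes on each face.
-/
theorem IsDual.innerMatK_grad (h : IsDual a g) {σ : Matrix (Fin 3) (Fin 3) Poly}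
    (hσ : ∀ i x, eval x (bary a g i) = 0 → evalMat x σ *ᵥ g i = 0) (φ : Fin 3 → Poly) :
    innerMatK a σ (grad φ) = -innerVecK a (divMat σ) φ := by
  have := h.integralK_div (w := fun j => ∑ i, σ i j * φ i) (by
    intro i x hx
    have hs : g i ⬝ᵥ evalVec x (fun j => ∑ l, σ l j * φ l) =
        (evalMat x σ *ᵥ g i) ⬝ᵥ evalVec x φ := by
      simp [evalVec, dotProduct, Matrix.mulVec, evalMat, Fin.sum_univ_three]
      ring
    rw [hs, hσ i x hx, zero_dotProduct])
  rw [innerMatK, innerVecK, eq_neg_iff_add_eq_zero, ← map_add, ← this]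
  congr 1
  simp only [grad, divMat, dotProduct, pderiv_mul, Matrix.of_apply, Fin.sum_univ_three, map_add]
  ring

theorem IsDual.integralK_dot_gradS (h : IsDual a g) {v : Fin 3 → Poly}
    (hv : ∀ i x, eval x (bary a g i) = 0 → g i ⬝ᵥ evalVec x v = 0) (q : Poly) :
    innerVecK a v (gradS q) = -integralK a ((∑ i, pderiv i (v i)) * q) := by
  have := h.integralK_div (w := fun j => v j * q) (by
    intro i x hx
    have hs : g i ⬝ᵥ evalVec x (fun j => v j * q) = (g i ⬝ᵥ evalVec x v) * eval x q := by
      simp [evalVec, dotProduct, Fin.sum_univ_three]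
      ring
    rw [hs, hv i x hx, zero_mul])
  rw [innerVecK, eq_neg_iff_add_eq_zero, ← map_add, ← this]
  congr 1
  simp only [gradS, dotProduct, pderiv_mul, Fin.sum_univ_three]
  ring

theorem hess_eq (q : Poly) : hess q = grad (gradS q) := rfl

theorem IsDual.eq_zero_of_innerVecK_self (h : IsDual a g) {v : Fin 3 → Poly}
    (hv : innerVecK a v v = 0) : v = 0 := by
  have := h.eq_zero_of_integralK_eq_zero (p := v ⬝ᵥ v) (fun x _ => by
    rw [dotProduct, map_sum]
    exact Finset.sum_nonneg fun i _ => by rw [map_mul]; exact mul_self_nonneg _) hv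
  ext1 i
  apply poly_ext
  intro x
  have hx := congrArg (eval x) this
  rw [dotProduct, map_sum, map_zero] at hx
  have := (Finset.sum_eq_zero_iff_of_nonneg
    (fun i _ => by rw [map_mul]; exact mul_self_nonneg _)).1 hx i (Finset.mem_univ i)
  simpa using this

theorem IsDual.eq_zero_of_innerMatK_self (h : IsDual a g) {σ : Matrix (Fin 3) (Fin 3) Poly}
    (hσ : innerMatK a σ σ = 0) : σ = 0 := by
  have := h.eq_zero_of_integralK_eq_zero (p := ∑ i, ∑ j, σ i j * σ i j) (fun x _ => by
    simp only [map_sum, map_mul]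
    exact Finset.sum_nonneg fun i _ => Finset.sum_nonneg fun j _ => mul_self_nonneg _) hσ
  ext1 i j
  apply poly_ext
  intro x
  have hx := congrArg (eval x) this
  simp only [map_sum, map_mul, map_zero] at hx
  have h1 := (Finset.sum_eq_zero_iff_of_nonneg
    (fun i _ => Finset.sum_nonneg fun j _ => mul_self_nonneg _)).1 hx i (Finset.mem_univ i)
  have h2 := (Finset.sum_eq_zero_iff_of_nonneg
    (fun j _ => mul_self_nonneg _)).1 h1 j (Finset.mem_univ j)
  simpa using h2

theorem sum_mul_grad_rigidMotion {σ : Matrix (Fin 3) (Fin 3) Poly} (hσ : σᵀ = σ) (c : Fin 6 → ℝ) :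
    ∑ i, ∑ j, σ i j * grad (rigidMotion c) i j = 0 := by
  have hs : ∀ i j, σ i j = σ j i := fun i j => congrFun (congrFun hσ j) i
  have h1 := hs 1 0
  have h2 := hs 2 0
  have h3 := hs 2 1
  simp [grad, rigidMotion, Fin.sum_univ_three, pderiv_X, h1, h2, h3]
  abel

/-! ### The degrees of freedom determine the field -/

/-- Both `t` and `w` are parallel to `ν 0 × ν 1`, so a vector orthogonal to `t` is orthogonal to
`w`. The two normals need not be orthogonal to each other. -/
theorem dot_eq_zero_of_edge_frame {t w γ : Pt} {ν : Fin 2 → Pt} (ht : t ≠ 0)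
    (hνt : ∀ i, ν i ⬝ᵥ t = 0) (hν : LinearIndependent ℝ ν) (hw : ∀ i, ν i ⬝ᵥ w = 0)
    (hγ : γ ⬝ᵥ t = 0) : γ ⬝ᵥ w = 0 := by
  have hc : ν 0 ⨯₃ ν 1 ≠ 0 := by
    have e : ![ν 0, ν 1] = ν := by
      ext1 i
      fin_cases i <;> rfl
    refine crossProduct_ne_zero_iff_linearIndependent.2 ?_
    rw [e]
    exact hν
  have key : ∀ w : Pt, (∀ i, ν i ⬝ᵥ w = 0) → (ν 0 ⨯₃ ν 1) ⨯₃ w = 0 := by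
    intro w hw
    rw [cross_cross_eq_smul_sub_smul, hw 0, hw 1]
    simp
  refine dot_eq_zero_of_cross_eq_zero hc ?_ (dot_eq_zero_of_cross_eq_zero ht (key t hνt) hγ)
  rw [← cross_anticomm, key w hw, neg_zero]

/-- The polynomial `uᵀ σ w`. -/
def biPoly (u w : Pt) : Matrix (Fin 3) (Fin 3) Poly →ₗ[ℝ] Poly where
  toFun σ := ∑ i, ∑ j, C (u i * w j) * σ i j
  map_add' σ τ := by simp only [Matrix.add_apply, mul_add, Finset.sum_add_distrib]
  map_smul' c σ := by
    simp only [Matrix.smul_apply, mul_smul_comm, Finset.smul_sum, RingHom.id_apply]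

theorem eval_biPoly (u w x : Pt) (σ : Matrix (Fin 3) (Fin 3) Poly) :
    eval x (biPoly u w σ) = u ⬝ᵥ (evalMat x σ *ᵥ w) := by
  simp [biPoly, evalMat, dotProduct, Matrix.mulVec, Fin.sum_univ_three]
  ring

theorem biPoly_mem {u w : Pt} {l : ℕ} {σ : Matrix (Fin 3) (Fin 3) Poly}
    (hσ : ∀ i j, σ i j ∈ scalarPoly l) : biPoly u w σ ∈ scalarPoly l :=
  Submodule.sum_mem _ fun i _ => Submodule.sum_mem _ fun j _ => C_mul_mem_scalarPoly _ (hσ i j)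

/-- The polynomial `w · v`. -/
def dotPoly (w : Pt) : (Fin 3 → Poly) →ₗ[ℝ] Poly where
  toFun v := ∑ i, C (w i) * v i
  map_add' u v := by simp only [Pi.add_apply, mul_add, Finset.sum_add_distrib]
  map_smul' c v := by
    simp only [Pi.smul_apply, mul_smul_comm, Finset.smul_sum, RingHom.id_apply]

theorem eval_dotPoly (w x : Pt) (v : Fin 3 → Poly) :
    eval x (dotPoly w v) = evalVec x v ⬝ᵥ w := by
  simp [dotPoly, evalVec, dotProduct, mul_comm]

theorem dotPoly_mem {w : Pt} {l : ℕ} {v : Fin 3 → Poly} (hv : v ∈ vecPoly l) :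
    dotPoly w v ∈ scalarPoly l :=
  Submodule.sum_mem _ fun i _ => C_mul_mem_scalarPoly _ (hv i)

theorem divMat_mem {l : ℕ} {σ : Matrix (Fin 3) (Fin 3) Poly}
    (hσ : ∀ i j, σ i j ∈ scalarPoly (l + 1)) : divMat σ ∈ vecPoly l := fun i =>
  Submodule.sum_mem _ fun j _ => pderiv_mem_scalarPoly j (hσ i j)

theorem evalMat_transpose {σ : Matrix (Fin 3) (Fin 3) Poly} (hσ : σᵀ = σ) (x : Pt) :
    (evalMat x σ)ᵀ = evalMat x σ := by
  rw [evalMat, ← Matrix.transpose_map, hσ]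

theorem dot_mulVec_symm {A : Matrix (Fin 3) (Fin 3) ℝ} (hA : Aᵀ = A) (u w : Pt) :
    u ⬝ᵥ (A *ᵥ w) = w ⬝ᵥ (A *ᵥ u) := by
  rw [Matrix.dotProduct_mulVec, ← Matrix.mulVec_transpose, hA, dotProduct_comm]

variable {t : Edge → Pt} {ν : Edge → Fin 2 → Pt} {k : ℕ}

/-- The edge data leave only `tᵀ σ t` undetermined on the edge, and `σ g_i` does not involve it
because `g_i` is orthogonal to `t`. -/
theorem IsDual.normal_eq_zero_of_edge_dofs (h : IsDual a g) (ht : ∀ e, IsEdgeTangent a e (t e))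
    (hν : ∀ e, AreEdgeNormals a e (ν e)) (hk : 2 ≤ k) {σ : Matrix (Fin 3) (Fin 3) Poly}
    (hσ : σ ∈ symPoly k) (hv : ∀ i, evalMat (a i) σ = 0)
    (hTN : ∀ e j (q : polyOn (k - 2) (edge a e)),
      integralE a e (fun x => (t e ⬝ᵥ (evalMat x σ *ᵥ ν e j)) * q.1 x) = 0)
    (hNN : ∀ e (p : NormalPair) (q : polyOn (k - 2) (edge a e)),
      integralE a e (fun x => (ν e p.1.1 ⬝ᵥ (evalMat x σ *ᵥ ν e p.1.2)) * q.1 x) = 0)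
    {i j : Fin 4} (hij : i ≠ j) {x : Pt} (hi : eval x (bary a g i) = 0)
    (hj : eval x (bary a g j) = 0) : evalMat x σ *ᵥ g i = 0 := by
  -- The edge whose endpoints are the two vertices other than `i` and `j`; it spans the line `λ_i =
  -- λ_j = 0`.
  have hd : ∀ i j : Fin 4, i ≠ j → ∃ e : Fin 4 × Fin 4, e.1 < e.2 ∧ i ≠ e.1 ∧ i ≠ e.2 ∧
      ∀ m, m ≠ e.1 → m ≠ e.2 → m = i ∨ m = j := by decide
  obtain ⟨e₀, he, hi1, hi2, hm⟩ := hd i j hij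
  let e : Edge := ⟨e₀, he⟩
  have htν : ∀ s, ν e s ⬝ᵥ t e = 0 := by
    intro s
    obtain ⟨c, hc⟩ := (ht e).2
    rw [hc, dotProduct_smul, (hν e).2.1 s, smul_zero]
  have ht0 : t e ≠ 0 := by
    intro h0
    have := (ht e).1
    rw [h0] at this
    simp at this
  have hgt : g i ⬝ᵥ t e = 0 := by
    obtain ⟨c, hc⟩ := (ht e).2
    rw [hc, dotProduct_smul, h.dot_edgeVec, if_neg hi1, if_neg hi2]
    simp
  have moment : ∀ u w : Pt, (∀ q : polyOn (k - 2) (edge a e),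
      integralE a e (fun x => (u ⬝ᵥ (evalMat x σ *ᵥ w)) * q.1 x) = 0) →
      ∀ x ∈ edge a e, u ⬝ᵥ (evalMat x σ *ᵥ w) = 0 := by
    intro u w hq x hx
    rw [← eval_biPoly]
    refine h.eval_eq_zero_of_edge_moments e hk (biPoly_mem hσ.2) ?_ ?_ ?_ x hx
    · rw [eval_biPoly, hv]; simp
    · rw [eval_biPoly, hv]; simp
    · intro q
      simp only [eval_biPoly]
      exact hq q
  have hedge : ∀ x ∈ segment ℝ (a e₀.1) (a e₀.2), evalMat x σ *ᵥ g i = 0 := by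
    intro x hx
    have hsym := evalMat_transpose hσ.1 x
    set A := evalMat x σ
    have h1 : ∀ s, t e ⬝ᵥ (A *ᵥ ν e s) = 0 := fun s => moment _ _ (hTN e s) x hx
    have h2 : ∀ s s', ν e s ⬝ᵥ (A *ᵥ ν e s') = 0 := by
      intro s s'
      rcases le_total s s' with hs | hs
      · exact moment _ _ (hNN e ⟨(s, s'), hs⟩) x hx
      · rw [dot_mulVec_symm hsym]
        exact moment _ _ (hNN e ⟨(s', s), hs⟩) x hx
    have frame : ∀ w : Pt, (∀ s, ν e s ⬝ᵥ w = 0) → t e ⬝ᵥ w = 0 → w = 0 := by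
      intro w hw htw
      apply dotProduct_self_eq_zero.1
      refine dot_eq_zero_of_edge_frame ht0 htν (hν e).2.2 hw ?_
      rw [dotProduct_comm]; exact htw
    have h3 : ∀ s, A *ᵥ ν e s = 0 := fun s => frame _ (fun s' => h2 s' s) (h1 s)
    refine frame _ (fun s => ?_) ?_
    · rw [dot_mulVec_symm hsym, h3, dotProduct_zero]
    · rw [dot_mulVec_symm hsym]
      refine dot_eq_zero_of_edge_frame ht0 htν (hν e).2.2 (fun s => ?_) hgt
      rw [dot_mulVec_symm hsym, h1]
  ext m
  have hcomp : ∀ x, (evalMat x σ *ᵥ g i) m = eval x (biPoly (Pi.single m 1) (g i) σ) := by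
    intro x; rw [eval_biPoly, single_one_dotProduct]
  rw [hcomp]
  refine h.eval_eq_zero_of_segment (i := e₀.1) (j := e₀.2) (fun y hy => ?_) fun l hl1 hl2 => ?_
  · rw [← hcomp, hedge y hy]; rfl
  · rcases hm l hl1 hl2 with rfl | rfl <;> assumption

/-- A field for which all degrees of freedom vanish is zero. -/
theorem IsDual.eq_zero_of_dofs (h : IsDual a g) (hgn : UnitNormals g n)
    (ht : ∀ e, IsEdgeTangent a e (t e)) (hν : ∀ e, AreEdgeNormals a e (ν e)) (hk : 3 ≤ k)
    {N : Submodule ℝ (Matrix (Fin 3) (Fin 3) Poly)}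
    (hN : (spaceM a n (k + 2)).map curlCurlStar ≤ N)
    {σ : Matrix (Fin 3) (Fin 3) Poly}
    (hσ : σ ∈ symPoly k) (hv : ∀ i, evalMat (a i) σ = 0)
    (hTN : ∀ e j (q : polyOn (k - 2) (edge a e)),
      integralE a e (fun x => (t e ⬝ᵥ (evalMat x σ *ᵥ ν e j)) * q.1 x) = 0)
    (hNN : ∀ e (p : NormalPair) (q : polyOn (k - 2) (edge a e)),
      integralE a e (fun x => (ν e p.1.1 ⬝ᵥ (evalMat x σ *ᵥ ν e p.1.2)) * q.1 x) = 0)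
    (hF : ∀ i (φ : Fin 3 → polyOn (k - 3) (face a i)),
      integralF a i (fun x => (evalMat x σ *ᵥ n i) ⬝ᵥ fun j => (φ j).1 x) = 0)
    (hD : ∀ i (q : polyOn (k - 1) (face a i)),
      integralF a i (fun x => (evalVec x (divMat σ) ⬝ᵥ n i) * q.1 x) = 0)
    (hH : ∀ η : hessians (k - 2), innerMatK a σ η.1 = 0)
    (hC : ∀ w : curlSpace a n k, innerMatK a σ (grad w.1) = 0)
    (hT : ∀ τ : N, innerMatK a σ τ.1 = 0) : σ = 0 := by
  have hσn : ∀ i x, eval x (bary a g i) = 0 → evalMat x σ *ᵥ g i = 0 := by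
    intro i x hx
    rw [← hgn.mulVec_iff]
    ext m
    have hcomp : ∀ x, (evalMat x σ *ᵥ n i) m = eval x (biPoly (Pi.single m 1) (n i) σ) := by
      intro x; rw [eval_biPoly, single_one_dotProduct]
    rw [hcomp]
    refine h.eval_eq_zero_of_face_interior_moments i hk (biPoly_mem hσ.2) ?_ ?_ hx
    · intro j hj y hyi hyj
      rw [← hcomp, (hgn.mulVec_iff i _).2 (h.normal_eq_zero_of_edge_dofs ht hν (by omega) hσ hv
        hTN hNN hj.symm hyi hyj)]
      rfl
    · intro q
      rw [← hF i (Pi.single m q)]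
      congr 1
      ext y
      rw [← hcomp, dotProduct, Finset.sum_eq_single m]
      · simp
      · intro j _ hj
        simp [Pi.single_eq_of_ne hj]
      · simp
  obtain ⟨l, rfl⟩ : ∃ l, k = l + 2 := ⟨k - 2, by omega⟩
  have hdiv : divMat σ ∈ vecPoly (l + 1) := divMat_mem hσ.2
  have hdn : ∀ i x, eval x (bary a g i) = 0 → g i ⬝ᵥ evalVec x (divMat σ) = 0 := by
    intro i x hx
    rw [← hgn.dot_iff, ← eval_dotPoly]
    refine h.eval_eq_zero_of_face_moments i (dotPoly_mem hdiv) ?_ hx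
    intro q
    simp only [eval_dotPoly]
    exact hD i q
  -- Two integrations by parts against the Hessian of `q = div div σ` itself, which has degree `k -
  -- 2`, give `(q, q)_K = 0`.
  have hdd : ∑ i, pderiv i (divMat σ i) = 0 := by
    set q := ∑ i, pderiv i (divMat σ i) with hq
    have hqm : q ∈ scalarPoly l :=
      Submodule.sum_mem _ fun i _ => pderiv_mem_scalarPoly i (hdiv i)
    have h1 : innerMatK a σ (hess q) = 0 := hH ⟨hess q, Submodule.mem_map_of_mem hqm⟩
    rw [hess_eq, h.innerMatK_grad hσn, h.integralK_dot_gradS hdn, neg_neg, ← hq] at h1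
    refine h.eq_zero_of_integralK_mul (b := 1) (fun x _ => by simp) one_ne_zero ?_
    rwa [one_mul]
  have hd0 : divMat σ = 0 := by
    obtain ⟨φ, hφ, hφc, hφn⟩ := h.exists_curl_eq hdiv hdd hdn
    have hmem : divMat σ ∈ curlSpace a n (l + 2) := by
      refine ⟨⟨φ, ⟨hφ, fun i x hx => ?_⟩, hφc⟩, fun c => ?_⟩
      · exact (hgn.cross_iff i _).2 (hφn i x ((h.mem_face_iff i x).1 hx).2)
      -- The gradient of a rigid motion is skew, so it is pointwise orthogonal to the symmetric `σ`.
      · have h1 := h.innerMatK_grad hσn (rigidMotion c)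
        rw [innerMatK, sum_mul_grad_rigidMotion hσ.1, map_zero] at h1
        linarith
    have h1 := hC ⟨_, hmem⟩
    rw [h.innerMatK_grad hσn, neg_eq_zero] at h1
    exact h.eq_zero_of_innerVecK_self h1
  obtain ⟨τ, hτ, hτσ⟩ := h.exists_curlCurlStar_eq hgn (l := l + 1) hσ hd0 hσn
  apply h.eq_zero_of_innerMatK_self
  exact hT ⟨σ, hN ⟨τ, hτ, hτσ⟩⟩

end

end DivDivElement

namespace DivDivElement

noncomputable section

open MvPolynomial

variable {a g n : Fin 4 → Pt}

/-! ### Dimension counting: general facts -/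

/-- For a bilinear pairing, the codimensions of the two kernels agree; here one inequality. -/
theorem finrank_add_finrank_ker_le {E V : Type*} [AddCommGroup E] [Module ℝ E]
    [FiniteDimensional ℝ E] [AddCommGroup V] [Module ℝ V] [FiniteDimensional ℝ V]
    (B : E →ₗ[ℝ] V →ₗ[ℝ] ℝ) :
    Module.finrank ℝ V + Module.finrank ℝ (LinearMap.ker B) ≤
      Module.finrank ℝ E + Module.finrank ℝ (LinearMap.ker B.flip) := by
  have h1 := LinearMap.finrank_range_add_finrank_ker B
  have h2 := LinearMap.finrank_range_add_finrank_ker B.flip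
  have h3 : Module.finrank ℝ (LinearMap.range B.flip) ≤ Module.finrank ℝ (LinearMap.range B) := by
    rw [← LinearMap.finrank_range_dualMap_eq_finrank_range B]
    have : B.flip = B.dualMap ∘ₗ Module.Dual.eval ℝ V := by ext v e; rfl
    rw [this]
    exact Submodule.finrank_mono (LinearMap.range_comp_le_range _ _)
  omega

theorem finrank_map_add_le {M M' : Type*} [AddCommGroup M] [Module ℝ M] [AddCommGroup M']
    [Module ℝ M'] {p q : Submodule ℝ M} [FiniteDimensional ℝ p] (f : M →ₗ[ℝ] M') (hq : q ≤ p)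
    (hqf : q ≤ LinearMap.ker f) :
    Module.finrank ℝ (p.map f) + Module.finrank ℝ q ≤ Module.finrank ℝ p := by
  rw [← LinearMap.finrank_range_add_finrank_ker (f.domRestrict p), LinearMap.range_domRestrict]
  refine Nat.add_le_add_left ?_ _
  rw [← (Submodule.comapSubtypeEquivOfLe hq).finrank_eq]
  refine Submodule.finrank_mono fun x hx => ?_
  exact hqf hx

theorem finrank_le_of_le_range {M E : Type*} [AddCommGroup M] [Module ℝ M] [AddCommGroup E]
    [Module ℝ E] [FiniteDimensional ℝ E] {p : Submodule ℝ M} (f : E →ₗ[ℝ] M)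
    (hp : p ≤ LinearMap.range f) : Module.finrank ℝ p ≤ Module.finrank ℝ E :=
  (Submodule.finrank_mono hp).trans (LinearMap.finrank_range_le f)

theorem finrank_symmetric {R : Type} [AddCommGroup R] [Module ℝ R] (S : Submodule ℝ R)
    [FiniteDimensional ℝ S] (W : Submodule ℝ (Matrix (Fin 3) (Fin 3) R)) (hW : ∀ A, A ∈ W ↔ Aᵀ = A ∧ ∀ i j, A i j ∈ S) :
    Module.finrank ℝ W = 6 * Module.finrank ℝ S ∧ FiniteDimensional ℝ W := by
  let I := {p : Fin 3 × Fin 3 // p.1 ≤ p.2}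
  let e : W ≃ₗ[ℝ] (I → S) :=
    { toFun := fun A p => ⟨A.1 p.1.1 p.1.2, ((hW _).1 A.2).2 _ _⟩
      invFun := fun f => ⟨Matrix.of fun i j =>
          (if h : i ≤ j then f ⟨(i, j), h⟩ else f ⟨(j, i), le_of_not_ge h⟩ : S), by
        rw [hW]
        refine ⟨?_, fun i j => Subtype.mem _⟩
        ext i j
        simp only [Matrix.transpose_apply, Matrix.of_apply]
        rcases lt_trichotomy i j with h | h | h
        · rw [dif_neg (not_le.2 h), dif_pos h.le]
        · subst h; rfl
        · rw [dif_pos h.le, dif_neg (not_le.2 h)]⟩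
      map_add' := fun A B => rfl
      map_smul' := fun c A => rfl
      left_inv := fun A => by
        ext i j
        simp only [Matrix.of_apply]
        split_ifs with h
        · rfl
        · exact congrFun (congrFun ((hW _).1 A.2).1 i) j
      right_inv := fun f => by
        ext p
        simp only [Matrix.of_apply]
        rw [dif_pos p.2] }
  constructor
  · rw [e.finrank_eq, Module.finrank_pi_fintype, Finset.sum_const]
    rfl
  · exact Module.Finite.equiv e.symm

theorem finrank_symPoly (k : ℕ) : Module.finrank ℝ (symPoly k) = 6 * (k + 3).choose 3 := by
  rw [(finrank_symmetric (scalarPoly k) (symPoly k) fun _ => Iff.rfl).1, finrank_scalarPoly]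

instance (k : ℕ) : FiniteDimensional ℝ (symPoly k) :=
  (finrank_symmetric (scalarPoly k) (symPoly k) fun _ => Iff.rfl).2

theorem finrank_symMat : Module.finrank ℝ (symMat ℝ) = 6 := by
  rw [(finrank_symmetric (⊤ : Submodule ℝ ℝ) (symMat ℝ) fun _ => by
    simp only [Submodule.mem_top, implies_true, and_true]; rfl).1]
  simp

/-- A polynomial vector field of bounded degree is a family of polynomials of bounded degree. -/
def vecPolyEquiv (l : ℕ) : vecPoly l ≃ₗ[ℝ] (Fin 3 → scalarPoly l) where
  toFun v i := ⟨v.1 i, v.2 i⟩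
  invFun f := ⟨fun i => f i, fun i => (f i).2⟩
  map_add' _ _ := rfl
  map_smul' _ _ := rfl
  left_inv _ := rfl
  right_inv _ := rfl

instance (l : ℕ) : FiniteDimensional ℝ (vecPoly l) := Module.Finite.equiv (vecPolyEquiv l).symm

theorem finrank_vecPoly (l : ℕ) : Module.finrank ℝ (vecPoly l) = 3 * (l + 3).choose 3 := by
  rw [(vecPolyEquiv l).finrank_eq, Module.finrank_pi_fintype, Finset.sum_const, finrank_scalarPoly]
  rfl

instance (l : ℕ) (G : Set Pt) : FiniteDimensional ℝ (polyOn l G) :=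
  inferInstanceAs (FiniteDimensional ℝ ((scalarPoly l).map (restrictTo G)))

instance (l : ℕ) : FiniteDimensional ℝ (hessians l) :=
  inferInstanceAs (FiniteDimensional ℝ ((scalarPoly l).map hess))

/-! ### Dimensions of the test spaces -/

/-- On the edge every polynomial of degree at most `l` is a combination of the powers `0, …, l` of
one barycentric coordinate. -/
theorem IsDual.finrank_polyOn_edge_le (h : IsDual a g) (l : ℕ) (e : Edge) :
    Module.finrank ℝ (polyOn l (edge a e)) ≤ l + 1 := by
  let b : Fin (l + 1) → (Pt → ℝ) := fun m => restrictTo (edge a e) (bary a g e.1.2 ^ (m : ℕ))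
  have hle : polyOn l (edge a e) ≤ Submodule.span ℝ (Set.range b) := by
    rintro _ ⟨p, hp, rfl⟩
    have hp' : restrictTo (edge a e) p = restrictTo (edge a e)
        (Polynomial.aeval (bary a g e.1.2) (along (a e.1.1) (edgeVec a e) p)) := by
      ext x
      by_cases hx : x ∈ edge a e
      · rw [restrictTo_apply_of_mem hx, restrictTo_apply_of_mem hx, eval_aeval, eval_along]
        rw [edge, segment_eq_image'] at hx
        obtain ⟨s, -, rfl⟩ := hx
        change eval (a e.1.1 + s • edgeVec a e) p = eval (a e.1.1 +
          eval (a e.1.1 + s • edgeVec a e) (bary a g e.1.2) • edgeVec a e) p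
        rw [eval_bary_add_smul, h.eval_bary_vertex, h.dot_edgeVec, if_neg e.2.ne', if_pos rfl]
        simp
      · simp [restrictTo, hx]
    rw [hp', Polynomial.aeval_eq_sum_range' (Nat.lt_succ_of_le (natDegree_along_le hp _ _)), map_sum]
    refine Submodule.sum_mem _ fun m hm => ?_
    rw [map_smul]
    exact Submodule.smul_mem _ _ (Submodule.subset_span ⟨⟨m, Finset.mem_range.1 hm⟩, rfl⟩)
  have : FiniteDimensional ℝ (Submodule.span ℝ (Set.range b)) :=
    FiniteDimensional.span_of_finite ℝ (Set.finite_range b)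
  refine (Submodule.finrank_mono hle).trans ?_
  exact (finrank_range_le_card (R := ℝ) b).trans (Fintype.card_fin _).le

/-- Restriction to the face kills all multiples of `λ_i`; Pascal's rule evaluates the difference of
the two dimensions. -/
theorem IsDual.finrank_polyOn_face_le (h : IsDual a g) (l : ℕ) (i : Fin 4) :
    Module.finrank ℝ (polyOn l (face a i)) ≤ (l + 2).choose 2 := by
  cases l with
  | zero =>
    have := Submodule.finrank_map_le (restrictTo (face a i)) (scalarPoly 0)
    rw [finrank_scalarPoly] at this
    exact this
  | succ l =>
    let μ : Poly →ₗ[ℝ] Poly := LinearMap.mulLeft ℝ (bary a g i)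
    have hμ : Function.Injective μ := fun p q hpq => mul_left_cancel₀ (h.bary_ne_zero i) hpq
    have := finrank_map_add_le (p := scalarPoly (l + 1)) (q := (scalarPoly l).map μ)
      (restrictTo (face a i)) (by
        rintro _ ⟨p, hp, rfl⟩
        rw [add_comm l 1]
        exact mul_mem_scalarPoly (bary_mem_scalarPoly i) hp) (by
        rintro _ ⟨p, hp, rfl⟩
        ext x
        by_cases hx : x ∈ face a i
        · rw [restrictTo_apply_of_mem hx]
          simp [μ, ((h.mem_face_iff i x).1 hx).2]
        · simp [restrictTo, hx])
    rw [← (Submodule.equivMapOfInjective μ hμ (scalarPoly l)).finrank_eq, finrank_scalarPoly,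
      finrank_scalarPoly] at this
    have hc : (l + 1 + 3).choose 3 = (l + 3).choose 2 + (l + 3).choose 3 := Nat.choose_succ_succ _ _
    change Module.finrank ℝ ((scalarPoly (l + 1)).map (restrictTo (face a i))) ≤ (l + 3).choose 2
    omega

theorem finrank_hessians_add_le {l : ℕ} (hl : 1 ≤ l) :
    Module.finrank ℝ (hessians l) + 4 ≤ (l + 3).choose 3 := by
  have := finrank_map_add_le (p := scalarPoly l) (q := scalarPoly 1) hess
    (fun p hp => scalarPoly_mono hl hp) (fun p hp => by
      rw [LinearMap.mem_ker]
      ext1 i j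
      obtain ⟨c, hc⟩ := exists_eq_C_of_mem_scalarPoly_zero (pderiv_mem_scalarPoly (l := 0) i hp)
      simp [hess, hc])
  rw [finrank_scalarPoly, finrank_scalarPoly] at this
  exact this

/-- The symmetric fields whose normal components vanish on the boundary. -/
def symBubbles (a g : Fin 4 → Pt) (k : ℕ) : Submodule ℝ (Matrix (Fin 3) (Fin 3) Poly) where
  carrier := {σ | σ ∈ symPoly k ∧ ∀ i j x, eval x (bary a g i) = 0 →
    eval x (biPoly (Pi.single j 1) (g i) σ) = 0}
  add_mem' hσ hτ := ⟨Submodule.add_mem _ hσ.1 hτ.1, fun i j x hx => by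
    rw [map_add, map_add, hσ.2 i j x hx, hτ.2 i j x hx, add_zero]⟩
  zero_mem' := ⟨Submodule.zero_mem _, fun i j x hx => by rw [map_zero, map_zero]⟩
  smul_mem' c σ hσ := ⟨Submodule.smul_mem _ c hσ.1, fun i j x hx => by
    rw [map_smul, smul_eval, hσ.2 i j x hx, mul_zero]⟩

theorem mem_symBubbles_iff {k : ℕ} {σ : Matrix (Fin 3) (Fin 3) Poly} :
    σ ∈ symBubbles a g k ↔ σ ∈ symPoly k ∧
      ∀ i x, eval x (bary a g i) = 0 → evalMat x σ *ᵥ g i = 0 := by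
  refine and_congr_right fun _ => forall_congr' fun i => ⟨fun H x hx => ?_, fun H j x hx => ?_⟩
  · ext j
    have := H j x hx
    rwa [eval_biPoly, single_one_dotProduct] at this
  · rw [eval_biPoly, H x hx, dotProduct_zero]

instance (k : ℕ) : FiniteDimensional ℝ (symBubbles a g k) :=
  Submodule.finiteDimensional_of_le (fun _ hσ => hσ.1 : symBubbles a g k ≤ symPoly k)

theorem IsDual.eval_eq_zero_of_bary_mul (h : IsDual a g) {i j : Fin 4} (hij : i ≠ j) {p : Poly}
    (hp : ∀ x, eval x (bary a g j) = 0 → eval x (bary a g i * p) = 0) {x : Pt}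
    (hx : eval x (bary a g j) = 0) : eval x p = 0 := by
  refine eval_eq_zero_of_mul_along (x := a i) (p := bary a g i) (fun s => hp _ ?_) ?_
  · rw [eval_bary_line, hx, h.eval_bary_vertex, if_neg hij.symm]; simp
  · rw [h.eval_bary_vertex, if_pos rfl]; exact one_ne_zero

theorem IsDual.exists_eq_bary_mul_bary_mul (h : IsDual a g) {i j : Fin 4} (hij : i ≠ j) {l : ℕ}
    {p : Poly} (hp : p ∈ scalarPoly (l + 2)) (hi : ∀ x, eval x (bary a g i) = 0 → eval x p = 0)
    (hj : ∀ x, eval x (bary a g j) = 0 → eval x p = 0) :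
    ∃ r ∈ scalarPoly l, p = bary a g i * bary a g j * r := by
  obtain ⟨q, hq, e⟩ := h.exists_eq_bary_mul i hp hi
  obtain ⟨r, hr, e'⟩ := h.exists_eq_bary_mul j hq fun x hx =>
    h.eval_eq_zero_of_bary_mul hij (fun y hy => by rw [← e]; exact hj y hy) hx
  exact ⟨r, hr, by rw [e, e', mul_assoc]⟩

theorem sum_sum_eq_two_smul_sum_edge {M : Type*} [AddCommGroup M] [Module ℝ M]
    (F : Fin 4 → Fin 4 → M) (h0 : ∀ i, F i i = 0) (hs : ∀ i j, F i j = F j i) :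
    ∑ i, ∑ j, F i j = (2 : ℝ) • ∑ e : Edge, F e.1.1 e.1.2 := by
  have h1 : ∑ e : Edge, F e.1.1 e.1.2 =
      ∑ p ∈ (Finset.univ : Finset (Fin 4 × Fin 4)).filter (fun p => p.1 < p.2), F p.1 p.2 :=
    (Finset.sum_subtype _ (by simp) (fun p : Fin 4 × Fin 4 => F p.1 p.2)).symm
  rw [h1, Finset.sum_filter, Fintype.sum_prod_type]
  simp only [Fin.sum_univ_four, h0, hs 1 0, hs 2 0, hs 3 0, hs 2 1, hs 3 1, hs 3 2]
  simp
  module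

/-- A symmetric matrix in terms of its products with the gradients of the barycentric coordinates. -/
theorem IsDual.eq_sum_edge (h : IsDual a g) {S : Matrix (Fin 3) (Fin 3) ℝ} (hS : Sᵀ = S) :
    S = -∑ e : Edge, (g e.1.1 ⬝ᵥ (S *ᵥ g e.1.2)) •
      Matrix.vecMulVec (edgeVec a e) (edgeVec a e) := by
  have hsum0 : ∑ i, g i = 0 := by
    apply dotProduct_eq
    intro u
    rw [sum_dotProduct, h.sum_dot, zero_dotProduct]
  have hrec : ∀ u : Pt, ∀ m, ∑ i, (g i ⬝ᵥ u) * a i m = u m := by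
    intro u m
    have := congrFun (h.sum_dot_smul u) m
    simpa using this
  -- On expanding `(a_j - a_i)(a_j - a_i)ᵀ`, the two squares drop out because the gradients sum to
  -- zero, and each of the two mixed terms reproduces `-S`.
  have key : ∑ i, ∑ j, (g i ⬝ᵥ (S *ᵥ g j)) • Matrix.vecMulVec (a j - a i) (a j - a i) =
      (-2 : ℝ) • S := by
    have hrow : ∀ i, ∑ j, g i ⬝ᵥ (S *ᵥ g j) = 0 := by
      intro i
      rw [← dotProduct_sum, ← Matrix.mulVec_sum, hsum0, Matrix.mulVec_zero, dotProduct_zero]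
    have hcol : ∀ j, ∑ i, g i ⬝ᵥ (S *ᵥ g j) = 0 := fun j => h.sum_dot _
    ext p q
    simp only [Matrix.sum_apply, Matrix.smul_apply, Matrix.vecMulVec_apply, Pi.sub_apply, smul_eq_mul]
    have hpq : ∀ p q, ∑ i, ∑ j, (g i ⬝ᵥ (S *ᵥ g j)) * (a j p * a i q) = S q p := by
      intro p q
      rw [Finset.sum_comm]
      have e1 : ∀ j, ∑ i, (g i ⬝ᵥ (S *ᵥ g j)) * (a j p * a i q) = (g j ⬝ᵥ S q) * a j p := by
        intro j
        rw [dotProduct_comm]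
        change _ = (S *ᵥ g j) q * a j p
        rw [← hrec (S *ᵥ g j) q, Finset.sum_mul]
        exact Finset.sum_congr rfl fun i _ => by ring
      simp only [e1]
      exact hrec (S q) p
    have hSs : S q p = S p q := congrFun (congrFun hS p) q
    have e2 : ∑ i, ∑ j, (g i ⬝ᵥ (S *ᵥ g j)) * (a i p * a i q) = 0 := by
      simp only [← Finset.sum_mul, hrow, zero_mul, Finset.sum_const_zero]
    have e3 : ∑ i, ∑ j, (g i ⬝ᵥ (S *ᵥ g j)) * (a j p * a j q) = 0 := by
      rw [Finset.sum_comm]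
      simp only [← Finset.sum_mul, hcol, zero_mul, Finset.sum_const_zero]
    have e4 := hpq p q
    have e5 := hpq q p
    have e6 : ∀ i j, (g i ⬝ᵥ (S *ᵥ g j)) * ((a j p - a i p) * (a j q - a i q)) =
        (g i ⬝ᵥ (S *ᵥ g j)) * (a i p * a i q) + (g i ⬝ᵥ (S *ᵥ g j)) * (a j p * a j q) -
          (g i ⬝ᵥ (S *ᵥ g j)) * (a j p * a i q) - (g i ⬝ᵥ (S *ᵥ g j)) * (a j q * a i p) := by
      intro i j; ring
    simp only [e6, Finset.sum_sub_distrib, Finset.sum_add_distrib, e2, e3, e4, e5, hSs]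
    ring
  rw [sum_sum_eq_two_smul_sum_edge (fun i j => (g i ⬝ᵥ (S *ᵥ g j)) •
    Matrix.vecMulVec (a j - a i) (a j - a i)) (by simp) (by
      intro i j
      rw [dot_mulVec_symm hS, ← neg_sub (a i) (a j), Matrix.neg_vecMulVec, Matrix.vecMulVec_neg,
        neg_neg])] at key
  have h2 : (2 : ℝ) • (∑ e : Edge, (g e.1.1 ⬝ᵥ (S *ᵥ g e.1.2)) •
      Matrix.vecMulVec (edgeVec a e) (edgeVec a e)) = (2 : ℝ) • (-S) := by
    rw [smul_neg, ← neg_smul]; exact key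
  have h3 := smul_right_injective _ (two_ne_zero (α := ℝ)) h2
  rw [h3, neg_neg]

/-- The edge bubble fields `∑ λᵢ λⱼ pᵢⱼ tᵢⱼ tᵢⱼᵀ`. -/
def edgeBubbles (a g : Fin 4 → Pt) (l : ℕ) :
    (Edge → scalarPoly l) →ₗ[ℝ] Matrix (Fin 3) (Fin 3) Poly where
  toFun p := Matrix.of fun i j => ∑ e : Edge,
    C (edgeVec a e i * edgeVec a e j) * (bary a g e.1.1 * bary a g e.1.2) * (p e : Poly)
  map_add' p q := by
    ext1 i j
    simp [mul_add, Finset.sum_add_distrib]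
  map_smul' c p := by
    ext1 i j
    simp [Finset.smul_sum]

/-- For `i ≠ j` the component `g_iᵀ σ g_j` vanishes on the faces `i` and `j`, by symmetry of `σ`, so
it is divisible by `λ_i λ_j`. These six components determine `σ`. -/
theorem IsDual.symBubbles_le (h : IsDual a g) (l : ℕ) :
    symBubbles a g (l + 2) ≤ LinearMap.range (edgeBubbles a g l) := by
  intro σ hσ
  rw [mem_symBubbles_iff] at hσ
  obtain ⟨hσ, hn⟩ := hσ
  have hp : ∀ e : Edge, ∃ r ∈ scalarPoly l,
      biPoly (g e.1.1) (g e.1.2) σ = bary a g e.1.1 * bary a g e.1.2 * r := by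
    intro e
    refine h.exists_eq_bary_mul_bary_mul e.2.ne (biPoly_mem hσ.2) (fun x hx => ?_) fun x hx => ?_
    · rw [eval_biPoly, dot_mulVec_symm (evalMat_transpose hσ.1 x), hn _ x hx, dotProduct_zero]
    · rw [eval_biPoly, hn _ x hx, dotProduct_zero]
  choose r hr e using hp
  refine ⟨fun e => ⟨-r e, Submodule.neg_mem _ (hr e)⟩, ?_⟩
  ext1 i j
  apply poly_ext
  intro x
  have := congrFun (congrFun (h.eq_sum_edge (evalMat_transpose hσ.1 x)) i) j
  change eval x (σ i j) = _ at this
  rw [this, edgeBubbles]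
  simp only [LinearMap.coe_mk, AddHom.coe_mk, Matrix.of_apply, map_sum, Matrix.neg_apply,
    Matrix.sum_apply, Matrix.smul_apply, Matrix.vecMulVec_apply, ← Finset.sum_neg_distrib]
  refine Finset.sum_congr rfl fun e' _ => ?_
  rw [← eval_biPoly, e e']
  simp
  ring

theorem IsDual.finrank_symBubbles_le (h : IsDual a g) (l : ℕ) :
    Module.finrank ℝ (symBubbles a g (l + 2)) ≤ 6 * (l + 3).choose 3 := by
  refine (finrank_le_of_le_range _ (h.symBubbles_le l)).trans ?_
  rw [Module.finrank_pi_fintype, Finset.sum_const, finrank_scalarPoly]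
  exact le_of_eq rfl

end

end DivDivElement

namespace DivDivElement

noncomputable section

open MvPolynomial

variable {a g n : Fin 4 → Pt}

/-! ### The range of the divergence on symmetric bubble fields -/

theorem divMat_add (σ τ : Matrix (Fin 3) (Fin 3) Poly) :
    divMat (σ + τ) = divMat σ + divMat τ := by
  ext1 i
  simp only [divMat, Matrix.add_apply, map_add, Finset.sum_add_distrib, Pi.add_apply]

theorem divMat_smul (c : ℝ) (σ : Matrix (Fin 3) (Fin 3) Poly) :
    divMat (c • σ) = c • divMat σ := by
  ext1 i
  simp only [divMat, Matrix.smul_apply, Derivation.map_smul, Finset.smul_sum, Pi.smul_apply]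

/-- The divergence as a linear map. -/
def divLinear : Matrix (Fin 3) (Fin 3) Poly →ₗ[ℝ] (Fin 3 → Poly) where
  toFun := divMat
  map_add' := divMat_add
  map_smul' := divMat_smul

/-- The pairing `(u, v)_K`. -/
def innerVecLinear (a : Fin 4 → Pt) : (Fin 3 → Poly) →ₗ[ℝ] (Fin 3 → Poly) →ₗ[ℝ] ℝ :=
  LinearMap.mk₂ ℝ (innerVecK a)
    (fun u v w => by simp only [innerVecK, add_dotProduct, map_add])
    (fun c u v => by simp only [innerVecK, smul_dotProduct, map_smul])
    (fun u v w => by simp only [innerVecK, dotProduct_add, map_add])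
    (fun c u v => by simp only [innerVecK, dotProduct_smul, map_smul])

theorem IsDual.bary_mul_bary_nonneg (h : IsDual a g) (i j : Fin 4) :
    ∀ x ∈ tet a, 0 ≤ eval x (bary a g i * bary a g j) := fun x hx => by
  rw [map_mul]
  exact mul_nonneg ((h.mem_tet_iff x).1 hx i) ((h.mem_tet_iff x).1 hx j)

/-- The faces `i` and `j` are handled by the factor `λ_i λ_j`; every other face contains the edge `a
i, a j`, so `a i - a j` is tangential to it. -/
theorem dot_eq_zero_of_bary_eq_zero (h : IsDual a g) {i j m : Fin 4} {x : Pt}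
    (hx : eval x (bary a g m) = 0) :
    eval x (bary a g i * bary a g j) * (g m ⬝ᵥ (a i - a j)) = 0 := by
  rw [h, map_mul]
  by_cases hi : m = i
  · subst hi; rw [hx]; ring
  · by_cases hj : m = j
    · subst hj; rw [hx]; ring
    · rw [if_neg hi, if_neg hj]; ring

/-- A vector field that is orthogonal to the divergences of the symmetric bubble fields has vanishing
symmetric gradient. -/
theorem IsDual.grad_add_transpose_eq_zero (h : IsDual a g) {l : ℕ} {v : Fin 3 → Poly}
    (hv : v ∈ vecPoly (l + 1))
    (hσ : ∀ σ ∈ symBubbles a g (l + 2), innerVecK a (divMat σ) v = 0) :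
    grad v + (grad v)ᵀ = 0 := by
  have hgrad : ∀ i j, grad v i j ∈ scalarPoly l := fun i j => pderiv_mem_scalarPoly j (hv i)
  have htt : ∀ i j, i ≠ j → biPoly (a i - a j) (a i - a j) (grad v) = 0 := by
    intro i j hij
    set p := biPoly (a i - a j) (a i - a j) (grad v) with hp
    -- Testing with `λ_i λ_j p t tᵀ`, where `t = a i - a j` and `p = tᵀ (∇v) t`, gives `∫ λ_i λ_j p²
    -- = 0`, up to sign.
    let σ : Matrix (Fin 3) (Fin 3) Poly := Matrix.of fun s t =>
      C ((a i - a j) s * (a i - a j) t) * (bary a g i * bary a g j * p)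
    have hmem : σ ∈ symBubbles a g (l + 2) := by
      rw [mem_symBubbles_iff]
      refine ⟨⟨?_, fun s t => C_mul_mem_scalarPoly _ ?_⟩, fun m x hx => ?_⟩
      · change σᵀ = σ
        ext1 s t
        simp [σ, mul_comm]
      · rw [add_comm l 2]
        exact mul_mem_scalarPoly (mul_mem_scalarPoly (bary_mem_scalarPoly i) (bary_mem_scalarPoly j))
          (biPoly_mem hgrad)
      · ext s
        have h0 := dot_eq_zero_of_bary_eq_zero h (i := i) (j := j) hx
        have : (evalMat x σ *ᵥ g m) s = (a i - a j) s * eval x p *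
            (eval x (bary a g i * bary a g j) * (g m ⬝ᵥ (a i - a j))) := by
          simp [σ, evalMat, Matrix.mulVec, dotProduct, Fin.sum_univ_three]
          ring
        rw [this, h0, mul_zero]; rfl
    have h1 := hσ σ hmem
    rw [← neg_eq_zero, ← h.innerMatK_grad (mem_symBubbles_iff.1 hmem).2, innerMatK] at h1
    refine h.eq_zero_of_integralK_mul (h.bary_mul_bary_nonneg i j)
      (mul_ne_zero (h.bary_ne_zero i) (h.bary_ne_zero j)) ?_
    rw [← h1]
    congr 1
    nth_rewrite 2 [hp]
    simp only [biPoly, LinearMap.coe_mk, AddHom.coe_mk, Finset.mul_sum, σ, Matrix.of_apply]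
    exact Finset.sum_congr rfl fun s _ => Finset.sum_congr rfl fun t _ => by ring
  ext1 s t
  apply poly_ext
  intro x
  let S : Matrix (Fin 3) (Fin 3) ℝ := evalMat x (grad v) + (evalMat x (grad v))ᵀ
  have hS : Sᵀ = S := by
    simp only [S, Matrix.transpose_add, Matrix.transpose_transpose, add_comm]
  have hdiag : ∀ i j, (a i - a j) ⬝ᵥ (S *ᵥ (a i - a j)) = 0 := by
    intro i j
    by_cases hij : i = j
    · subst hij; simp
    · have := congrArg (eval x) (htt i j hij)
      rw [eval_biPoly, map_zero] at this
      rw [Matrix.add_mulVec, dotProduct_add, Matrix.mulVec_transpose,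
        dotProduct_comm _ ((a i - a j) ᵥ* _), ← Matrix.dotProduct_mulVec, this, add_zero]
  -- Polarization: `a i - a j` is the difference of the edge vectors from `a 0`, and the quadratic
  -- form vanishes on all edges.
  have hoff : ∀ i j, (a i - a 0) ⬝ᵥ (S *ᵥ (a j - a 0)) = 0 := by
    intro i j
    have h1 := hdiag i j
    rw [← sub_sub_sub_cancel_right (a i) (a j) (a 0), Matrix.mulVec_sub, dotProduct_sub,
      sub_dotProduct _ _ (S *ᵥ (a i - a 0)), sub_dotProduct _ _ (S *ᵥ (a j - a 0)), hdiag, hdiag,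
      dot_mulVec_symm hS (a j - a 0)] at h1
    linarith
  have hz : S = 0 := by
    have hcol : ∀ j, S *ᵥ (a j - a 0) = 0 := by
      intro j
      apply dotProduct_eq
      intro u
      rw [← h.sum_dot_smul_sub u, zero_dotProduct, dotProduct_sum]
      refine Finset.sum_eq_zero fun i _ => ?_
      rw [dotProduct_smul, dotProduct_comm (S *ᵥ _), hoff, smul_zero]
    apply Matrix.ext_of_mulVec_single
    intro m
    rw [← h.sum_dot_smul_sub (Pi.single m 1), Matrix.mulVec_sum]
    simp only [Matrix.mulVec_smul, hcol, smul_zero, Finset.sum_const_zero, Matrix.zero_mulVec]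
  have := congrFun (congrFun hz s) t
  simpa [S, evalMat] using this

/-- The space of polynomial fields with vanishing symmetric gradient has dimension at most six. -/
theorem finrank_le_of_grad_add_transpose_eq_zero (V : Submodule ℝ (Fin 3 → Poly))
    (hV : ∀ v ∈ V, grad v + (grad v)ᵀ = 0) : Module.finrank ℝ V ≤ 6 := by
  let f : V →ₗ[ℝ] (Fin 6 → ℝ) :=
    { toFun := fun v => ![eval 0 (v.1 0), eval 0 (v.1 1), eval 0 (v.1 2),
        eval 0 (pderiv 1 (v.1 0)), eval 0 (pderiv 2 (v.1 0)), eval 0 (pderiv 2 (v.1 1))]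
      map_add' := fun v w => by ext i; fin_cases i <;> simp
      map_smul' := fun c v => by ext i; fin_cases i <;> simp }
  have hf : Function.Injective f := by
    rw [injective_iff_map_eq_zero]
    rintro ⟨v, hv⟩ hfv
    have hsk : ∀ i j, pderiv j (v i) = -pderiv i (v j) := by
      intro i j
      have := congrFun (congrFun (hV v hv) i) j
      simp only [grad, Matrix.add_apply, Matrix.transpose_apply, Matrix.of_apply,
        Matrix.zero_apply] at this
      exact eq_neg_of_add_eq_zero_left this
    -- Alternating skew-symmetry of the gradient with commutation of derivatives changes the sign
    -- three times and returns to the same second derivative.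
    have h2 : ∀ i j k, pderiv k (pderiv j (v i)) = 0 := by
      intro i j k
      have e1 : pderiv k (pderiv j (v i)) = -pderiv k (pderiv i (v j)) := by rw [hsk i j, map_neg]
      have e2 : pderiv k (pderiv i (v j)) = -pderiv i (pderiv j (v k)) := by
        rw [pderiv_comm, hsk j k, map_neg]
      have e3 : pderiv i (pderiv j (v k)) = -pderiv k (pderiv j (v i)) := by
        rw [pderiv_comm, hsk k i, map_neg, pderiv_comm]
      have : (2 : ℝ) • pderiv k (pderiv j (v i)) = 0 := by
        rw [two_smul]
        nth_rewrite 1 [e1]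
        rw [e2, e3]
        simp
      simpa using this
    have z0 : eval 0 (v 0) = 0 := congrFun hfv 0
    have z1 : eval 0 (v 1) = 0 := congrFun hfv 1
    have z2 : eval 0 (v 2) = 0 := congrFun hfv 2
    have z3 : eval 0 (pderiv 1 (v 0)) = 0 := congrFun hfv 3
    have z4 : eval 0 (pderiv 2 (v 0)) = 0 := congrFun hfv 4
    have z5 : eval 0 (pderiv 2 (v 1)) = 0 := congrFun hfv 5
    have hC : ∀ i j, pderiv j (v i) = C (eval 0 (pderiv j (v i))) := fun i j =>
      eq_C_of_pderiv_eq_zero (h2 i j)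
    have h01 : pderiv 1 (v 0) = 0 := by rw [hC, z3, C_0]
    have h02 : pderiv 2 (v 0) = 0 := by rw [hC, z4, C_0]
    have h12 : pderiv 2 (v 1) = 0 := by rw [hC, z5, C_0]
    have hd : ∀ i, pderiv i (v i) = 0 := fun i => self_eq_neg.1 (hsk i i)
    have h10 : pderiv 0 (v 1) = 0 := by rw [hsk, h01, neg_zero]
    have h20 : pderiv 0 (v 2) = 0 := by rw [hsk, h02, neg_zero]
    have h21 : pderiv 1 (v 2) = 0 := by rw [hsk, h12, neg_zero]
    have v0 : v 0 = 0 := by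
      rw [eq_C_of_pderiv_eq_zero (Fin.forall_fin_succ.2 ⟨hd 0, Fin.forall_fin_two.2 ⟨h01, h02⟩⟩), z0,
        C_0]
    have v1 : v 1 = 0 := by
      rw [eq_C_of_pderiv_eq_zero (Fin.forall_fin_succ.2 ⟨h10, Fin.forall_fin_two.2 ⟨hd 1, h12⟩⟩), z1,
        C_0]
    have v2 : v 2 = 0 := by
      rw [eq_C_of_pderiv_eq_zero (Fin.forall_fin_succ.2 ⟨h20, Fin.forall_fin_two.2 ⟨h21, hd 2⟩⟩), z2,
        C_0]
    apply Subtype.ext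
    exact funext (Fin.forall_fin_succ.2 ⟨v0, Fin.forall_fin_two.2 ⟨v1, v2⟩⟩)
  simpa using LinearMap.finrank_le_finrank_of_injective hf

/-- In the pairing `(div σ, v)_K` of symmetric bubbles with vector polynomials, `curl curl* M` lies
in the left kernel, and the right kernel consists of fields with zero symmetric gradient, hence has
dimension at most six. -/
theorem IsDual.finrank_map_spaceM_add_le (h : IsDual a g) (hgn : UnitNormals g n) (l : ℕ) :
    Module.finrank ℝ ((spaceM a n (l + 4)).map curlCurlStar) + 3 * (l + 4).choose 3 ≤
      6 * (l + 3).choose 3 + 6 := by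
  let B : symBubbles a g (l + 2) →ₗ[ℝ] vecPoly (l + 1) →ₗ[ℝ] ℝ :=
    (innerVecLinear a).compl₁₂ (divLinear ∘ₗ Submodule.subtype _) (Submodule.subtype _)
  have hB : ∀ σ v, B σ v = innerVecK a (divMat σ.1) v.1 := fun _ _ => rfl
  have h1 := finrank_add_finrank_ker_le B
  rw [finrank_vecPoly] at h1
  have h2 : Module.finrank ℝ (LinearMap.ker B.flip) ≤ 6 := by
    rw [(Submodule.equivMapOfInjective (vecPoly (l + 1)).subtype
      (Submodule.subtype_injective _) (LinearMap.ker B.flip)).finrank_eq]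
    apply finrank_le_of_grad_add_transpose_eq_zero
    rintro _ ⟨v, hv, rfl⟩
    refine h.grad_add_transpose_eq_zero v.2 fun σ hσ => ?_
    have := LinearMap.congr_fun hv ⟨σ, hσ⟩
    exact this
  have h3 : Module.finrank ℝ ((spaceM a n (l + 4)).map curlCurlStar) ≤
      Module.finrank ℝ (LinearMap.ker B) := by
    have hmem : ∀ σ ∈ (spaceM a n (l + 4)).map curlCurlStar,
        σ ∈ symBubbles a g (l + 2) ∧ divMat σ = 0 := by
      rintro _ ⟨τ, hτ, rfl⟩
      refine ⟨mem_symBubbles_iff.2 ⟨curlCurlStar_mem_symPoly hτ.1.1, fun i x hx => ?_⟩,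
        divMat_curlCurlStar τ⟩
      ext j
      have hp : ∀ x, eval x (biPoly (Pi.single j 1) (g i) (curlCurlStar τ)) =
          (evalMat x (curlCurlStar τ) *ᵥ g i) j := by
        intro x; rw [eval_biPoly, single_one_dotProduct]
      rw [← hp]
      refine h.eval_eq_zero_of_face (fun y hy => ?_) hx
      rw [hp, (hgn.mulVec_iff i _).1 (hτ.2 i y hy)]
      rfl
    rw [(Submodule.equivMapOfInjective (symBubbles a g (l + 2)).subtype
      (Submodule.subtype_injective _) (LinearMap.ker B)).finrank_eq]
    refine Submodule.finrank_mono fun σ hσ => ?_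
    obtain ⟨hσ1, hσ2⟩ := hmem σ hσ
    refine ⟨⟨σ, hσ1⟩, ?_, rfl⟩
    change B _ = 0
    ext v
    rw [hB, hσ2]
    simp [innerVecK]
  have h4 := h.finrank_symBubbles_le l
  have h5 : l + 1 + 3 = l + 4 := rfl
  rw [h5] at h1
  omega

/-! ### The dimension of the space of curls -/

/-- The vector fields whose normal components vanish on the boundary. -/
def vecBubbles (a g : Fin 4 → Pt) (l : ℕ) : Submodule ℝ (Fin 3 → Poly) where
  carrier := {v | v ∈ vecPoly l ∧ ∀ i x, eval x (bary a g i) = 0 → g i ⬝ᵥ evalVec x v = 0}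
  add_mem' hv hw := ⟨Submodule.add_mem _ hv.1 hw.1, fun i x hx => by
    rw [evalVec_add, dotProduct_add, hv.2 i x hx, hw.2 i x hx, add_zero]⟩
  zero_mem' := ⟨Submodule.zero_mem _, fun i x hx => by simp [evalVec, dotProduct]⟩
  smul_mem' c v hv := ⟨Submodule.smul_mem _ c hv.1, fun i x hx => by
    have : evalVec x (c • v) = c • evalVec x v := by ext j; simp [evalVec]
    rw [this, dotProduct_smul, hv.2 i x hx, smul_zero]⟩

instance (l : ℕ) : FiniteDimensional ℝ (vecBubbles a g l) :=
  Submodule.finiteDimensional_of_le (fun _ hv => hv.1 : vecBubbles a g l ≤ vecPoly l)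

/-- The map `p ↦ ∑ λᵢ pᵢ`. -/
def barySum (a g : Fin 4 → Pt) (l : ℕ) : (Fin 4 → scalarPoly l) →ₗ[ℝ] scalarPoly (l + 1) where
  toFun p := ⟨∑ i, bary a g i * (p i : Poly), Submodule.sum_mem _ fun i _ => by
    rw [add_comm l 1]
    exact mul_mem_scalarPoly (bary_mem_scalarPoly i) (p i).2⟩
  map_add' p q := by
    apply Subtype.ext
    simp [mul_add, Finset.sum_add_distrib]
  map_smul' c p := by
    apply Subtype.ext
    simp [Finset.smul_sum]

/-- A preimage comes from substituting `1 = ∑ λ_i` and `x_m = ∑ λ_i (a_i)_m` into a polynomial with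
one variable split off each nonconstant term. -/
theorem IsDual.barySum_surjective (h : IsDual a g) (l : ℕ) :
    Function.Surjective (barySum a g l) := by
  rintro ⟨q, hq⟩
  obtain ⟨c, r, hr, rfl⟩ := exists_eq_C_add_sum_X_mul hq
  refine ⟨fun i => ⟨C c + ∑ m, C (a i m) * r m, Submodule.add_mem _ (C_mem_scalarPoly _ _)
    (Submodule.sum_mem _ fun m _ => C_mul_mem_scalarPoly _ (hr m))⟩, ?_⟩
  apply Subtype.ext
  change ∑ i, bary a g i * (C c + ∑ m, C (a i m) * r m) = _
  have hX : ∀ m, (X m : Poly) = ∑ i, bary a g i * C (a i m) := by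
    intro m
    apply poly_ext
    intro x
    have := congrFun (h.sum_eval_bary_smul x) m
    rw [eval_X, ← this, map_sum]
    simp
  simp only [mul_add, Finset.sum_add_distrib, ← Finset.sum_mul, h.sum_bary, one_mul, Finset.mul_sum]
  congr 1
  rw [Finset.sum_comm]
  refine Finset.sum_congr rfl fun m _ => ?_
  rw [hX m, Finset.sum_mul]
  exact Finset.sum_congr rfl fun i _ => (mul_assoc _ _ _).symm

/-- A bubble `v` is recovered from the quotients `p_i` in `g_i · v = λ_i p_i`. Since the gradients
sum to zero these satisfy `∑ λ_i p_i = 0`, so they range in the kernel of the surjective `barySum`.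
-/
theorem IsDual.finrank_vecBubbles_add_le (h : IsDual a g) (l : ℕ) :
    Module.finrank ℝ (vecBubbles a g (l + 1)) + (l + 4).choose 3 ≤ 4 * (l + 3).choose 3 := by
  have h1 := LinearMap.finrank_range_add_finrank_ker (barySum a g l)
  rw [LinearMap.range_eq_top.2 (h.barySum_surjective l), finrank_top, finrank_scalarPoly,
    Module.finrank_pi_fintype, Finset.sum_const, finrank_scalarPoly] at h1
  let f : (Fin 4 → scalarPoly l) →ₗ[ℝ] (Fin 3 → Poly) :=
    { toFun := fun p m => ∑ i, C (a i m) * (bary a g i * (p i : Poly))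
      map_add' := fun p q => by ext1 m; simp [mul_add, Finset.sum_add_distrib]
      map_smul' := fun c p => by ext1 m; simp [Finset.smul_sum] }
  have h2 : Module.finrank ℝ (vecBubbles a g (l + 1)) ≤
      Module.finrank ℝ (LinearMap.ker (barySum a g l)) := by
    refine finrank_le_of_le_range (E := LinearMap.ker (barySum a g l))
      (f ∘ₗ (LinearMap.ker (barySum a g l)).subtype) fun v hv => ?_
    choose p hp e using fun i => h.exists_eq_bary_mul i (l := l) (p := dotPoly (g i) v)
      (dotPoly_mem hv.1) (fun x hx => by rw [eval_dotPoly, dotProduct_comm, hv.2 i x hx])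
    refine ⟨⟨fun i => ⟨p i, hp i⟩, ?_⟩, ?_⟩
    · rw [LinearMap.mem_ker]
      apply Subtype.ext
      change ∑ i, bary a g i * p i = 0
      simp only [← e]
      apply poly_ext
      intro x
      simp only [map_sum, eval_dotPoly, map_zero, dotProduct_comm _ (g _), h.sum_dot]
    · ext1 m
      change ∑ i, C (a i m) * (bary a g i * p i) = v m
      simp only [← e]
      apply poly_ext
      intro x
      have := congrFun (h.sum_dot_smul (evalVec x v)) m
      change _ = eval x (v m) at this
      rw [← this, map_sum]
      simp [eval_dotPoly, dotProduct_comm _ (g _), mul_comm]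
  simp only [Finset.card_univ, Fintype.card_fin, smul_eq_mul] at h1
  change (l + 4).choose 3 + _ = _ at h1
  omega

/-- The divergence-free vector fields whose normal components vanish on the boundary. -/
def solenoidalBubbles (a g : Fin 4 → Pt) (l : ℕ) : Submodule ℝ (Fin 3 → Poly) where
  carrier := {v | v ∈ vecBubbles a g l ∧ ∑ i, pderiv i (v i) = 0}
  add_mem' hv hw := ⟨Submodule.add_mem _ hv.1 hw.1, by
    simp only [Pi.add_apply, map_add, Finset.sum_add_distrib, hv.2, hw.2, add_zero]⟩
  zero_mem' := ⟨Submodule.zero_mem _, by simp⟩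
  smul_mem' c v hv := ⟨Submodule.smul_mem _ c hv.1, by
    simp only [Pi.smul_apply, Derivation.map_smul, ← Finset.smul_sum, hv.2, smul_zero]⟩

instance (l : ℕ) : FiniteDimensional ℝ (solenoidalBubbles a g l) :=
  Submodule.finiteDimensional_of_le (fun _ hv => hv.1 : solenoidalBubbles a g l ≤ vecBubbles a g l)

theorem IsDual.pderiv_eq_zero_of_dirD (h : IsDual a g) {q : Poly}
    (hq : ∀ i j, i ≠ j → dirD (a i - a j) q = 0) (m : Fin 3) : pderiv m q = 0 := by
  apply poly_ext
  intro x
  have h1 : eval x (pderiv m q) = (Pi.single m 1 : Pt) ⬝ᵥ evalVec x (gradS q) := by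
    rw [single_one_dotProduct]; rfl
  rw [h1, ← h.sum_dot_smul_sub (Pi.single m 1), sum_dotProduct, map_zero]
  refine Finset.sum_eq_zero fun j _ => ?_
  rw [smul_dotProduct, ← dirD_eq_dot, hq _ _ (Fin.succ_ne_zero j), map_zero, smul_zero]

/-- In the pairing `(div v, q)_K`, a polynomial in the right kernel has zero derivative along every
edge, as the test field `λ_i λ_j (∂_t q) t` shows; hence it is constant. -/
theorem IsDual.finrank_solenoidalBubbles_add_le (h : IsDual a g) (l : ℕ) :
    Module.finrank ℝ (solenoidalBubbles a g (l + 1)) + (l + 4).choose 3 ≤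
      3 * (l + 3).choose 3 + 1 := by
  let D : (Fin 3 → Poly) →ₗ[ℝ] Poly →ₗ[ℝ] ℝ :=
    LinearMap.mk₂ ℝ (fun v q => integralK a ((∑ i, pderiv i (v i)) * q))
      (fun v w q => by
        rw [← map_add, ← add_mul]
        simp only [Pi.add_apply, map_add, Finset.sum_add_distrib])
      (fun c v q => by
        rw [← map_smul, ← smul_mul_assoc]
        simp only [Pi.smul_apply, Derivation.map_smul, Finset.smul_sum])
      (fun v p q => by rw [mul_add, map_add])
      (fun c v q => by rw [mul_smul_comm, map_smul])
  let B : vecBubbles a g (l + 1) →ₗ[ℝ] scalarPoly l →ₗ[ℝ] ℝ :=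
    D.compl₁₂ (Submodule.subtype _) (Submodule.subtype _)
  have hB : ∀ v q, B v q = integralK a ((∑ i, pderiv i (v.1 i)) * q.1) := fun _ _ => rfl
  have h1 := finrank_add_finrank_ker_le B
  rw [finrank_scalarPoly] at h1
  have h2 : Module.finrank ℝ (LinearMap.ker B.flip) ≤ 1 := by
    let E : LinearMap.ker B.flip →ₗ[ℝ] ℝ :=
      { toFun := fun q => eval 0 (q.1.1)
        map_add' := fun p q => by simp
        map_smul' := fun c q => by simp }
    have hE : Function.Injective E := by
      rw [injective_iff_map_eq_zero]
      rintro ⟨⟨q, hql⟩, hq⟩ hE0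
      have hd : ∀ m, pderiv m q = 0 := by
        refine h.pderiv_eq_zero_of_dirD fun i j hij => ?_
        cases l with
        | zero =>
          obtain ⟨c, rfl⟩ := exists_eq_C_of_mem_scalarPoly_zero hql
          simp
        | succ l =>
          set p := dirD (a i - a j) q with hp
          let v : Fin 3 → Poly := fun m => C ((a i - a j) m) * (bary a g i * bary a g j * p)
          have hv : v ∈ vecBubbles a g (l + 1 + 1) := by
            refine ⟨fun m => C_mul_mem_scalarPoly _ ?_, fun m x hx => ?_⟩
            · rw [show l + 1 + 1 = 2 + l by ring]
              exact mul_mem_scalarPoly (mul_mem_scalarPoly (bary_mem_scalarPoly i)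
                (bary_mem_scalarPoly j)) (dirD_mem_scalarPoly _ hql)
            · have h0 := dot_eq_zero_of_bary_eq_zero h (i := i) (j := j) hx
              have : g m ⬝ᵥ evalVec x v = eval x p *
                  (eval x (bary a g i * bary a g j) * (g m ⬝ᵥ (a i - a j))) := by
                simp [v, evalVec, dotProduct, Fin.sum_univ_three]
                ring
              rw [this, h0, mul_zero]
          have h3 : integralK a ((∑ i, pderiv i (v i)) * q) = 0 :=
            LinearMap.congr_fun hq ⟨v, hv⟩
          rw [← neg_eq_zero, ← h.integralK_dot_gradS hv.2, innerVecK] at h3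
          refine h.eq_zero_of_integralK_mul (h.bary_mul_bary_nonneg i j)
            (mul_ne_zero (h.bary_ne_zero i) (h.bary_ne_zero j)) ?_
          rw [← h3]
          congr 1
          nth_rewrite 2 [hp]
          rw [dirD_apply, Finset.mul_sum]
          exact Finset.sum_congr rfl fun m _ => by simp only [v, gradS]; ring
      apply Subtype.ext
      apply Subtype.ext
      change q = 0
      rw [eq_C_of_pderiv_eq_zero hd]
      have h0 : eval 0 q = 0 := hE0
      rw [h0, C_0]
    simpa using LinearMap.finrank_le_finrank_of_injective hE
  have h3 : Module.finrank ℝ (solenoidalBubbles a g (l + 1)) ≤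
      Module.finrank ℝ (LinearMap.ker B) := by
    rw [(Submodule.equivMapOfInjective (vecBubbles a g (l + 1)).subtype
      (Submodule.subtype_injective _) (LinearMap.ker B)).finrank_eq]
    refine Submodule.finrank_mono fun v hv => ⟨⟨v, hv.1⟩, ?_, rfl⟩
    change B _ = 0
    ext q
    rw [hB, hv.2, zero_mul, map_zero]
    rfl
  have h4 := h.finrank_vecBubbles_add_le l
  omega

/-- The normal component of the curl is `div (φ × g_i)`. Here `φ × g_i = λ_i r`, and `r` is
orthogonal to `g_i = ∇λ_i`, so the divergence is again a multiple of `λ_i`. -/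
theorem IsDual.dot_curl_eq_zero (h : IsDual a g) {φ : Fin 3 → Poly} {l : ℕ} (hφ : φ ∈ vecPoly l)
    {i : Fin 4} (hc : ∀ x, eval x (bary a g i) = 0 → evalVec x φ ⨯₃ g i = 0) {x : Pt}
    (hx : eval x (bary a g i) = 0) : g i ⬝ᵥ evalVec x (curl φ) = 0 := by
  let G : Fin 3 → Poly := fun m => C (g i m)
  have hG : ∀ x, evalVec x G = g i := by intro x; ext m; simp [G, evalVec]
  have hmem : ∀ m, (φ ⨯₃ G) m ∈ scalarPoly (l + 1) := by
    intro m
    rw [cross_apply]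
    fin_cases m <;> exact Submodule.sub_mem _
      (mul_mem_scalarPoly (hφ _) (C_mem_scalarPoly _ _)) (mul_mem_scalarPoly (hφ _) (C_mem_scalarPoly _ _))
  choose r hr e using fun m => h.exists_eq_bary_mul i (hmem m) (fun x hx => by
    have := congrFun (hc x hx) m
    rw [← hG x, ← evalVec_cross] at this
    exact this)
  have hGr : ∑ m, G m * r m = 0 := by
    have h1 : bary a g i * ∑ m, G m * r m = 0 := by
      rw [Finset.mul_sum]
      have : ∀ m, bary a g i * (G m * r m) = G m * (φ ⨯₃ G) m := by
        intro m; rw [e m]; ring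
      simp only [this]
      exact dot_cross_self φ G
    exact (mul_eq_zero.1 h1).resolve_left (h.bary_ne_zero i)
  have h2 : ∑ m, G m * curl φ m = ∑ m, pderiv m ((φ ⨯₃ G) m) := by
    simp [cross_apply, curl, G, Fin.sum_univ_three]
    ring
  have h3 : ∑ m, pderiv m ((φ ⨯₃ G) m) = bary a g i * ∑ m, pderiv m (r m) := by
    simp only [e, pderiv_mul, pderiv_bary, Finset.sum_add_distrib, ← Finset.mul_sum]
    change ∑ m, G m * r m + _ = _
    rw [hGr, zero_add]
  have h4 : g i ⬝ᵥ evalVec x (curl φ) = eval x (∑ m, G m * curl φ m) := by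
    simp [G, dotProduct, evalVec]
  rw [h4, h2, h3, map_mul, hx, zero_mul]

theorem IsDual.curl_mem_solenoidalBubbles (h : IsDual a g) {φ : Fin 3 → Poly} {l : ℕ}
    (hφ : φ ∈ vecPoly (l + 1))
    (hc : ∀ i x, eval x (bary a g i) = 0 → evalVec x φ ⨯₃ g i = 0) :
    curl φ ∈ solenoidalBubbles a g l :=
  ⟨⟨curl_mem_vecPoly hφ, fun i _ hx => h.dot_curl_eq_zero hφ (hc i) hx⟩, sum_pderiv_curl φ⟩

theorem IsDual.innerVecK_curl (h : IsDual a g) {φ : Fin 3 → Poly}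
    (hc : ∀ i x, eval x (bary a g i) = 0 → evalVec x φ ⨯₃ g i = 0) (r : Fin 3 → Poly) :
    innerVecK a (curl φ) r = innerVecK a φ (curl r) := by
  have := h.integralK_div (w := φ ⨯₃ r) (fun i x hx => by
    rw [evalVec_cross, triple_product_permutation, triple_product_permutation, ← cross_anticomm,
      hc i x hx, neg_zero, dotProduct_zero])
  rw [innerVecK, innerVecK, ← sub_eq_zero, ← map_sub, ← this]
  congr 1
  simp [cross_apply, curl, dotProduct, Fin.sum_univ_three]
  ring

/-- Orthogonality to the three rotations imposes three independent conditions on solenoidal bubbles.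
Translations would add nothing: they are gradients, to which these bubbles are already orthogonal.
-/
theorem IsDual.finrank_curlSpace_add_le (h : IsDual a g) (hgn : UnitNormals g n) (l : ℕ) :
    Module.finrank ℝ (curlSpace a n (l + 3)) + 3 ≤
      Module.finrank ℝ (solenoidalBubbles a g (l + 2)) := by
  let R : (Fin 3 → ℝ) →ₗ[ℝ] (Fin 3 → Poly) :=
    { toFun := fun c => rigidMotion ![0, 0, 0, c 0, c 1, c 2]
      map_add' := fun c d => by
        ext1 i
        fin_cases i <;> simp [rigidMotion, add_smul] <;> ring
      map_smul' := fun s c => by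
        ext1 i
        fin_cases i <;> simp [rigidMotion, mul_smul, smul_sub] }
  let B : solenoidalBubbles a g (l + 2) →ₗ[ℝ] (Fin 3 → ℝ) →ₗ[ℝ] ℝ :=
    (innerVecLinear a).compl₁₂ (Submodule.subtype _) R
  have hB : ∀ v c, B v c = innerVecK a v.1 (R c) := fun _ _ => rfl
  have h1 := finrank_add_finrank_ker_le B
  have h2 : LinearMap.ker B.flip = ⊥ := by
    rw [LinearMap.ker_eq_bot']
    intro c hc
    -- Half the curl of the rotation with parameters `c`.
    let u : Pt := ![c 2, -c 1, c 0]
    have hu : ∀ i, g i ⬝ᵥ u = 0 := by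
      intro i
      -- This field is normal on face `i` and zero on the others. Pairing its curl with the rotation
      -- gives `2 (g_i · u) ∫ b_i`, where the face bubble `b_i` has positive integral.
      let φ : Fin 3 → Poly := fun m => C (g i m) * faceBubble a g i
      have hφm : φ ∈ vecPoly (l + 2 + 1) := fun m => C_mul_mem_scalarPoly _
        (scalarPoly_mono (by omega) (faceBubble_mem_scalarPoly i))
      have hφc : ∀ j x, eval x (bary a g j) = 0 → evalVec x φ ⨯₃ g j = 0 := by
        intro j x hx
        have e : evalVec x φ = eval x (faceBubble a g i) • g i := by
          ext m; simp [φ, evalVec, mul_comm]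
        rw [e, LinearMap.map_smul₂]
        by_cases hij : j = i
        · subst hij; rw [cross_self, smul_zero]
        · rw [eval_faceBubble_eq_zero hij hx, zero_smul]
      have h3 : innerVecK a (curl φ) (R c) = 0 :=
        LinearMap.congr_fun hc ⟨curl φ, h.curl_mem_solenoidalBubbles hφm hφc⟩
      rw [h.innerVecK_curl hφc] at h3
      have e : φ ⬝ᵥ curl (R c) = (2 * (g i ⬝ᵥ u)) • faceBubble a g i := by
        have hC2 : (C 2 : Poly) = 2 := map_ofNat C 2
        simp [φ, R, u, rigidMotion, curl, dotProduct, Fin.sum_univ_three, pderiv_X, smul_eq_C_mul,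
          hC2]
        ring
      rw [innerVecK, e, map_smul, smul_eq_mul, mul_eq_zero] at h3
      rcases h3 with h3 | h3
      · linarith
      · exfalso
        have hb := h.eq_zero_of_integralK_eq_zero (fun x hx => by
          rw [faceBubble, map_prod]
          exact Finset.prod_nonneg fun j _ => (h.mem_tet_iff x).1 hx j) h3
        exact Finset.prod_ne_zero_iff.2 (fun j _ => h.bary_ne_zero j) hb
    have hu0 : u = 0 := by
      rw [← h.sum_dot_smul u]
      simp [hu]
    have u0 := congrFun hu0 0
    have u1 := congrFun hu0 1
    have u2 := congrFun hu0 2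
    simp [u] at u0 u1 u2
    ext i
    fin_cases i <;> simp [u0, u1, u2]
  have h3 : Module.finrank ℝ (curlSpace a n (l + 3)) ≤ Module.finrank ℝ (LinearMap.ker B) := by
    rw [(Submodule.equivMapOfInjective (solenoidalBubbles a g (l + 2)).subtype
      (Submodule.subtype_injective _) (LinearMap.ker B)).finrank_eq]
    refine Submodule.finrank_mono fun w hw => ?_
    obtain ⟨⟨φ, hφ, hφw⟩, hwr⟩ := hw
    have hmem : w ∈ solenoidalBubbles a g (l + 2) := by
      rw [← hφw]
      refine h.curl_mem_solenoidalBubbles hφ.1 fun i x hx => ?_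
      let G : Fin 3 → Poly := fun m => C (g i m)
      have hG : ∀ x, evalVec x G = g i := by intro x; ext m; simp [G, evalVec]
      ext m
      have hp : ∀ x, eval x ((φ ⨯₃ G) m) = (evalVec x φ ⨯₃ g i) m := by
        intro x
        rw [← hG x, ← evalVec_cross]
        rfl
      rw [← hp]
      refine h.eval_eq_zero_of_face (fun y hy => ?_) hx
      rw [hp, (hgn.cross_iff i _).1 (hφ.2 i y hy)]
      rfl
    refine ⟨⟨w, hmem⟩, ?_, rfl⟩
    change B _ = 0
    ext c
    exact hwr _
  rw [h2, finrank_bot, Module.finrank_fin_fun] at h1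
  omega

end

end DivDivElement

namespace DivDivElement

noncomputable section

open MvPolynomial

variable {a g n : Fin 4 → Pt}

/-! ### The degrees of freedom as a linear map -/

/-- The integral of a polynomial over an edge. -/
def edgeIntegral (a : Fin 4 → Pt) (e : Edge) : Poly →ₗ[ℝ] ℝ where
  toFun p := integralE a e fun x => eval x p
  map_add' p q := by
    have hc : ∀ r : Poly, IntervalIntegrable (fun s : ℝ => eval (a e.1.1 + s • edgeVec a e) r *
        √(edgeVec a e ⬝ᵥ edgeVec a e)) MeasureTheory.volume 0 1 := fun r =>
      (((MvPolynomial.continuous_eval r).comp (by fun_prop)).mul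
        continuous_const).intervalIntegrable _ _
    simp only [integralE, map_add, add_mul]
    exact intervalIntegral.integral_add (hc p) (hc q)
  map_smul' c p := by
    simp only [integralE, smul_eval, mul_assoc, RingHom.id_apply, smul_eq_mul]
    exact intervalIntegral.integral_const_mul c _

/-- The integral of a polynomial over a face. -/
def faceIntegral (a : Fin 4 → Pt) (i : Fin 4) : Poly →ₗ[ℝ] ℝ where
  toFun p := integralF a i fun x => eval x p
  map_add' p q := by
    have hp : Continuous (facePoint a i) := by unfold facePoint; fun_prop
    have hc : ∀ (r : Poly) (c : ℝ), MeasureTheory.IntegrableOn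
        (fun z => eval (facePoint a i z) r * c) refTriangle := fun r c =>
      (((MvPolynomial.continuous_eval r).comp hp).mul
        continuous_const).continuousOn.integrableOn_compact isCompact_refTriangle
    simp only [integralF_eq, map_add, add_mul]
    exact MeasureTheory.integral_add (hc p _) (hc q _)
  map_smul' c p := by
    simp only [integralF_eq, smul_eval, mul_assoc, RingHom.id_apply, smul_eq_mul]
    exact MeasureTheory.integral_const_mul c _

theorem exists_poly_of_mem_polyOn {l : ℕ} {G : Set Pt} (q : polyOn l G) :
    ∃ r : Poly, ∀ x ∈ G, q.1 x = eval x r := by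
  obtain ⟨_, r, _, rfl⟩ := q
  exact ⟨r, fun x hx => restrictTo_apply_of_mem hx r⟩

/-- The moments of a polynomial against the polynomial functions on `G`, for an integral `I` over `G`
that is given by the linear functional `J` on polynomials. -/
def moment {G : Set Pt} (I : (Pt → ℝ) → ℝ) (J : Poly →ₗ[ℝ] ℝ)
    (hIJ : ∀ f p, (∀ x ∈ G, f x = eval x p) → I f = J p) (l : ℕ) :
    Poly →ₗ[ℝ] Module.Dual ℝ (polyOn l G) :=
  -- Only the functional `J` on polynomials is linear, so each test function is replaced by a
  -- polynomial agreeing with it on `G`.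
  have key : ∀ (p : Poly) {q : Pt → ℝ} {r : Poly}, (∀ x ∈ G, q x = eval x r) →
      (I fun x => eval x p * q x) = J (p * r) := fun p _ _ hr =>
    hIJ _ _ fun x hx => by rw [hr x hx, map_mul]
  LinearMap.mk₂ ℝ (fun p q => I fun x => eval x p * q.1 x)
    (fun p p' q => by
      obtain ⟨r, hr⟩ := exists_poly_of_mem_polyOn q
      rw [key _ hr, key _ hr, key _ hr, add_mul, map_add])
    (fun c p q => by
      obtain ⟨r, hr⟩ := exists_poly_of_mem_polyOn q
      rw [key _ hr, key _ hr, smul_mul_assoc, map_smul])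
    (fun p q q' => by
      obtain ⟨r, hr⟩ := exists_poly_of_mem_polyOn q
      obtain ⟨r', hr'⟩ := exists_poly_of_mem_polyOn q'
      have hs : ∀ x ∈ G, (q + q').1 x = eval x (r + r') := fun x hx => by
        rw [Submodule.coe_add, Pi.add_apply, hr x hx, hr' x hx, map_add]
      rw [key _ hr, key _ hr', key _ hs, mul_add, map_add])
    (fun c p q => by
      obtain ⟨r, hr⟩ := exists_poly_of_mem_polyOn q
      have hs : ∀ x ∈ G, (c • q).1 x = eval x (c • r) := fun x hx => by
        rw [Submodule.coe_smul, Pi.smul_apply, hr x hx, smul_eval, smul_eq_mul]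
      rw [key _ hr, key _ hs, mul_smul_comm, map_smul])

/-- The moments of a polynomial on an edge. -/
def edgeMoment (a : Fin 4 → Pt) (e : Edge) (l : ℕ) :
    Poly →ₗ[ℝ] Module.Dual ℝ (polyOn l (edge a e)) :=
  moment (integralE a e) (edgeIntegral a e) (fun _ _ hf => integralE_congr hf) l

/-- The moments of a polynomial on a face. -/
def IsDual.faceMoment (h : IsDual a g) (i : Fin 4) (l : ℕ) :
    Poly →ₗ[ℝ] Module.Dual ℝ (polyOn l (face a i)) :=
  moment (integralF a i) (faceIntegral a i) (fun _ _ hf => h.integralF_congr hf) l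

/-- The moments of a vector of polynomials on a face. -/
def IsDual.faceVecMoment (h : IsDual a g) (i : Fin 4) (l : ℕ) :
    (Fin 3 → Poly) →ₗ[ℝ] Module.Dual ℝ (Fin 3 → polyOn l (face a i)) :=
  ∑ j, LinearMap.lcomp ℝ ℝ (LinearMap.proj j) ∘ₗ h.faceMoment i l ∘ₗ LinearMap.proj j

theorem IsDual.faceVecMoment_apply (h : IsDual a g) (i : Fin 4) (l : ℕ) (v : Fin 3 → Poly)
    (φ : Fin 3 → polyOn l (face a i)) :
    h.faceVecMoment i l v φ = integralF a i fun x => evalVec x v ⬝ᵥ fun j => (φ j).1 x := by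
  choose r hr using fun j => exists_poly_of_mem_polyOn (φ j)
  have h1 : ∀ j, h.faceMoment i l (v j) (φ j) = faceIntegral a i (v j * r j) := by
    intro j
    change integralF a i (fun x => eval x (v j) * (φ j).1 x) =
      integralF a i (fun x => eval x (v j * r j))
    exact h.integralF_congr fun x hx => by rw [hr j x hx, map_mul]
  have h2 : (integralF a i fun x => evalVec x v ⬝ᵥ fun j => (φ j).1 x) =
      faceIntegral a i (∑ j, v j * r j) := by
    change _ = integralF a i (fun x => eval x (∑ j, v j * r j))
    refine h.integralF_congr fun x hx => ?_
    simp only [map_sum, map_mul, ← hr _ x hx]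
    rfl
  rw [h2, map_sum, ← Finset.sum_congr rfl fun j _ => h1 j]
  simp only [IsDual.faceVecMoment, LinearMap.sum_apply]
  rfl

/-- The pairing `(σ, τ)_K`. -/
def innerMatLinear (a : Fin 4 → Pt) :
    Matrix (Fin 3) (Fin 3) Poly →ₗ[ℝ] Module.Dual ℝ (Matrix (Fin 3) (Fin 3) Poly) :=
  LinearMap.mk₂ ℝ (innerMatK a)
    (fun u v w => by
      simp only [innerMatK, Matrix.add_apply, add_mul, Finset.sum_add_distrib, map_add])
    (fun c u v => by
      simp only [innerMatK, Matrix.smul_apply, smul_mul_assoc, ← Finset.smul_sum, map_smul])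
    (fun u v w => by
      simp only [innerMatK, Matrix.add_apply, mul_add, Finset.sum_add_distrib, map_add])
    (fun c u v => by
      simp only [innerMatK, Matrix.smul_apply, mul_smul_comm, ← Finset.smul_sum, map_smul])

/-- The gradient of a vector field as a linear map. -/
def gradLinear : (Fin 3 → Poly) →ₗ[ℝ] Matrix (Fin 3) (Fin 3) Poly where
  toFun := grad
  map_add' u v := by ext1 i j; simp [grad]
  map_smul' c v := by ext1 i j; simp [grad]

/-- The value at a vertex of a symmetric matrix field. -/
def vertexValue (a : Fin 4 → Pt) (k : ℕ) (i : Fin 4) : symPoly k →ₗ[ℝ] symMat ℝ where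
  toFun σ := ⟨evalMat (a i) σ.1, evalMat_transpose σ.2.1 _⟩
  map_add' σ τ := by
    apply Subtype.ext
    ext i j
    simp [evalMat]
  map_smul' c σ := by
    apply Subtype.ext
    ext i j
    simp [evalMat]

/-- The row vector field `σ m`. -/
def mulVecLinear (m : Pt) : Matrix (Fin 3) (Fin 3) Poly →ₗ[ℝ] (Fin 3 → Poly) :=
  LinearMap.pi fun j => biPoly (Pi.single j 1) m

theorem evalVec_mulVecLinear (m x : Pt) (σ : Matrix (Fin 3) (Fin 3) Poly) :
    evalVec x (mulVecLinear m σ) = evalMat x σ *ᵥ m := by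
  ext j
  rw [← single_one_dotProduct j (evalMat x σ *ᵥ m), ← eval_biPoly]
  rfl

/-- The space of all prescriptions of the degrees of freedom, as a vector space. -/
abbrev DofSpace (a n : Fin 4 → Pt) (k : ℕ) (N : Submodule ℝ (Matrix (Fin 3) (Fin 3) Poly)) : Type :=
  (Fin 4 → symMat ℝ) ×
  (∀ e : Edge, Fin 2 → Module.Dual ℝ (polyOn (k - 2) (edge a e))) ×
  (∀ e : Edge, NormalPair → Module.Dual ℝ (polyOn (k - 2) (edge a e))) ×
  (∀ i : Fin 4, Module.Dual ℝ (Fin 3 → polyOn (k - 3) (face a i))) ×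
  (∀ i : Fin 4, Module.Dual ℝ (polyOn (k - 1) (face a i))) ×
  Module.Dual ℝ (hessians (k - 2)) ×
  Module.Dual ℝ (curlSpace a n k) ×
  Module.Dual ℝ N

/-- A prescription of the degrees of freedom as a vector. -/
def DofData.toDofSpace {k : ℕ} {N : Submodule ℝ (Matrix (Fin 3) (Fin 3) Poly)}
    (d : DofData a n k N) : DofSpace a n k N :=
  (d.vertex, d.edgeTN, d.edgeNN, d.faceNormal, d.faceDiv, d.interiorHess, d.interiorCurl,
    d.interiorTensor)

variable {t : Edge → Pt} {ν : Edge → Fin 2 → Pt} {k : ℕ}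
  {N : Submodule ℝ (Matrix (Fin 3) (Fin 3) Poly)}

/-- The degrees of freedom of a symmetric matrix field. -/
def IsDual.dofMap (h : IsDual a g) (n : Fin 4 → Pt) (t : Edge → Pt) (ν : Edge → Fin 2 → Pt) (k : ℕ)
    (N : Submodule ℝ (Matrix (Fin 3) (Fin 3) Poly)) : symPoly k →ₗ[ℝ] DofSpace a n k N :=
  (LinearMap.pi (vertexValue a k)).prod <|
  (LinearMap.pi fun e => LinearMap.pi fun j =>
    edgeMoment a e (k - 2) ∘ₗ biPoly (t e) (ν e j) ∘ₗ (symPoly k).subtype).prod <|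
  (LinearMap.pi fun e => LinearMap.pi fun p : NormalPair =>
    edgeMoment a e (k - 2) ∘ₗ biPoly (ν e p.1.1) (ν e p.1.2) ∘ₗ (symPoly k).subtype).prod <|
  (LinearMap.pi fun i =>
    h.faceVecMoment i (k - 3) ∘ₗ mulVecLinear (n i) ∘ₗ (symPoly k).subtype).prod <|
  (LinearMap.pi fun i =>
    h.faceMoment i (k - 1) ∘ₗ dotPoly (n i) ∘ₗ divLinear ∘ₗ (symPoly k).subtype).prod <|
  (LinearMap.lcomp ℝ ℝ (hessians (k - 2)).subtype ∘ₗ innerMatLinear a ∘ₗ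
    (symPoly k).subtype).prod <|
  (LinearMap.lcomp ℝ ℝ (gradLinear ∘ₗ (curlSpace a n k).subtype) ∘ₗ innerMatLinear a ∘ₗ
    (symPoly k).subtype).prod <|
  LinearMap.lcomp ℝ ℝ N.subtype ∘ₗ innerMatLinear a ∘ₗ (symPoly k).subtype

theorem edgeMoment_biPoly (e : Edge) (l : ℕ) (u w : Pt) (σ : Matrix (Fin 3) (Fin 3) Poly)
    (q : polyOn l (edge a e)) :
    edgeMoment a e l (biPoly u w σ) q =
      integralE a e fun x => (u ⬝ᵥ (evalMat x σ *ᵥ w)) * q.1 x := by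
  simp only [← eval_biPoly]
  rfl

theorem IsDual.faceMoment_dotPoly (h : IsDual a g) (i : Fin 4) (l : ℕ) (m : Pt) (v : Fin 3 → Poly)
    (q : polyOn l (face a i)) :
    h.faceMoment i l (dotPoly m v) q = integralF a i fun x => (evalVec x v ⬝ᵥ m) * q.1 x := by
  simp only [← eval_dotPoly]
  rfl

theorem IsDual.faceVecMoment_mulVecLinear (h : IsDual a g) (i : Fin 4) (l : ℕ) (m : Pt)
    (σ : Matrix (Fin 3) (Fin 3) Poly) (φ : Fin 3 → polyOn l (face a i)) :
    h.faceVecMoment i l (mulVecLinear m σ) φ =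
      integralF a i fun x => (evalMat x σ *ᵥ m) ⬝ᵥ fun j => (φ j).1 x := by
  rw [h.faceVecMoment_apply]
  simp only [evalVec_mulVecLinear]

theorem IsDual.hasDofs_iff (h : IsDual a g) (d : DofData a n k N) (σ : symPoly k) :
    HasDofs a n t ν k N d σ.1 ↔ h.dofMap n t ν k N σ = d.toDofSpace := by
  constructor
  · intro H
    refine Prod.ext (funext fun i => Subtype.ext (H.vertex i)) <|
      Prod.ext (funext fun e => funext fun j => LinearMap.ext fun q =>
        (edgeMoment_biPoly _ _ _ _ _ _).trans (H.edgeTN e j q)) <|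
      Prod.ext (funext fun e => funext fun p => LinearMap.ext fun q =>
        (edgeMoment_biPoly _ _ _ _ _ _).trans (H.edgeNN e p q)) <|
      Prod.ext (funext fun i => LinearMap.ext fun φ =>
        (h.faceVecMoment_mulVecLinear _ _ _ _ _).trans (H.faceNormal i φ)) <|
      Prod.ext (funext fun i => LinearMap.ext fun q =>
        (h.faceMoment_dotPoly _ _ _ _ _).trans (H.faceDiv i q)) <|
      Prod.ext (LinearMap.ext H.interiorHess) <|
      Prod.ext (LinearMap.ext H.interiorCurl) (LinearMap.ext H.interiorTensor)
  · intro H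
    obtain ⟨H1, H⟩ := Prod.ext_iff.1 H
    obtain ⟨H2, H⟩ := Prod.ext_iff.1 H
    obtain ⟨H3, H⟩ := Prod.ext_iff.1 H
    obtain ⟨H4, H⟩ := Prod.ext_iff.1 H
    obtain ⟨H5, H⟩ := Prod.ext_iff.1 H
    obtain ⟨H6, H⟩ := Prod.ext_iff.1 H
    obtain ⟨H7, H8⟩ := Prod.ext_iff.1 H
    exact
      { vertex := fun i => congrArg Subtype.val (congrFun H1 i)
        edgeTN := fun e j q => (edgeMoment_biPoly _ _ _ _ _ _).symm.trans
          (LinearMap.congr_fun (congrFun (congrFun H2 e) j) q)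
        edgeNN := fun e p q => (edgeMoment_biPoly _ _ _ _ _ _).symm.trans
          (LinearMap.congr_fun (congrFun (congrFun H3 e) p) q)
        faceNormal := fun i φ => (h.faceVecMoment_mulVecLinear _ _ _ _ _).symm.trans
          (LinearMap.congr_fun (congrFun H4 i) φ)
        faceDiv := fun i q => (h.faceMoment_dotPoly _ _ _ _ _).symm.trans
          (LinearMap.congr_fun (congrFun H5 i) q)
        interiorHess := LinearMap.congr_fun H6
        interiorCurl := LinearMap.congr_fun H7
        interiorTensor := LinearMap.congr_fun H8 }

/-- Stated for every last test space containing `𝓜_k`, so that it serves both the unisolvent element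
and its enlargement. -/
theorem IsDual.dofMap_injective (h : IsDual a g) (hgn : UnitNormals g n)
    (ht : ∀ e, IsEdgeTangent a e (t e)) (hν : ∀ e, AreEdgeNormals a e (ν e)) (hk : 3 ≤ k)
    (hN : (spaceM a n (k + 2)).map curlCurlStar ≤ N) :
    Function.Injective (h.dofMap n t ν k N) := by
  rw [injective_iff_map_eq_zero]
  intro σ hσ
  let d : DofData a n k N := ⟨0, 0, 0, 0, 0, 0, 0, 0⟩
  have H : HasDofs a n t ν k N d σ.1 := (h.hasDofs_iff d σ).2 hσ
  exact Subtype.ext (h.eq_zero_of_dofs hgn ht hν hk hN σ.2 H.vertex H.edgeTN H.edgeNN H.faceNormal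
    H.faceDiv H.interiorHess H.interiorCurl H.interiorTensor)

/-! ### Counting the degrees of freedom -/

instance (l : ℕ) : FiniteDimensional ℝ (spaceW a n l) :=
  Submodule.finiteDimensional_of_le (fun _ hφ => hφ.1 : spaceW a n l ≤ vecPoly l)

instance (l : ℕ) : FiniteDimensional ℝ (curlSpace a n l) :=
  Submodule.finiteDimensional_of_le (fun _ hw => hw.1 : curlSpace a n l ≤ (spaceW a n l).map curl)

instance (l : ℕ) : FiniteDimensional ℝ (spaceM a n l) :=
  Submodule.finiteDimensional_of_le (fun _ hτ => hτ.1.1 : spaceM a n l ≤ symPoly l)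

set_option synthInstance.maxHeartbeats 400000 in
instance [FiniteDimensional ℝ N] : FiniteDimensional ℝ (DofSpace a n k N) :=
  inferInstance

theorem finrank_prod_eq_add {V W : Type*} [AddCommGroup V] [Module ℝ V] [FiniteDimensional ℝ V]
    [AddCommGroup W] [Module ℝ W] [FiniteDimensional ℝ W] {p q : ℕ}
    (hV : Module.finrank ℝ V = p) (hW : Module.finrank ℝ W = q) :
    Module.finrank ℝ (V × W) = p + q := by
  rw [Module.finrank_prod, hV, hW]

set_option synthInstance.maxHeartbeats 400000 in
set_option maxHeartbeats 800000 in
theorem finrank_dofSpace [FiniteDimensional ℝ N] :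
    Module.finrank ℝ (DofSpace a n k N) = numberOfDofs a n k N := by
  have h1 : Module.finrank ℝ (Fin 4 → symMat ℝ) = ∑ _i : Fin 4, Module.finrank ℝ (symMat ℝ) :=
    Module.finrank_pi_fintype ℝ
  have h2 : ∀ (ι : Type) [Fintype ι],
      Module.finrank ℝ (∀ e : Edge, ι → Module.Dual ℝ (polyOn (k - 2) (edge a e))) =
        ∑ e : Edge, ∑ _j : ι, Module.finrank ℝ (polyOn (k - 2) (edge a e)) := fun ι _ => by
    rw [Module.finrank_pi_fintype]
    refine Finset.sum_congr rfl fun e _ => ?_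
    rw [Module.finrank_pi_fintype, Subspace.dual_finrank_eq]
  have h3 : Module.finrank ℝ (∀ i : Fin 4, Module.Dual ℝ (Fin 3 → polyOn (k - 3) (face a i))) =
      ∑ i : Fin 4, Module.finrank ℝ (Fin 3 → polyOn (k - 3) (face a i)) := by
    rw [Module.finrank_pi_fintype]
    exact Finset.sum_congr rfl fun i _ => Subspace.dual_finrank_eq
  have h4 : Module.finrank ℝ (∀ i : Fin 4, Module.Dual ℝ (polyOn (k - 1) (face a i))) =
      ∑ i : Fin 4, Module.finrank ℝ (polyOn (k - 1) (face a i)) := by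
    rw [Module.finrank_pi_fintype]
    exact Finset.sum_congr rfl fun i _ => Subspace.dual_finrank_eq
  have h5 := Subspace.dual_finrank_eq (K := ℝ) (V := hessians (k - 2))
  have h6 := Subspace.dual_finrank_eq (K := ℝ) (V := curlSpace a n k)
  have h7 := Subspace.dual_finrank_eq (K := ℝ) (V := N)
  have p6 := finrank_prod_eq_add h6 h7
  have p5 := finrank_prod_eq_add h5 p6
  have p4 := finrank_prod_eq_add h4 p5
  have p3 := finrank_prod_eq_add h3 p4
  have p2 := finrank_prod_eq_add (h2 NormalPair) p3
  have p1 := finrank_prod_eq_add (h2 (Fin 2)) p2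
  refine (finrank_prod_eq_add h1 p1).trans ?_
  rw [numberOfDofs, Finset.sum_add_distrib]
  ring

theorem two_mul_choose_two (m : ℕ) : 2 * (m + 2).choose 2 = (m + 2) * (m + 1) := by
  have := Nat.add_one_mul_choose_eq (m + 1) 1
  rw [Nat.choose_one_right] at this
  linarith

theorem six_mul_choose_three (m : ℕ) : 6 * (m + 3).choose 3 = (m + 3) * (m + 2) * (m + 1) := by
  have h1 := Nat.add_one_mul_choose_eq (m + 2) 2
  have h2 := two_mul_choose_two m
  calc 6 * (m + 3).choose 3 = 2 * ((m + 2 + 1).choose (2 + 1) * (2 + 1)) := by ring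
    _ = (m + 3) * (2 * (m + 2).choose 2) := by rw [← h1]; ring
    _ = _ := by rw [h2]; ring

/-- The bounds for the test spaces add up to `24 + 30(k-1) + 6(k-1)(k-2) + 2k(k+1) + 10 C(k+1,3) - 4
C(k+2,3)`, which equals the product on the right. -/
theorem IsDual.numberOfDofs_le (h : IsDual a g) (hgn : UnitNormals g n) (hk : 3 ≤ k) :
    numberOfDofs a n k ((spaceM a n (k + 2)).map curlCurlStar) ≤ (k + 1) * (k + 2) * (k + 3) := by
  obtain ⟨l, rfl⟩ : ∃ l, k = l + 3 := ⟨k - 3, by omega⟩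
  have hE : ∑ e : Edge, (∑ _j : Fin 2, Module.finrank ℝ (polyOn (l + 3 - 2) (edge a e))
        + ∑ _p : NormalPair, Module.finrank ℝ (polyOn (l + 3 - 2) (edge a e))) ≤
      6 * (5 * (l + 2)) := by
    refine (Finset.sum_le_card_nsmul _ _ (5 * (l + 2)) fun e _ => ?_).trans_eq ?_
    · have := h.finrank_polyOn_edge_le (l + 1) e
      have hc : Fintype.card NormalPair = 3 := rfl
      rw [Finset.sum_const, Finset.sum_const, Finset.card_univ, Finset.card_univ, hc,
        Fintype.card_fin, smul_eq_mul, smul_eq_mul]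
      change 2 * Module.finrank ℝ (polyOn (l + 1) (edge a e)) +
        3 * Module.finrank ℝ (polyOn (l + 1) (edge a e)) ≤ _
      omega
    · rfl
  have hF : ∑ i : Fin 4, Module.finrank ℝ (Fin 3 → polyOn (l + 3 - 3) (face a i)) ≤
      4 * (3 * (l + 2).choose 2) := by
    refine (Finset.sum_le_card_nsmul _ _ (3 * (l + 2).choose 2) fun i _ => ?_).trans_eq rfl
    rw [Module.finrank_pi_fintype, Finset.sum_const, Finset.card_univ, Fintype.card_fin,
      smul_eq_mul]
    exact Nat.mul_le_mul_left 3 (h.finrank_polyOn_face_le l i)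
  have hD : ∑ i : Fin 4, Module.finrank ℝ (polyOn (l + 3 - 1) (face a i)) ≤
      4 * (l + 4).choose 2 :=
    (Finset.sum_le_card_nsmul _ _ _ fun i _ => h.finrank_polyOn_face_le (l + 2) i).trans_eq rfl
  have hV : ∑ _i : Fin 4, Module.finrank ℝ (symMat ℝ) = 24 := by
    rw [finrank_symMat]; rfl
  have hH : Module.finrank ℝ (hessians (l + 3 - 2)) + 4 ≤ (l + 4).choose 3 :=
    finrank_hessians_add_le (Nat.le_add_left 1 l)
  have hC := h.finrank_curlSpace_add_le hgn l
  have hS : Module.finrank ℝ (solenoidalBubbles a g (l + 2)) + (l + 5).choose 3 ≤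
      3 * (l + 4).choose 3 + 1 := h.finrank_solenoidalBubbles_add_le (l + 1)
  have hM : Module.finrank ℝ ((spaceM a n (l + 3 + 2)).map curlCurlStar) +
      3 * (l + 5).choose 3 ≤ 6 * (l + 4).choose 3 + 6 := h.finrank_map_spaceM_add_le hgn (l + 1)
  have c1 := two_mul_choose_two l
  have c2 := two_mul_choose_two (l + 2)
  have c3 := six_mul_choose_three (l + 1)
  have c4 := six_mul_choose_three (l + 2)
  simp only [add_assoc, Nat.reduceAdd] at c2 c3 c4 hC
  unfold numberOfDofs
  simp only [add_assoc, Nat.reduceAdd] at hE hF hD hV hH hM ⊢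
  nlinarith

end

end DivDivElement

/-! ### Unisolvence from injectivity and the dimension count -/

theorem mainTheorem2 (a : Fin 4 → Pt) (ha : AffineIndependent ℝ a)
    (n : Fin 4 → Pt) (hn : ∀ i, IsOuterNormal a i (n i))
    (t : Edge → Pt) (ht : ∀ e, IsEdgeTangent a e (t e))
    (ν : Edge → Fin 2 → Pt) (hν : ∀ e, AreEdgeNormals a e (ν e))
    (k : ℕ) (hk : 3 ≤ k) :
    (∀ g : DofData a n k ((spaceM a n (k + 2)).map curlCurlStar),
      ∃! σ : Matrix (Fin 3) (Fin 3) Poly, σ ∈ symPoly k ∧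
        HasDofs a n t ν k ((spaceM a n (k + 2)).map curlCurlStar) g σ) ∧
    numberOfDofs a n k ((spaceM a n (k + 2)).map curlCurlStar) = (k + 1) * (k + 2) * (k + 3) ∧
    Module.finrank ℝ (symPoly k) = (k + 1) * (k + 2) * (k + 3) ∧
    (∀ g : DofData a n k ((tangentialFree a n (k + 2)).map curlCurlStar),
      ∀ σ ∈ symPoly k, ∀ τ ∈ symPoly k,
        HasDofs a n t ν k ((tangentialFree a n (k + 2)).map curlCurlStar) g σ →
        HasDofs a n t ν k ((tangentialFree a n (k + 2)).map curlCurlStar) g τ → σ = τ) := by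
  obtain ⟨b, h, hbn⟩ := exists_isDual hn
  have hdim : Module.finrank ℝ (symPoly k) = (k + 1) * (k + 2) * (k + 3) := by
    rw [finrank_symPoly, six_mul_choose_three]
    ring
  have hinj := h.dofMap_injective hbn ht hν hk le_rfl
  have hnum : numberOfDofs a n k ((spaceM a n (k + 2)).map curlCurlStar) =
      (k + 1) * (k + 2) * (k + 3) := by
    -- The lower bound for the number of degrees of freedom is injectivity itself, so all the
    -- separate upper bounds are attained.
    refine (h.numberOfDofs_le hbn hk).antisymm ?_
    rw [← hdim, ← finrank_dofSpace]
    exact LinearMap.finrank_le_finrank_of_injective hinj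
  refine ⟨fun d => ?_, hnum, hdim, fun d σ hσ τ hτ hdσ hdτ => ?_⟩
  · have hsurj := (LinearMap.injective_iff_surjective_of_finrank_eq_finrank
      (by rw [hdim, finrank_dofSpace, hnum])).1 hinj
    obtain ⟨σ, hσ⟩ := hsurj d.toDofSpace
    refine ⟨σ, ⟨σ.2, (h.hasDofs_iff d σ).2 hσ⟩, fun τ ⟨hτ, hdτ⟩ => ?_⟩
    exact congrArg Subtype.val (hinj (((h.hasDofs_iff d ⟨τ, hτ⟩).1 hdτ).trans hσ.symm))
  · have hle : (spaceM a n (k + 2)).map curlCurlStar ≤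
        (tangentialFree a n (k + 2)).map curlCurlStar := Submodule.map_mono fun _ hτ => hτ.1
    have hinj' := h.dofMap_injective hbn ht hν hk hle
    exact congrArg Subtype.val (hinj' (((h.hasDofs_iff d ⟨σ, hσ⟩).1 hdσ).trans
      ((h.hasDofs_iff d ⟨τ, hτ⟩).1 hdτ).symm))
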